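/- Let $G$ be a directed acyclic graph with a finite vertex set $X$, $n$ vertices and $m$ edges. A linear order $L$ on $X$ is *compatible* with $G$ if $x <_L y$ for every edge $x \to y$ of $G$, and $e(G)$ denotes the number of linear orders on $X$ that are compatible with $G$; compatibility with, and $e(H)$ for, any other directed graph $H$ are defined in the same way. Logarithms are to base 2. The model of computation is a word RAM with words of $w = \log(n+m+1) + O(1)$ bits (or more), in which the vertices are the numbers $0,\dots,n-1$ and the graph is given as a list of its edges in arbitrary order. The items are compared through an oracle that decides in one step whether $x <_L y$ for two items $x, y \in X$, where $L$ is an unknown linear order compatible with $G$. There are a preprocessing program, which does not compare items, a sorting program, and an absolute constant, on which the $O$-notation is based, such that the following holds for every directed acyclic graph $G$. 1. (Preprocessing phase.) Given $G$, the preprocessing program computes in $O(n+m+1)$ time a subset $Y \subseteq X$ with $|Y| = O(\log e(G))$ and a directed graph $H$ with vertex set $Y$ and $O(m)$ edges. It outputs $Y$ as an array, and $H$ as a list of its edges. 2. If $L$ is a linear order on $X$ compatible with $G$, then the restriction of $L$ to $Y$ is compatible with $H$. Conversely, every linear order on $Y$ compatible with $H$ is the restriction to $Y$ of some linear order on $X$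 compatible with $G$. In particular $e(H) \le e(G)$. 3. (Sorting phase.) Let $L$ be any linear order on $X$ compatible with $G$. If, after the preprocessing phase, the array of $Y$ is replaced by the array of the elements of $Y$ in increasing order with respect to $L$, then the sorting program, using comparisons with respect to $L$, computes the sorted order of $X$ with respect to $L$ in $O(1+\log e(G))$ time. The output is a linked list, that is, a pointer to the smallest item, together with a table in memory that stores the successor of each item. -/

import Mathlib

/-! ### Directed acyclic graphs and compatible linear orders -/

namespace DagSort

/-- `G` has no directed cycle (in particular no loop). -/
def IsDag {V : Type*} (G : Digraph V) : Prop :=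
  ∀ v, ¬ Relation.TransGen G.Adj v v

/-- The linear order `L` is compatible with `G`: every edge goes from a smaller to a larger item. -/
def Compatible {V : Type*} (G : Digraph V) (L : LinearOrder V) : Prop :=
  ∀ u v, G.Adj u v → L.lt u v

/-- `e(G)`: the number of linear orders on the vertex set that are compatible with `G`. -/
noncomputable def numOrders {V : Type*} (G : Digraph V) : ℕ :=
  Nat.card {L : LinearOrder V // Compatible G L}

/-- The restriction of a linear order to a subset. -/
abbrev restrictOrder {V : Type*} (L : LinearOrder V) (Y : Finset V) : LinearOrder Y :=
  @LinearOrder.lift' Y V L Subtype.val Subtype.val_injective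

/-- `es` lists every edge of `G` exactly once; so `es.length` is the number of edges. -/
def IsEdgeList {V : Type*} (G : Digraph V) (es : List (V × V)) : Prop :=
  es.Nodup ∧ ∀ u v, (u, v) ∈ es ↔ G.Adj u v

/-- `l` is the list of the elements of `S` in increasing order with respect to `L`. -/
def IsSortedListOf {V : Type*} (L : LinearOrder V) (S : Finset V) (l : List V) : Prop :=
  l.Pairwise L.lt ∧ ∀ x, x ∈ l ↔ x ∈ S

end DagSort

/-! ### A word RAM with a comparison oracle

Programs are structured programs over registers and a random access memory. A machine word is a
natural number below `W = 2 ^ w`. Every elementary operation (including one comparison of two items)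
costs one unit of time; an operation whose result is not a machine word blocks the execution. -/

namespace WordRAM

/-- The configuration of the machine: contents of the registers and of the memory cells. -/
structure State where
  reg : ℕ → ℕ
  mem : ℕ → ℕ

/-- `load a` is the content of the memory cell with address `a`; `less a b` asks the comparison
oracle whether item `a` is smaller than item `b`. Truth values are the words `1` and `0`. -/
inductive Expr where
  | const (c : ℕ)
  | reg (r : ℕ)
  | load (a : Expr)
  | add (a b : Expr)
  | sub (a b : Expr)
  | mul (a b : Expr)
  | div (a b : Expr)
  | eq (a b : Expr)
  | lt (a b : Expr)
  | less (a b : Expr)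

/-- The value of an expression, where `ord` is the comparison oracle. Subtraction is truncated at
`0`, and division is integer division with `x / 0 = 0`. -/
def Expr.eval (ord : ℕ → ℕ → Bool) (s : State) : Expr → ℕ
  | .const c => c
  | .reg r => s.reg r
  | .load a => s.mem (a.eval ord s)
  | .add a b => a.eval ord s + b.eval ord s
  | .sub a b => a.eval ord s - b.eval ord s
  | .mul a b => a.eval ord s * b.eval ord s
  | .div a b => a.eval ord s / b.eval ord s
  | .eq a b => if a.eval ord s = b.eval ord s then 1 else 0
  | .lt a b => if a.eval ord s < b.eval ord s then 1 else 0
  | .less a b => if ord (a.eval ord s) (b.eval ord s) then 1 else 0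

/-- No overflow: all constants and intermediate results that occur in the evaluation of the
expression are below `W` (given that all registers and memory cells are). -/
def Expr.Fits (W : ℕ) (ord : ℕ → ℕ → Bool) (s : State) : Expr → Prop
  | .const c => c < W
  | .reg _ => True
  | .load a => a.Fits W ord s
  | .add a b => a.Fits W ord s ∧ b.Fits W ord s ∧ a.eval ord s + b.eval ord s < W
  | .mul a b => a.Fits W ord s ∧ b.Fits W ord s ∧ a.eval ord s * b.eval ord s < W
  | .sub a b => a.Fits W ord s ∧ b.Fits W ord s
  | .div a b => a.Fits W ord s ∧ b.Fits W ord s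
  | .eq a b => a.Fits W ord s ∧ b.Fits W ord s
  | .lt a b => a.Fits W ord s ∧ b.Fits W ord s
  | .less a b => a.Fits W ord s ∧ b.Fits W ord s

/-- The time to evaluate an expression: the number of its elementary operations. -/
def Expr.cost : Expr → ℕ
  | .const _ => 1
  | .reg _ => 1
  | .load a => a.cost + 1
  | .add a b => a.cost + b.cost + 1
  | .sub a b => a.cost + b.cost + 1
  | .mul a b => a.cost + b.cost + 1
  | .div a b => a.cost + b.cost + 1
  | .eq a b => a.cost + b.cost + 1
  | .lt a b => a.cost + b.cost + 1
  | .less a b => a.cost + b.cost + 1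

/-- The expression does not compare items. -/
def Expr.ComparisonFree : Expr → Prop
  | .const _ => True
  | .reg _ => True
  | .load a => a.ComparisonFree
  | .add a b => a.ComparisonFree ∧ b.ComparisonFree
  | .sub a b => a.ComparisonFree ∧ b.ComparisonFree
  | .mul a b => a.ComparisonFree ∧ b.ComparisonFree
  | .div a b => a.ComparisonFree ∧ b.ComparisonFree
  | .eq a b => a.ComparisonFree ∧ b.ComparisonFree
  | .lt a b => a.ComparisonFree ∧ b.ComparisonFree
  | .less _ _ => False

/-- Programs. `assign r e` puts the value of `e` into register `r`; `store a e` puts the value of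
`e` into the memory cell with address `a`; `cond` and `loop` are `if` and `while`. -/
inductive Cmd where
  | skip
  | assign (r : ℕ) (e : Expr)
  | store (a e : Expr)
  | seq (c d : Cmd)
  | cond (e : Expr) (c d : Cmd)
  | loop (e : Expr) (c : Cmd)

/-- The program does not compare items. -/
def Cmd.ComparisonFree : Cmd → Prop
  | .skip => True
  | .assign _ e => e.ComparisonFree
  | .store a e => a.ComparisonFree ∧ e.ComparisonFree
  | .seq c d => c.ComparisonFree ∧ d.ComparisonFree
  | .cond e c d => e.ComparisonFree ∧ c.ComparisonFree ∧ d.ComparisonFree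
  | .loop e c => e.ComparisonFree ∧ c.ComparisonFree

/-- `Exec W ord c s s' t`: on a machine with words below `W` and comparison oracle `ord`, the
program `c`, started in configuration `s`, halts without overflow in configuration `s'` after
exactly `t` units of time. -/
inductive Exec (W : ℕ) (ord : ℕ → ℕ → Bool) : Cmd → State → State → ℕ → Prop
  | skip (s : State) : Exec W ord .skip s s 1
  | assign (s : State) (r : ℕ) (e : Expr) (he : e.Fits W ord s) :
      Exec W ord (.assign r e) s ⟨Function.update s.reg r (e.eval ord s), s.mem⟩ (e.cost + 1)
  | store (s : State) (a e : Expr) (ha : a.Fits W ord s) (he : e.Fits W ord s) :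
      Exec W ord (.store a e) s
        ⟨s.reg, Function.update s.mem (a.eval ord s) (e.eval ord s)⟩ (a.cost + e.cost + 1)
  | seq {s s' s'' : State} {c d : Cmd} {t t' : ℕ}
      (hc : Exec W ord c s s' t) (hd : Exec W ord d s' s'' t') :
      Exec W ord (.seq c d) s s'' (t + t')
  | condTrue {s s' : State} {e : Expr} {c d : Cmd} {t : ℕ}
      (he : e.Fits W ord s) (h : e.eval ord s ≠ 0) (hc : Exec W ord c s s' t) :
      Exec W ord (.cond e c d) s s' (e.cost + 1 + t)
  | condFalse {s s' : State} {e : Expr} {c d : Cmd} {t : ℕ}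
      (he : e.Fits W ord s) (h : e.eval ord s = 0) (hd : Exec W ord d s s' t) :
      Exec W ord (.cond e c d) s s' (e.cost + 1 + t)
  | loopDone {s : State} {e : Expr} {c : Cmd}
      (he : e.Fits W ord s) (h : e.eval ord s = 0) :
      Exec W ord (.loop e c) s s (e.cost + 1)
  | loopStep {s s' s'' : State} {e : Expr} {c : Cmd} {t t' : ℕ}
      (he : e.Fits W ord s) (h : e.eval ord s ≠ 0)
      (hc : Exec W ord c s s' t) (hl : Exec W ord (.loop e c) s' s'' t') :
      Exec W ord (.loop e c) s s'' (e.cost + 1 + t + t')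

/-- Consecutive memory cells from address `A` on hold the words of `l`. -/
def HoldsArray (mem : ℕ → ℕ) (A : ℕ) (l : List ℕ) : Prop :=
  ∀ (i : ℕ) (h : i < l.length), mem (A + i) = l[i]

/-- The memory `mem` after the words of `l` were written to consecutive cells from `A` on. -/
def writeArray (mem : ℕ → ℕ) (A : ℕ) (l : List ℕ) : ℕ → ℕ :=
  fun a => if h : A ≤ a ∧ a - A < l.length then l[a - A]'h.2 else mem a

/-- A singly linked list: `p` is its first item (`null` if the list is empty), and for each
item `x` of the list, cell `A + x` holds the next item, or `null` after the last one. -/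
def HoldsLinkedList (mem : ℕ → ℕ) (A null : ℕ) : ℕ → List ℕ → Prop
  | p, [] => p = null
  | p, x :: l => p = x ∧ HoldsLinkedList mem A null (mem (A + x)) l

/-- The words that encode an edge list: tail and head of each edge in turn. -/
def encodeEdges (es : List (ℕ × ℕ)) : List ℕ :=
  es.flatMap fun e => [e.1, e.2]

/-- The initial configuration for a graph with vertices `0, …, n - 1`: register `0` holds `n`,
register `1` holds the number of edges, the edge list is stored from memory cell `0` on, and
everything else is `0`. -/
def inputState (n : ℕ) (es : List (Fin n × Fin n)) : State where
  reg := fun r => if r = 0 then n else if r = 1 then es.length else 0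
  mem := writeArray (fun _ => 0) 0 (encodeEdges (es.map fun e => (e.1.val, e.2.val)))

/-- The comparison oracle for items `0, …, n - 1` under the linear order `L`. -/
noncomputable def oracle {n : ℕ} (L : LinearOrder (Fin n)) : ℕ → ℕ → Bool :=
  open Classical in
  fun a b => if h : a < n ∧ b < n then decide (L.lt ⟨a, h.1⟩ ⟨b, h.2⟩) else false

end WordRAM

/-! Let the level of a vertex be the number of vertices on a longest path that ends there, and let
`P` be a longest path, with `k` vertices. It has exactly one vertex on each level. A vertex outside
`P` can be put on either side of the path vertex of its own level, independently of all others,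
while the levels stay in order. Hence `2 ^ (n - k) ≤ e(G)` (`two_pow_le_numOrders`). The set `Y`
consists of the vertices outside `P` together with the last predecessor and the first successor on
`P` of each of them, so `|Y| ≤ 3 * (n - k) ≤ 3 * log e(G)`.

The edges of `H` join consecutive kept vertices of `P`; added to them are the edges of `G` between
kept vertices that are not both on `P`. These are at most `(k - 1) + m ≤ 2 * m` edges. An order on
`Y` that is compatible with `H` extends to all vertices: every omitted path vertex goes behind the
last kept path vertex before it. An edge between an omitted path vertex and a vertex `v` outside `P`
is then respected because the last predecessor and the first successor of `v` are kept
(`KeptVertices.exists_extension`).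

Sorting starts from `P` as a linked list and goes through the sorted `Y`. A vertex `y` outside `P`
is inserted by exponential and binary search on `P`, starting at the previous item of `Y`; passing
`d` path vertices costs `O(1 + log (d + 1))`. The items between the previous item of `Y` and `y` are
omitted path vertices, and none of them is a predecessor of `y`, because the last predecessor of `y`
on `P` is kept. So `y` may be moved down past any number of them, independently for all `y`, and the
product of the numbers `d + 1` is at most `e(G)` (`prod_le_numOrders`). All searches together take
`O(|Y| + log e(G))` time.

The programs are written in a language with 20 arrays of common length `N` that is compiled to the
word RAM. By `AExec.compile_spec` the time is at most a constant times one plus the number of loop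
iterations, so only iterations have to be counted; `wp_loop` does this with a potential. Levels come
from topological sorting with a first-in-first-out queue, which visits the levels in increasing
order. -/

/-! ### A small imperative language with arrays, compiled to the word RAM -/

namespace ArrayLang

open WordRAM

/-- Contents of the registers and of the arrays. -/
structure AState where
  reg : ℕ → ℕ
  arr : ℕ → ℕ → ℕ

/-- The state after a register assignment. -/
def AState.setReg (σ : AState) (r v : ℕ) : AState := ⟨Function.update σ.reg r v, σ.arr⟩

/-- The state after an assignment to an array element. -/
def AState.setArr (σ : AState) (k i v : ℕ) : AState :=
  ⟨σ.reg, Function.update σ.arr k (Function.update (σ.arr k) i v)⟩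

@[simp] theorem AState.setReg_reg (σ : AState) (r v r' : ℕ) :
    (σ.setReg r v).reg r' = if r' = r then v else σ.reg r' := by
  simp [setReg, Function.update_apply]

@[simp] theorem AState.setReg_arr (σ : AState) (r v : ℕ) : (σ.setReg r v).arr = σ.arr := rfl

@[simp] theorem AState.setArr_reg (σ : AState) (k i v : ℕ) : (σ.setArr k i v).reg = σ.reg := rfl

@[simp] theorem AState.setArr_arr (σ : AState) (k i v k' : ℕ) :
    (σ.setArr k i v).arr k' = if k' = k then Function.update (σ.arr k) i v else σ.arr k' := by
  by_cases h : k' = k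
  · subst h; simp [setArr]
  · simp [setArr, h]

/-- The truth value of `a = b`. -/
def testEq (a b : ℕ) : ℕ := if a = b then 1 else 0

/-- The truth value of `a < b`. -/
def testLt (a b : ℕ) : ℕ := if a < b then 1 else 0

@[simp] theorem testEq_eq_zero {a b : ℕ} : testEq a b = 0 ↔ ¬ a = b := by
  simp only [testEq]; split_ifs with h <;> simp [h]

@[simp] theorem testLt_eq_zero {a b : ℕ} : testLt a b = 0 ↔ ¬ a < b := by
  simp only [testLt]; split_ifs with h <;> simp [h]

/-- Expressions; `arr k e` is the element of array `k` with index `e`. -/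
inductive AExpr where
  | const (c : ℕ)
  | reg (r : ℕ)
  | arr (k : ℕ) (e : AExpr)
  | add (a b : AExpr)
  | sub (a b : AExpr)
  | div (a b : AExpr)
  | eq (a b : AExpr)
  | lt (a b : AExpr)
  | less (a b : AExpr)

namespace AExpr

/-- The value of an expression. -/
@[simp] def eval (ord : ℕ → ℕ → Bool) (σ : AState) : AExpr → ℕ
  | const c => c
  | reg r => σ.reg r
  | arr k e => σ.arr k (e.eval ord σ)
  | add a b => a.eval ord σ + b.eval ord σ
  | sub a b => a.eval ord σ - b.eval ord σ
  | div a b => a.eval ord σ / b.eval ord σ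
  | eq a b => testEq (a.eval ord σ) (b.eval ord σ)
  | lt a b => testLt (a.eval ord σ) (b.eval ord σ)
  | less a b => (ord (a.eval ord σ) (b.eval ord σ)).toNat

/-- Sufficient conditions for the evaluation without overflow and inside the arrays of size `N`. -/
@[simp] def Ok (N : ℕ) (ord : ℕ → ℕ → Bool) (σ : AState) : AExpr → Prop
  | const c => c < 20
  | reg _ => True
  | arr k e => k < 20 ∧ e.Ok N ord σ ∧ e.eval ord σ < N
  | add a b => a.Ok N ord σ ∧ b.Ok N ord σ ∧ a.eval ord σ + b.eval ord σ < 20 * N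
  | sub a b => a.Ok N ord σ ∧ b.Ok N ord σ
  | div a b => a.Ok N ord σ ∧ b.Ok N ord σ
  | eq a b => a.Ok N ord σ ∧ b.Ok N ord σ
  | lt a b => a.Ok N ord σ ∧ b.Ok N ord σ
  | less a b => a.Ok N ord σ ∧ b.Ok N ord σ

/-- The machine expression for the address of an array element. Register `9` holds the array
size. -/
def address (k : ℕ) (e : Expr) : Expr := .add (.mul (.const k) (.reg 9)) e

/-- Compilation of expressions. -/
def compile : AExpr → Expr
  | const c => .const c
  | reg r => .reg r
  | arr k e => .load (address k e.compile)
  | add a b => .add a.compile b.compile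
  | sub a b => .sub a.compile b.compile
  | div a b => .div a.compile b.compile
  | eq a b => .eq a.compile b.compile
  | lt a b => .lt a.compile b.compile
  | less a b => .less a.compile b.compile

end AExpr

/-- Programs; `store k i e` assigns to the element of array `k` with index `i`. -/
inductive ACmd where
  | skip
  | assign (r : ℕ) (e : AExpr)
  | store (k : ℕ) (i e : AExpr)
  | seq (c d : ACmd)
  | cond (e : AExpr) (c d : ACmd)
  | loop (e : AExpr) (c : ACmd)

namespace ACmd

/-- Sequential composition of a list of programs. -/
def block : List ACmd → ACmd
  | [] => skip
  | c :: cs => seq c (block cs)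

/-- Compilation of programs. -/
def compile : ACmd → Cmd
  | skip => .skip
  | assign r e => .assign r e.compile
  | store k i e => .store (AExpr.address k i.compile) e.compile
  | seq c d => .seq c.compile d.compile
  | cond e c d => .cond e.compile c.compile d.compile
  | loop e c => .loop e.compile c.compile

/-- The time of one pass through all parts of a program. -/
def size : ACmd → ℕ
  | skip => 1
  | assign _ e => e.compile.cost + 1
  | store k i e => (AExpr.address k i.compile).cost + e.compile.cost + 1
  | seq c d => c.size + d.size
  | cond e c d => e.compile.cost + 1 + c.size + d.size
  | loop e c => e.compile.cost + 1 + c.size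

end ACmd

/-- `AExec N ord c σ σ' k`: program `c` started in `σ` halts in `σ'` after `k` loop iterations. -/
inductive AExec (N : ℕ) (ord : ℕ → ℕ → Bool) : ACmd → AState → AState → ℕ → Prop
  | skip (σ : AState) : AExec N ord .skip σ σ 0
  | assign (σ : AState) (r : ℕ) (e : AExpr) (hr : r ≠ 9) (he : e.Ok N ord σ) :
      AExec N ord (.assign r e) σ (σ.setReg r (e.eval ord σ)) 0
  | store (σ : AState) (k : ℕ) (i e : AExpr) (hk : k < 20) (hi : i.Ok N ord σ)
      (hiN : i.eval ord σ < N) (he : e.Ok N ord σ) :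
      AExec N ord (.store k i e) σ (σ.setArr k (i.eval ord σ) (e.eval ord σ)) 0
  | seq {σ σ' σ'' : AState} {c d : ACmd} {k k' : ℕ}
      (hc : AExec N ord c σ σ' k) (hd : AExec N ord d σ' σ'' k') :
      AExec N ord (.seq c d) σ σ'' (k + k')
  | condTrue {σ σ' : AState} {e : AExpr} {c d : ACmd} {k : ℕ}
      (he : e.Ok N ord σ) (h : e.eval ord σ ≠ 0) (hc : AExec N ord c σ σ' k) :
      AExec N ord (.cond e c d) σ σ' k
  | condFalse {σ σ' : AState} {e : AExpr} {c d : ACmd} {k : ℕ}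
      (he : e.Ok N ord σ) (h : e.eval ord σ = 0) (hd : AExec N ord d σ σ' k) :
      AExec N ord (.cond e c d) σ σ' k
  | loopDone {σ : AState} {e : AExpr} {c : ACmd}
      (he : e.Ok N ord σ) (h : e.eval ord σ = 0) :
      AExec N ord (.loop e c) σ σ 0
  | loopStep {σ σ' σ'' : AState} {e : AExpr} {c : ACmd} {k k' : ℕ}
      (he : e.Ok N ord σ) (h : e.eval ord σ ≠ 0)
      (hc : AExec N ord c σ σ' k) (hl : AExec N ord (.loop e c) σ' σ'' k') :
      AExec N ord (.loop e c) σ σ'' (k + k' + 1)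

/-- The machine configuration `s` represents `σ` with arrays of size `N`. -/
structure Represents (N : ℕ) (s : State) (σ : AState) : Prop where
  reg : s.reg = σ.reg
  size : σ.reg 9 = N
  mem : ∀ k i, i < N → s.mem (k * N + i) = σ.arr k i

/-- The 20 arrays are laid out consecutively and fill the first `20 * N` cells. -/
theorem array_address_lt {N W k i : ℕ} (hW : 20 * N ≤ W) (hk : k < 20) (hi : i < N) :
    k * N + i < W := by
  have : (k + 1) * N ≤ 20 * N := Nat.mul_le_mul_right N hk
  rw [Nat.add_mul] at this
  omega

theorem array_address_inj {N k i k' i' : ℕ} (hi : i < N) (hi' : i' < N)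
    (h : k * N + i = k' * N + i') : k = k' ∧ i = i' := by
  have hN : 0 < N := by omega
  have h1 : (k * N + i) / N = k := by
    rw [Nat.add_comm, Nat.add_mul_div_right _ _ hN, Nat.div_eq_of_lt hi, Nat.zero_add]
  have h2 : (k' * N + i') / N = k' := by
    rw [Nat.add_comm, Nat.add_mul_div_right _ _ hN, Nat.div_eq_of_lt hi', Nat.zero_add]
  have h3 : k = k' := by rw [← h1, h, h2]
  subst h3
  exact ⟨rfl, by omega⟩

theorem AExpr.compile_spec {N W : ℕ} {ord : ℕ → ℕ → Bool} (hN : 0 < N) (hW : 20 * N ≤ W)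
    {s : State} {σ : AState} (hs : Represents N s σ) (e : AExpr) (he : e.Ok N ord σ) :
    e.compile.Fits W ord s ∧ e.compile.eval ord s = e.eval ord σ := by
  induction e with
  | const c => simp only [Ok] at he; exact ⟨show c < W by omega, rfl⟩
  | reg r => simp [compile, Expr.Fits, Expr.eval, hs.reg]
  | arr k e ih =>
    obtain ⟨hk, h1, h2⟩ := he
    obtain ⟨h3, h4⟩ := ih h1
    have h5 := array_address_lt hW hk h2
    simp only [compile, address, Expr.Fits, Expr.eval, eval, h4, hs.reg, hs.size]
    refine ⟨⟨⟨by omega, trivial, by omega⟩, h3, h5⟩, hs.mem _ _ h2⟩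
  | add a b iha ihb =>
    obtain ⟨h1, h2, h3⟩ := he
    simp only [compile, Expr.Fits, Expr.eval, eval, (iha h1).2, (ihb h2).2]
    exact ⟨⟨(iha h1).1, (ihb h2).1, by omega⟩, trivial⟩
  | less a b iha ihb =>
    obtain ⟨h1, h2⟩ := he
    simp only [compile, Expr.Fits, Expr.eval, eval, (iha h1).2, (ihb h2).2]
    refine ⟨⟨(iha h1).1, (ihb h2).1⟩, ?_⟩
    cases ord (a.eval ord σ) (b.eval ord σ) <;> rfl
  | eq a b iha ihb | lt a b iha ihb =>
    obtain ⟨h1, h2⟩ := he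
    simp only [compile, Expr.Fits, Expr.eval, eval, (iha h1).2, (ihb h2).2]
    exact ⟨⟨(iha h1).1, (ihb h2).1⟩, rfl⟩
  | sub a b iha ihb | div a b iha ihb =>
    obtain ⟨h1, h2⟩ := he
    simp only [compile, Expr.Fits, Expr.eval, eval, (iha h1).2, (ihb h2).2]
    exact ⟨⟨(iha h1).1, (ihb h2).1⟩, trivial⟩

/-- The compiled program simulates the program, with time proportional to the number of loop
iterations. -/
theorem AExec.compile_spec {N W : ℕ} {ord : ℕ → ℕ → Bool} (hN : 0 < N) (hW : 20 * N ≤ W)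
    {c : ACmd} {σ σ' : AState} {k : ℕ} (h : AExec N ord c σ σ' k) {s : State}
    (hs : Represents N s σ) :
    ∃ s' t, Exec W ord c.compile s s' t ∧ Represents N s' σ' ∧ t ≤ c.size * (k + 1) := by
  induction h generalizing s with
  | skip σ => exact ⟨s, 1, .skip s, hs, by simp [ACmd.size]⟩
  | assign σ r e hr he =>
    obtain ⟨h1, h2⟩ := e.compile_spec hN hW hs he
    refine ⟨_, _, .assign s r e.compile h1, ⟨?_, ?_, hs.mem⟩, by simp [ACmd.size]⟩
    · simp [AState.setReg, hs.reg, h2]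
    · simp [Ne.symm hr, hs.size]
  | store σ k i e hk hi hiN he =>
    obtain ⟨h1, h2⟩ := i.compile_spec hN hW hs hi
    obtain ⟨h3, h4⟩ := e.compile_spec hN hW hs he
    have h5 := array_address_lt hW hk hiN
    have h6 : (AExpr.address k i.compile).Fits W ord s := by
      simp only [AExpr.address, Expr.Fits, Expr.eval, h2, hs.reg, hs.size]
      exact ⟨⟨by omega, trivial, by omega⟩, h1, h5⟩
    have h7 : (AExpr.address k i.compile).eval ord s = k * N + i.eval ord σ := by
      simp only [AExpr.address, Expr.eval, h2, hs.reg, hs.size]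
    refine ⟨_, _, .store s _ e.compile h6 h3, ⟨hs.reg, hs.size, ?_⟩, by simp [ACmd.size]⟩
    intro k' i' hi'
    simp only [h7, h4, Function.update_apply, AState.setArr_arr]
    by_cases hkk : k' = k
    · subst hkk
      simp only [if_true, Function.update_apply, hs.mem _ _ hi', Nat.add_left_cancel_iff]
    · rw [if_neg hkk, if_neg, hs.mem _ _ hi']
      exact fun h => hkk (array_address_inj hi' hiN h).1
  | @seq _ _ _ c d _ _ _ _ ihc ihd =>
    obtain ⟨s1, t1, e1, r1, l1⟩ := ihc hs
    obtain ⟨s2, t2, e2, r2, l2⟩ := ihd r1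
    refine ⟨s2, _, .seq e1 e2, r2, ?_⟩
    simp only [ACmd.size]
    nlinarith [Nat.zero_le (c.size), Nat.zero_le (d.size)]
  | @condTrue _ _ e c d k he h _ ih =>
    obtain ⟨h1, h2⟩ := e.compile_spec hN hW hs he
    obtain ⟨s1, t1, e1, r1, l1⟩ := ih hs
    refine ⟨s1, _, .condTrue h1 (by rwa [h2]) e1, r1, ?_⟩
    simp only [ACmd.size]
    nlinarith [Nat.zero_le (e.compile.cost * k), Nat.zero_le (d.size * k)]
  | @condFalse _ _ e c d k he h _ ih =>
    obtain ⟨h1, h2⟩ := e.compile_spec hN hW hs he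
    obtain ⟨s1, t1, e1, r1, l1⟩ := ih hs
    refine ⟨s1, _, .condFalse h1 (by rwa [h2]) e1, r1, ?_⟩
    simp only [ACmd.size]
    nlinarith [Nat.zero_le (e.compile.cost * k), Nat.zero_le (c.size * k)]
  | @loopDone _ e c he h =>
    obtain ⟨h1, h2⟩ := e.compile_spec hN hW hs he
    exact ⟨s, _, .loopDone h1 (by rwa [h2]), hs, by simp only [ACmd.size]; omega⟩
  | @loopStep _ _ _ e c k k' he h _ _ ihc ihl =>
    obtain ⟨h1, h2⟩ := e.compile_spec hN hW hs he
    obtain ⟨s1, t1, e1, r1, l1⟩ := ihc hs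
    obtain ⟨s2, t2, e2, r2, l2⟩ := ihl r1
    refine ⟨s2, _, .loopStep h1 (by rwa [h2]) e1 e2, r2, ?_⟩
    -- With `size` that of the whole loop, this iteration costs at most `size * (k + 1)` and the
    -- remaining ones at most `size * (k' + 1)`, which adds up to `size * (k + k' + 2)`.
    simp only [ACmd.size] at l2 ⊢
    nlinarith [Nat.zero_le (e.compile.cost * k)]

/-! #### Weakest preconditions -/

/-- Started in `σ`, program `c` halts, and `Q` holds for the final state and the number of loop
iterations. -/
def WP (N : ℕ) (ord : ℕ → ℕ → Bool) (c : ACmd) (σ : AState) (Q : AState → ℕ → Prop) : Prop :=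
  ∃ σ' k, AExec N ord c σ σ' k ∧ Q σ' k

section
variable {N : ℕ} {ord : ℕ → ℕ → Bool} {σ : AState} {Q : AState → ℕ → Prop}

theorem WP.mono {c : ACmd} {Q' : AState → ℕ → Prop} (h : WP N ord c σ Q)
    (hQ : ∀ σ' k, Q σ' k → Q' σ' k) : WP N ord c σ Q' := by
  obtain ⟨σ', k, h1, h2⟩ := h
  exact ⟨σ', k, h1, hQ _ _ h2⟩

@[simp] theorem wp_skip : WP N ord .skip σ Q ↔ Q σ 0 := by
  constructor
  · rintro ⟨_, _, ⟨⟩, h⟩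
    exact h
  · exact fun h => ⟨_, _, .skip σ, h⟩

@[simp] theorem wp_assign {r : ℕ} {e : AExpr} : WP N ord (.assign r e) σ Q ↔
    r ≠ 9 ∧ e.Ok N ord σ ∧ Q (σ.setReg r (e.eval ord σ)) 0 := by
  constructor
  · rintro ⟨_, _, ⟨⟩, h⟩
    exact ⟨‹_›, ‹_›, h⟩
  · exact fun ⟨h1, h2, h⟩ => ⟨_, _, .assign σ r e h1 h2, h⟩

@[simp] theorem wp_store {k : ℕ} {i e : AExpr} : WP N ord (.store k i e) σ Q ↔
    k < 20 ∧ i.Ok N ord σ ∧ i.eval ord σ < N ∧ e.Ok N ord σ ∧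
      Q (σ.setArr k (i.eval ord σ) (e.eval ord σ)) 0 := by
  constructor
  · rintro ⟨_, _, ⟨⟩, h⟩
    exact ⟨‹_›, ‹_›, ‹_›, ‹_›, h⟩
  · exact fun ⟨h1, h2, h3, h4, h⟩ => ⟨_, _, .store σ k i e h1 h2 h3 h4, h⟩

@[simp] theorem wp_seq {c d : ACmd} : WP N ord (.seq c d) σ Q ↔
    WP N ord c σ fun σ' k => WP N ord d σ' fun σ'' k' => Q σ'' (k + k') := by
  constructor
  · rintro ⟨_, _, ⟨⟩, h⟩
    exact ⟨_, _, ‹_›, _, _, ‹_›, h⟩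
  · rintro ⟨_, _, h1, _, _, h2, h⟩
    exact ⟨_, _, .seq h1 h2, h⟩

@[simp] theorem wp_block_cons {c : ACmd} {cs : List ACmd} : WP N ord (.block (c :: cs)) σ Q ↔
    WP N ord c σ fun σ' k => WP N ord (.block cs) σ' fun σ'' k' => Q σ'' (k + k') :=
  wp_seq

@[simp] theorem wp_block_nil : WP N ord (.block []) σ Q ↔ Q σ 0 :=
  wp_skip

@[simp] theorem wp_cond {e : AExpr} {c d : ACmd} : WP N ord (.cond e c d) σ Q ↔
    e.Ok N ord σ ∧ (e.eval ord σ ≠ 0 → WP N ord c σ Q) ∧ (e.eval ord σ = 0 → WP N ord d σ Q) := by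
  constructor
  · rintro ⟨_, _, h, hQ⟩
    cases h with
    | condTrue h1 h2 h3 => exact ⟨h1, fun _ => ⟨_, _, h3, hQ⟩, fun h => absurd h h2⟩
    | condFalse h1 h2 h3 => exact ⟨h1, fun h => absurd h2 h, fun _ => ⟨_, _, h3, hQ⟩⟩
  · rintro ⟨h1, h2, h3⟩
    by_cases h : e.eval ord σ = 0
    · obtain ⟨_, _, h4, h5⟩ := h3 h
      exact ⟨_, _, .condFalse h1 h h4, h5⟩
    · obtain ⟨_, _, h4, h5⟩ := h2 h
      exact ⟨_, _, .condTrue h1 h h4, h5⟩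

/-- The loop rule: `I p` is the loop invariant with `p` the number of iterations (also of inner
loops) that remain available. -/
theorem wp_loop {e : AExpr} {c : ACmd} (I : ℕ → AState → Prop) (p : ℕ) (h0 : I p σ)
    (hok : ∀ p σ, I p σ → e.Ok N ord σ)
    (hstep : ∀ p σ, I p σ → e.eval ord σ ≠ 0 →
      WP N ord c σ fun σ' k => ∃ p', p' + k + 1 ≤ p ∧ I p' σ')
    (hQ : ∀ p' σ' k, I p' σ' → e.eval ord σ' = 0 → p' + k ≤ p → Q σ' k) :
    WP N ord (.loop e c) σ Q := by
  suffices H : ∀ p σ, I p σ → WP N ord (.loop e c) σ fun σ' k =>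
      ∃ p', p' + k ≤ p ∧ I p' σ' ∧ e.eval ord σ' = 0 by
    obtain ⟨σ', k, h1, p', h2, h3, h4⟩ := H p σ h0
    exact ⟨σ', k, h1, hQ p' σ' k h3 h4 h2⟩
  intro p
  induction p using Nat.strong_induction_on with
  | _ p ih =>
    intro σ hI
    by_cases h : e.eval ord σ = 0
    · exact ⟨σ, 0, .loopDone (hok _ _ hI) h, p, le_rfl, hI, h⟩
    · obtain ⟨σ1, k1, h1, p1, h2, h3⟩ := hstep p σ hI h
      obtain ⟨σ2, k2, h4, p2, h5, h6, h7⟩ := ih p1 (by omega) σ1 h3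
      exact ⟨σ2, _, .loopStep (hok _ _ hI) h h1 h4, p2, by omega, h6, h7⟩

/-- The rule for a loop that counts in register `r` up to the bound `M` in register `b`. -/
theorem wp_for {r b : ℕ} {c : ACmd} (M : ℕ) (J : ℕ → AState → Prop) (h0 : J 0 σ)
    (hr : ∀ i σ, J i σ → σ.reg r = i ∧ σ.reg b = M)
    (hstep : ∀ i σ, i < M → J i σ → WP N ord c σ fun σ' k => k = 0 ∧ J (i + 1) σ')
    (hQ : ∀ σ' k, J M σ' → k ≤ M → Q σ' k) :
    WP N ord (.loop (.lt (.reg r) (.reg b)) c) σ Q := by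
  refine wp_loop (fun p σ => ∃ i, J i σ ∧ i + p = M) M ⟨0, h0, Nat.zero_add M⟩ (by simp) ?_ ?_
  · rintro p σ ⟨i, hJ, hp⟩ he
    obtain ⟨h1, h2⟩ := hr i σ hJ
    simp only [AExpr.eval, ne_eq, testLt_eq_zero, not_not, h1, h2] at he
    refine (hstep i σ he hJ).mono ?_
    rintro σ' k ⟨rfl, h3⟩
    exact ⟨p - 1, by omega, i + 1, h3, by omega⟩
  · rintro p σ' k ⟨i, hJ, hp⟩ he hk
    obtain ⟨h1, h2⟩ := hr i σ' hJ
    simp only [AExpr.eval, testLt_eq_zero, h1, h2] at he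
    have : i = M := by omega
    exact hQ σ' k (this ▸ hJ) (by omega)

end

end ArrayLang

/-! ### Preprocessing: adjacency lists and topological sorting -/

namespace ArrayLang

/-- An acyclic graph with vertices `0, …, n - 1` and edges `0, …, m - 1`, given by the tails and heads
of its edges. Acyclicity is witnessed by a numbering of the vertices. -/
structure EdgeArray where
  n : ℕ
  m : ℕ
  tail : ℕ → ℕ
  head : ℕ → ℕ
  rank : ℕ → ℕ
  tail_lt : ∀ j < m, tail j < n
  head_lt : ∀ j < m, head j < n
  inj : ∀ i < m, ∀ j < m, tail i = tail j → head i = head j → i = j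
  rank_lt : ∀ j < m, rank (tail j) < rank (head j)

/-- The size of the arrays. -/
abbrev EdgeArray.N (g : EdgeArray) : ℕ := 2 * (g.n + g.m + 1)

/-- The graph is stored in registers `4`, `5` and in array `0`. -/
structure Stores (g : EdgeArray) (σ : AState) : Prop where
  r4 : σ.reg 4 = g.n
  r5 : σ.reg 5 = g.m
  tail : ∀ j < g.m, σ.arr 0 (j + j) = g.tail j
  head : ∀ j < g.m, σ.arr 0 (j + j + 1) = g.head j

theorem Stores.congr {g : EdgeArray} {σ σ' : AState} (h : Stores g σ) (h4 : σ'.reg 4 = σ.reg 4)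
    (h5 : σ'.reg 5 = σ.reg 5) (h0 : σ'.arr 0 = σ.arr 0) : Stores g σ' :=
  ⟨h4.trans h.r4, h5.trans h.r5, fun j hj => by rw [h0, h.tail j hj],
    fun j hj => by rw [h0, h.head j hj]⟩

/-- One plus the last edge before `j` with tail `u`, or `0` if there is none. -/
def lastEdge (T : ℕ → ℕ) (u : ℕ) : ℕ → ℕ
  | 0 => 0
  | j + 1 => if T j = u then j + 1 else lastEdge T u j

theorem lastEdge_le (T : ℕ → ℕ) (u j : ℕ) : lastEdge T u j ≤ j := by
  induction j with
  | zero => simp [lastEdge]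
  | succ j ih => simp only [lastEdge]; split_ifs <;> omega

/-- This makes a single number a cursor in an adjacency list: the edges with tail `u` that are still
to be visited are exactly those with index below the cursor. -/
theorem lt_lastEdge {T : ℕ → ℕ} {u i j : ℕ} (hij : i < j) (hi : T i = u) : i < lastEdge T u j := by
  induction j with
  | zero => omega
  | succ j ih =>
    simp only [lastEdge]
    split_ifs with h
    · omega
    · refine ih ?_
      rcases Nat.lt_succ_iff_lt_or_eq.mp hij with h1 | h1
      · exact h1
      · subst h1; exact absurd hi h

theorem tail_lastEdge {T : ℕ → ℕ} {u j : ℕ} (h : lastEdge T u j ≠ 0) :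
    T (lastEdge T u j - 1) = u := by
  induction j with
  | zero => simp [lastEdge] at h
  | succ j ih =>
    simp only [lastEdge] at h ⊢
    split_ifs at h ⊢ with h1
    · simpa using h1
    · exact ih h

/-- Builds linked adjacency lists (arrays `1`, `2`) and counts the incoming edges (array `3`). -/
def buildAdjacency : ACmd := .loop (.lt (.reg 6) (.reg 5)) (.block [
  .assign 7 (.arr 0 (.add (.reg 6) (.reg 6))),
  .assign 8 (.arr 0 (.add (.add (.reg 6) (.reg 6)) (.const 1))),
  .store 2 (.reg 6) (.arr 1 (.reg 7)),
  .store 1 (.reg 7) (.add (.reg 6) (.const 1)),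
  .store 3 (.reg 8) (.add (.arr 3 (.reg 8)) (.const 1)),
  .assign 6 (.add (.reg 6) (.const 1))])

/-- The adjacency structure of the first `j` edges. -/
structure AdjInv (g : EdgeArray) (j : ℕ) (σ : AState) : Prop extends Stores g σ where
  first : ∀ u < g.n, σ.arr 1 u = lastEdge g.tail u j
  next : ∀ i < j, σ.arr 2 i = lastEdge g.tail (g.tail i) i
  indeg : ∀ v < g.n, σ.arr 3 v = ((Finset.range j).filter fun i => g.head i = v).card
  zero : ∀ k, 4 ≤ k → ∀ i, σ.arr k i = 0

variable {ord : ℕ → ℕ → Bool}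

theorem wp_buildAdjacency {g : EdgeArray} {σ : AState} {Q : AState → ℕ → Prop}
    (h : Stores g σ) (h6 : σ.reg 6 = 0) (h0 : ∀ k, 1 ≤ k → ∀ i, σ.arr k i = 0)
    (hQ : ∀ σ' k, AdjInv g g.m σ' → k ≤ g.m → Q σ' k) :
    WP g.N ord buildAdjacency σ Q := by
  refine wp_for g.m (fun j σ => AdjInv g j σ ∧ σ.reg 6 = j) ⟨⟨h, ?_, ?_, ?_, ?_⟩, h6⟩
    (fun i σ h => ⟨h.2, h.1.r5⟩) ?_ (fun σ' k h => hQ σ' k h.1)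
  · simp [lastEdge, h0]
  · simp
  · simp [h0]
  · exact fun k hk => h0 k (by omega)
  · rintro j σ hj ⟨hI, h6⟩
    have ht := hI.tail _ hj
    have hh := hI.head _ hj
    have ht1 := g.tail_lt _ hj
    have hh1 := g.head_lt _ hj
    have hd := hI.indeg _ hh1
    have hdle : σ.arr 3 (g.head j) ≤ j := by
      rw [hd]; exact (Finset.card_filter_le _ _).trans (by simp)
    have hN : g.N = 2 * (g.n + g.m + 1) := rfl
    simp [ht, hh, h6]
    -- The leading conjuncts are the range and overflow checks of the instructions; what remains is
    -- the invariant.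
    repeat refine And.intro (by omega) ?_
    refine ⟨hI.toStores.congr (by simp) (by simp) (by simp), ?_, ?_, ?_, ?_⟩
    · intro u hu
      simp
      simp only [lastEdge, Function.update_apply, hI.first u hu, eq_comm]
    · intro i hi
      simp [Function.update_apply]
      split_ifs with h1
      · subst h1; exact hI.first _ ht1
      · exact hI.next i (by omega)
    · intro v hv
      simp [Function.update_apply, Finset.range_add_one, Finset.filter_insert]
      by_cases h1 : v = g.head j
      · subst h1; simp [hd]
      · rw [if_neg h1, if_neg (Ne.symm h1), hI.indeg v hv]
    · intro k hk i
      have := hI.zero k hk i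
      have h1 : k ≠ 1 := by omega
      have h2 : k ≠ 2 := by omega
      have h3 : k ≠ 3 := by omega
      simpa [h1, h2, h3] using this

/-- Consecutive elements of an array, from index `0` on, form the list `l`. -/
def Holds (f : ℕ → ℕ) (l : List ℕ) : Prop := ∀ (i : ℕ) (h : i < l.length), f i = l[i]

theorem Holds.nil (f : ℕ → ℕ) : Holds f [] := fun i h => by simp at h

theorem Holds.append {f : ℕ → ℕ} {l : List ℕ} (h : Holds f l) {a : ℕ} (ha : a = l.length)
    (v : ℕ) : Holds (Function.update f a v) (l ++ [v]) := by
  intro i hi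
  subst ha
  simp only [List.length_append, List.length_singleton] at hi
  rw [Function.update_apply, List.getElem_append]
  by_cases h1 : i < l.length
  · rw [if_neg (by omega), dif_pos h1, h i h1]
  · rw [if_pos (by omega), dif_neg h1]
    simp

/-- Puts the vertices without incoming edges into the queue (array `4`), with level `1`
(array `6`). -/
def initQueue : ACmd := .loop (.lt (.reg 6) (.reg 4)) (.block [
  .cond (.eq (.arr 3 (.reg 6)) (.const 0))
    (.block [
      .store 4 (.reg 11) (.reg 6),
      .assign 11 (.add (.reg 11) (.const 1)),
      .store 6 (.reg 6) (.const 1)])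
    .skip,
  .assign 6 (.add (.reg 6) (.const 1))])

/-- The queue after the first `j` vertices have been considered. -/
structure QueueInv (g : EdgeArray) (d : ℕ → ℕ) (j : ℕ) (q : List ℕ) (σ : AState) : Prop
    extends Stores g σ where
  first : ∀ u < g.n, σ.arr 1 u = lastEdge g.tail u g.m
  next : ∀ i < g.m, σ.arr 2 i = lastEdge g.tail (g.tail i) i
  indeg : σ.arr 3 = d
  queue : Holds (σ.arr 4) q
  len : σ.reg 11 = q.length
  nodup : q.Nodup
  mem : ∀ x, x ∈ q ↔ x < j ∧ d x = 0
  lev : ∀ x ∈ q, σ.arr 6 x = 1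
  pred : ∀ x, σ.arr 5 x = 0
  zero : ∀ k, 7 ≤ k → ∀ i, σ.arr k i = 0

/-- Keeps the queue and the list of kept vertices inside their arrays. -/
theorem length_le_of_nodup_of_lt {q : List ℕ} {n : ℕ} (hq : q.Nodup) (h : ∀ x ∈ q, x < n) :
    q.length ≤ n := by
  rw [← List.toFinset_card_of_nodup hq]
  calc _ ≤ (Finset.range n).card := Finset.card_le_card fun x hx => by simpa using h x (by simpa using hx)
    _ = n := by simp

theorem wp_initQueue {g : EdgeArray} {σ : AState} {Q : AState → ℕ → Prop}
    (h : AdjInv g g.m σ) (h6 : σ.reg 6 = 0) (h11 : σ.reg 11 = 0)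
    (hQ : ∀ σ' k q, QueueInv g (σ.arr 3) g.n q σ' → k ≤ g.n → Q σ' k) :
    WP g.N ord initQueue σ Q := by
  refine wp_for g.n (fun j σ' => (∃ q, QueueInv g (σ.arr 3) j q σ') ∧ σ'.reg 6 = j)
    ⟨⟨[], ⟨h.toStores, h.first, h.next, rfl, .nil _, h11, List.nodup_nil, by simp, by simp,
      h.zero 5 (by simp), fun k hk => h.zero k (by omega)⟩⟩, h6⟩
    (fun i σ h => ⟨h.2, h.1.choose_spec.r4⟩) ?_ (fun σ' k ⟨⟨q, hq⟩, _⟩ => hQ σ' k q hq)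
  rintro j σ' hj ⟨⟨q, hI⟩, h6⟩
  have hN : g.N = 2 * (g.n + g.m + 1) := rfl
  have hlen : q.length ≤ g.n :=
    length_le_of_nodup_of_lt hI.nodup fun x hx => by have := (hI.mem x).1 hx; omega
  have hjq : j ∉ q := fun h => by have := (hI.mem j).1 h; omega
  simp [h6, hI.indeg, hI.len]
  refine ⟨by omega, fun hz => ?_, fun hz => ?_⟩
  · repeat refine And.intro (by omega) ?_
    refine ⟨q ++ [j], hI.toStores.congr (by simp) (by simp) (by simp), by simpa using hI.first,
      by simpa using hI.next, by simpa using hI.indeg, by simpa using hI.queue.append rfl j,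
      by simp, by simpa [List.nodup_append] using ⟨hI.nodup, fun x hx h => hjq (h ▸ hx)⟩,
      ?_, ?_, by simpa using hI.pred, ?_⟩
    · intro x
      simp only [List.mem_append, hI.mem x, List.mem_singleton]
      constructor
      · rintro (h1 | rfl)
        · omega
        · exact ⟨by omega, hz⟩
      · rintro ⟨h1, h2⟩
        by_cases h3 : x = j
        · exact .inr h3
        · exact .inl ⟨by omega, h2⟩
    · intro x hx
      simp only [List.mem_append, List.mem_singleton] at hx
      by_cases h3 : x = j
      · simp [h3]
      · simpa [Function.update_apply, h3] using hI.lev x (by tauto)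
    · intro k hk i
      have h4 : k ≠ 4 := by omega
      have h6 : k ≠ 6 := by omega
      simpa [h4, h6] using hI.zero k hk i
  · refine ⟨by omega, q, hI.toStores.congr (by simp) (by simp) (by simp), by simpa using hI.first,
      by simpa using hI.next, by simpa using hI.indeg, by simpa using hI.queue,
      by simpa using hI.len, hI.nodup, ?_, by simpa using hI.lev, by simpa using hI.pred,
      by simpa using hI.zero⟩
    intro x
    rw [hI.mem x]
    constructor
    · rintro ⟨h1, h2⟩; exact ⟨by omega, h2⟩
    · rintro ⟨h1, h2⟩
      refine ⟨?_, h2⟩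
      have : x ≠ j := by rintro rfl; exact hz h2
      omega

end ArrayLang

/-! ### Levels by topological sorting -/

namespace ArrayLang

variable {ord : ℕ → ℕ → Bool}

theorem testLt_le_one (a b : ℕ) : testLt a b ≤ 1 := by
  simp only [testLt]; split_ifs <;> omega

/-- Topological sorting with a queue. Register `7` is one plus the current edge of the current vertex
(register `8`) with level in register `13`; registers `10` and `11` are the ends of the queue. -/
def topoSort : ACmd := .loop (.add (.reg 7) (.lt (.reg 10) (.reg 11))) (.cond (.reg 7)
  (.block [
    .assign 7 (.sub (.reg 7) (.const 1)),
    .assign 12 (.arr 0 (.add (.add (.reg 7) (.reg 7)) (.const 1))),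
    .store 3 (.reg 12) (.sub (.arr 3 (.reg 12)) (.const 1)),
    .cond (.arr 3 (.reg 12)) .skip (.block [
      .store 4 (.reg 11) (.reg 12),
      .assign 11 (.add (.reg 11) (.const 1)),
      .store 5 (.reg 12) (.add (.reg 8) (.const 1)),
      .store 6 (.reg 12) (.add (.reg 13) (.const 1))]),
    .assign 7 (.arr 2 (.reg 7))])
  (.block [
    .assign 8 (.arr 4 (.reg 10)),
    .assign 10 (.add (.reg 10) (.const 1)),
    .assign 13 (.arr 6 (.reg 8)),
    .assign 7 (.arr 1 (.reg 8))]))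

/-- The invariant of topological sorting: `q` is the queue and `U` the set of edges that have not
been processed. -/
structure TopoInv (g : EdgeArray) (q : List ℕ) (U : Finset ℕ) (σ : AState) : Prop
    extends Stores g σ where
  first : ∀ u < g.n, σ.arr 1 u = lastEdge g.tail u g.m
  next : ∀ i < g.m, σ.arr 2 i = lastEdge g.tail (g.tail i) i
  queue : Holds (σ.arr 4) q
  len : σ.reg 11 = q.length
  nodup : q.Nodup
  lt : ∀ x ∈ q, x < g.n
  pos_le : σ.reg 10 ≤ q.length
  undone : ∀ j, j ∈ U ↔ j < g.m ∧
    (g.tail j ∈ q.take (σ.reg 10) → g.tail j = σ.reg 8 ∧ j < σ.reg 7)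
  cursor : σ.reg 7 ≠ 0 → σ.reg 7 ≤ g.m ∧ g.tail (σ.reg 7 - 1) = σ.reg 8 ∧
    σ.reg 8 ∈ q.take (σ.reg 10) ∧ σ.arr 6 (σ.reg 8) = σ.reg 13
  indeg : ∀ v < g.n, σ.arr 3 v = (U.filter fun j => g.head j = v).card
  mem : ∀ x < g.n, x ∈ q ↔ σ.arr 3 x = 0
  pred : ∀ x ∈ q, (σ.arr 6 x = 1 ∧ σ.arr 5 x = 0) ∨ ∃ j < g.m, g.head j = x ∧ g.tail j ∈ q ∧
    σ.arr 5 x = g.tail j + 1 ∧ σ.arr 6 x = σ.arr 6 (g.tail j) + 1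
  up : ∀ j < g.m, g.head j ∈ q → σ.arr 6 (g.tail j) < σ.arr 6 (g.head j)
  sorted : q.Pairwise fun x y => σ.arr 6 x ≤ σ.arr 6 y
  le_cur : ∀ x ∈ q.take (σ.reg 10), σ.arr 6 x ≤ σ.reg 13
  cur_le : ∀ x ∈ q.drop (σ.reg 10), σ.reg 13 ≤ σ.arr 6 x
  le_succ : ∀ x ∈ q, σ.arr 6 x ≤ σ.reg 13 + 1
  le_length : ∀ x ∈ q, σ.arr 6 x ≤ q.length
  cur_le_length : σ.reg 13 ≤ q.length
  zero : ∀ k, 7 ≤ k → ∀ i, σ.arr k i = 0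

/-- The final state of topological sorting: levels in array `6`, and predecessors on the preceding
level in array `5`. -/
structure Leveled (g : EdgeArray) (lev pred : ℕ → ℕ) (last : ℕ) : Prop where
  pos : ∀ x < g.n, 1 ≤ lev x
  le : ∀ x < g.n, lev x ≤ g.n
  up : ∀ j < g.m, lev (g.tail j) < lev (g.head j)
  pred : ∀ x < g.n, (lev x = 1 ∧ pred x = 0) ∨
    ∃ j < g.m, g.head j = x ∧ pred x = g.tail j + 1 ∧ lev x = lev (g.tail j) + 1
  last : g.n ≠ 0 → last < g.n ∧ ∀ x < g.n, lev x ≤ lev last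

/-- `U` does not change: no edge out of the popped vertex has been processed, and the new cursor,
the head of its adjacency list, lies above all of them. The old cursor is `0`, so the edges out of
the vertices popped earlier are all done. -/
theorem TopoInv.pop {g : EdgeArray} {q : List ℕ} {U : Finset ℕ} {σ : AState}
    (hI : TopoInv g q U σ) (h7 : σ.reg 7 = 0) (h10 : σ.reg 10 < q.length)
    {σ' : AState} (harr : σ'.arr = σ.arr) (h4 : σ'.reg 4 = σ.reg 4) (h5 : σ'.reg 5 = σ.reg 5)
    (h7' : σ'.reg 7 = σ.arr 1 q[σ.reg 10]) (h8 : σ'.reg 8 = q[σ.reg 10])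
    (h10' : σ'.reg 10 = σ.reg 10 + 1) (h11 : σ'.reg 11 = σ.reg 11)
    (h13 : σ'.reg 13 = σ.arr 6 q[σ.reg 10]) : TopoInv g q U σ' := by
  have htake : q.take (σ.reg 10 + 1) = q.take (σ.reg 10) ++ [q[σ.reg 10]] :=
    List.take_succ_eq_append_getElem h10
  have hdrop : q.drop (σ.reg 10) = q[σ.reg 10] :: q.drop (σ.reg 10 + 1) :=
    List.drop_eq_getElem_cons h10
  have hmem : q[σ.reg 10] ∈ q := List.getElem_mem h10
  have hn := hI.lt _ hmem
  have hf := hI.first _ hn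
  have hle := hI.cur_le _ (hdrop ▸ List.mem_cons_self)
  have hnot : q[σ.reg 10] ∉ q.take (σ.reg 10) := by
    have := hI.nodup.sublist (List.take_sublist (σ.reg 10 + 1) q)
    rw [htake, List.nodup_append] at this
    exact fun h => this.2.2 _ h _ (by simp) rfl
  refine ⟨hI.toStores.congr h4 h5 (by rw [harr]), by rw [harr]; exact hI.first,
    by rw [harr]; exact hI.next, by rw [harr]; exact hI.queue, h11.trans hI.len, hI.nodup, hI.lt,
    by omega, ?_, ?_, by rw [harr]; exact hI.indeg, by rw [harr]; exact hI.mem,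
    by rw [harr]; exact hI.pred, by rw [harr]; exact hI.up, by rw [harr]; exact hI.sorted,
    ?_, ?_, ?_, by rw [harr]; exact hI.le_length, by rw [h13]; exact hI.le_length _ hmem,
    by rw [harr]; exact hI.zero⟩
  · intro j
    rw [hI.undone j, h10', htake, h8, h7', hf, h7]
    refine and_congr_right fun hj => ?_
    simp only [List.mem_append, List.mem_singleton]
    constructor
    · rintro h (h1 | h1)
      · exact absurd (h h1).2 (by omega)
      · exact ⟨h1, lt_lastEdge hj h1⟩
    · intro h h1
      exact absurd h1 ((h (.inl h1)).1 ▸ hnot)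
  · rw [h7', hf, h8, h10', harr, h13, htake]
    exact fun h => ⟨lastEdge_le _ _ _, tail_lastEdge h, List.mem_append_right _ (by simp), rfl⟩
  · rw [h10', h13, harr, htake]
    intro x hx
    simp only [List.mem_append, List.mem_singleton] at hx
    rcases hx with hx | rfl
    · exact (hI.le_cur x hx).trans hle
    · exact le_rfl
  · rw [h10', h13, harr]
    have := hI.sorted.sublist (List.drop_sublist (σ.reg 10) q)
    rw [hdrop, List.pairwise_cons] at this
    exact this.1
  · rw [harr, h13]
    exact fun x hx => (hI.le_succ x hx).trans (by omega)

/-- Between `e` and the next edge of its adjacency list there is no edge with the same tail, so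
advancing the cursor declares exactly `e` processed. -/
theorem TopoInv.undone_erase {g : EdgeArray} {q : List ℕ} {U : Finset ℕ} {σ : AState}
    (hI : TopoInv g q U σ) {e : ℕ} (h7 : σ.reg 7 = e + 1) (j : ℕ) :
    j ∈ U.erase e ↔ j < g.m ∧ (g.tail j ∈ q.take (σ.reg 10) →
      g.tail j = σ.reg 8 ∧ j < lastEdge g.tail (g.tail e) e) := by
  obtain ⟨h1, h2, h3, h4⟩ := hI.cursor (by omega)
  have h5 : e + 1 - 1 = e := rfl
  rw [h7, h5] at h2
  rw [Finset.mem_erase, hI.undone j, h7, h2]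
  constructor
  · rintro ⟨h6, h7, h8⟩
    refine ⟨h7, fun h => ?_⟩
    obtain ⟨h9, h10⟩ := h8 h
    exact ⟨h9, lt_lastEdge (by omega) h9⟩
  · rintro ⟨h6, h7⟩
    refine ⟨?_, h6, fun h => ?_⟩
    · rintro rfl
      have := (h7 (h2 ▸ h3)).2
      have := lastEdge_le g.tail (σ.reg 8) j
      omega
    · have := lastEdge_le g.tail (σ.reg 8) e
      exact ⟨(h7 h).1, by have := (h7 h).2; omega⟩

theorem TopoInv.indeg_erase {g : EdgeArray} {q : List ℕ} {U : Finset ℕ} {σ : AState}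
    (hI : TopoInv g q U σ) {e : ℕ} (he : e ∈ U) (v : ℕ) (hv : v < g.n) :
    Function.update (σ.arr 3) (g.head e) (σ.arr 3 (g.head e) - 1) v =
      ((U.erase e).filter fun j => g.head j = v).card := by
  rw [Function.update_apply, Finset.filter_erase]
  split_ifs with h
  · subst h
    rw [Finset.card_erase_of_mem (by simp [he]), hI.indeg _ hv]
  · rw [Finset.erase_eq_of_notMem (by simp [Ne.symm h]), hI.indeg _ hv]

/-- The head of `e` still waits for other incoming edges, so the queue stays as it is. -/
theorem TopoInv.skip {g : EdgeArray} {q : List ℕ} {U : Finset ℕ} {σ : AState}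
    (hI : TopoInv g q U σ) {e : ℕ} (h7 : σ.reg 7 = e + 1) (hd : σ.arr 3 (g.head e) - 1 ≠ 0)
    {σ' : AState} (h3 : σ'.arr 3 = Function.update (σ.arr 3) (g.head e) (σ.arr 3 (g.head e) - 1))
    (harr : ∀ k, k ≠ 3 → σ'.arr k = σ.arr k)
    (h7' : σ'.reg 7 = lastEdge g.tail (g.tail e) e)
    (hreg : ∀ r, r ≠ 7 → r ≠ 12 → σ'.reg r = σ.reg r) : TopoInv g q (U.erase e) σ' := by
  obtain ⟨h1, h2, h4, h5⟩ := hI.cursor (by omega)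
  have h6 : e + 1 - 1 = e := rfl
  rw [h7, h6] at h2
  have he : e ∈ U := (hI.undone e).2 ⟨by omega, fun _ => ⟨h2, by omega⟩⟩
  refine ⟨hI.toStores.congr (hreg _ (by simp) (by simp)) (hreg _ (by simp) (by simp))
    (harr _ (by simp)), ?_, ?_, ?_, ?_, hI.nodup, hI.lt, ?_, ?_, ?_, ?_, ?_, ?_, ?_, ?_, ?_, ?_,
    ?_, ?_, ?_, ?_⟩
  · rw [harr 1 (by simp)]; exact hI.first
  · rw [harr 2 (by simp)]; exact hI.next
  · rw [harr 4 (by simp)]; exact hI.queue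
  · rw [hreg 11 (by simp) (by simp)]; exact hI.len
  · rw [hreg 10 (by simp) (by simp)]; exact hI.pos_le
  · rw [hreg 10 (by simp) (by simp), hreg 8 (by simp) (by simp), h7']
    exact hI.undone_erase h7
  · rw [hreg 10 (by simp) (by simp), hreg 8 (by simp) (by simp), hreg 13 (by simp) (by simp), h7',
      harr 6 (by simp)]
    refine fun h => ⟨(lastEdge_le _ _ _).trans (by omega), ?_, h4, h5⟩
    rw [tail_lastEdge h, h2]
  · rw [h3]; exact hI.indeg_erase he
  · intro x hx
    rw [hI.mem x hx, h3, Function.update_apply]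
    split_ifs with h
    · subst h; omega
    · rfl
  · rw [harr 6 (by simp), harr 5 (by simp)]; exact hI.pred
  · rw [harr 6 (by simp)]; exact hI.up
  · rw [harr 6 (by simp)]; exact hI.sorted
  · rw [hreg 10 (by simp) (by simp), hreg 13 (by simp) (by simp), harr 6 (by simp)]
    exact hI.le_cur
  · rw [hreg 10 (by simp) (by simp), hreg 13 (by simp) (by simp), harr 6 (by simp)]
    exact hI.cur_le
  · rw [hreg 13 (by simp) (by simp), harr 6 (by simp)]; exact hI.le_succ
  · rw [harr 6 (by simp)]; exact hI.le_length
  · rw [hreg 13 (by simp) (by simp)]; exact hI.cur_le_length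
  · intro k hk
    rw [harr k (by omega)]; exact hI.zero k hk

/-- When the last incoming edge of a vertex is processed, all its predecessors have been popped.
Their levels are at most the current one, which the tail of `e` attains, so the new level is one
more than their maximum and the tail of `e` is a predecessor on the preceding level. The queue stays
sorted since no level in it exceeds the current one by more than `1`. -/
theorem TopoInv.push {g : EdgeArray} {q : List ℕ} {U : Finset ℕ} {σ : AState}
    (hI : TopoInv g q U σ) {e : ℕ} (h7 : σ.reg 7 = e + 1) (hd : σ.arr 3 (g.head e) - 1 = 0)
    {σ' : AState} (h3 : σ'.arr 3 = Function.update (σ.arr 3) (g.head e) (σ.arr 3 (g.head e) - 1))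
    (ha4 : σ'.arr 4 = Function.update (σ.arr 4) q.length (g.head e))
    (ha5 : σ'.arr 5 = Function.update (σ.arr 5) (g.head e) (σ.reg 8 + 1))
    (ha6 : σ'.arr 6 = Function.update (σ.arr 6) (g.head e) (σ.reg 13 + 1))
    (harr : ∀ k, k ≠ 3 → k ≠ 4 → k ≠ 5 → k ≠ 6 → σ'.arr k = σ.arr k)
    (h7' : σ'.reg 7 = lastEdge g.tail (g.tail e) e) (h11 : σ'.reg 11 = q.length + 1)
    (hreg : ∀ r, r ≠ 7 → r ≠ 11 → r ≠ 12 → σ'.reg r = σ.reg r) :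
    TopoInv g (q ++ [g.head e]) (U.erase e) σ' := by
  obtain ⟨h1, h2, h4, h5⟩ := hI.cursor (by omega)
  have h6 : e + 1 - 1 = e := rfl
  rw [h7, h6] at h2
  have hem : e < g.m := by omega
  have hu := g.head_lt e hem
  have he : e ∈ U := (hI.undone e).2 ⟨hem, fun _ => ⟨h2, by omega⟩⟩
  have hpos : σ.arr 3 (g.head e) ≠ 0 := by
    rw [hI.indeg _ hu]
    exact (Finset.card_pos.2 ⟨e, by simp [he]⟩).ne'
  have huq : g.head e ∉ q := fun h => hpos ((hI.mem _ hu).1 h)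
  have hlev : ∀ x ∈ q, σ'.arr 6 x = σ.arr 6 x := fun x hx => by
    rw [ha6, Function.update_apply, if_neg]
    rintro rfl; exact huq hx
  have hlevu : σ'.arr 6 (g.head e) = σ.reg 13 + 1 := by rw [ha6, Function.update_self]
  have hr10 := hreg 10 (by simp) (by simp) (by simp)
  have hr8 := hreg 8 (by simp) (by simp) (by simp)
  have hr13 := hreg 13 (by simp) (by simp) (by simp)
  have htake : (q ++ [g.head e]).take (σ'.reg 10) = q.take (σ.reg 10) := by
    rw [hr10, List.take_append_of_le_length hI.pos_le]
  have hdrop : (q ++ [g.head e]).drop (σ'.reg 10) = q.drop (σ.reg 10) ++ [g.head e] := by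
    rw [hr10, List.drop_append_of_le_length hI.pos_le]
  have hcard := hI.indeg_erase he
  have hund := hI.undone_erase h7
  have hzero : ∀ x ∈ q ++ [g.head e], σ'.arr 3 x = 0 := by
    intro x hx
    rw [h3, Function.update_apply]
    split_ifs with h
    · exact hd
    · have hx : x ∈ q := by simpa [h] using hx
      exact (hI.mem x (hI.lt x hx)).1 hx
  -- An unprocessed edge into a queued vertex would be counted in its in-degree, which is `0`.
  have hdone : ∀ j < g.m, g.head j ∈ q ++ [g.head e] → g.tail j ∈ q.take (σ.reg 10) := by
    intro j hj hx
    by_contra hc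
    have h8 : j ∈ U.erase e := (hund j).2 ⟨hj, fun h => absurd h hc⟩
    have h9 := hzero _ hx
    rw [h3, hcard _ (g.head_lt j hj), Finset.card_eq_zero] at h9
    have : j ∈ (U.erase e).filter fun i => g.head i = g.head j := by
      rw [Finset.mem_filter]; exact ⟨h8, rfl⟩
    simp [h9] at this
  have hsub : ∀ x ∈ q.take (σ.reg 10), x ∈ q := fun x hx => List.mem_of_mem_take hx
  refine ⟨hI.toStores.congr (hreg _ (by simp) (by simp) (by simp))
    (hreg _ (by simp) (by simp) (by simp)) (harr _ (by simp) (by simp) (by simp) (by simp)),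
    ?_, ?_, ?_, ?_, ?_, ?_, ?_, ?_, ?_, ?_, ?_, ?_, ?_, ?_, ?_, ?_,
    ?_, ?_, ?_, ?_⟩
  · rw [harr 1 (by simp) (by simp) (by simp) (by simp)]; exact hI.first
  · rw [harr 2 (by simp) (by simp) (by simp) (by simp)]; exact hI.next
  · rw [ha4]; exact hI.queue.append rfl _
  · simp [h11]
  · rw [List.nodup_append]
    exact ⟨hI.nodup, by simp, fun x hx y hy h => huq (by simp at hy; rwa [← hy, ← h])⟩
  · intro x hx
    rcases List.mem_append.1 hx with hx | hx
    · exact hI.lt x hx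
    · rw [List.mem_singleton.1 hx]; exact hu
  · rw [hr10, List.length_append]; exact hI.pos_le.trans (by omega)
  · rw [htake, hr8, h7']; exact hund
  · rw [htake, hr8, hr13, h7', hlev _ (hsub _ h4)]
    refine fun h => ⟨(lastEdge_le _ _ _).trans (by omega), ?_, h4, h5⟩
    rw [tail_lastEdge h, h2]
  · rw [h3]; exact hcard
  · refine fun x hx => ⟨hzero x, ?_⟩
    rw [h3, Function.update_apply, List.mem_append, List.mem_singleton]
    split_ifs with h
    · exact fun _ => .inr h
    · exact fun h => .inl ((hI.mem x hx).2 h)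
  · intro x hx
    rcases List.mem_append.1 hx with hx | hx
    · have hxu : x ≠ g.head e := by rintro rfl; exact huq hx
      rw [hlev x hx, ha5, Function.update_apply, if_neg hxu]
      rcases hI.pred x hx with h | ⟨j, hj, h8, h9, h10, h11⟩
      · exact .inl h
      · exact .inr ⟨j, hj, h8, List.mem_append_left _ h9, h10, by rw [hlev _ h9, h11]⟩
    · rw [List.mem_singleton.1 hx]
      refine .inr ⟨e, hem, rfl, ?_, ?_, ?_⟩
      · rw [h2]; exact List.mem_append_left _ (hsub _ h4)
      · rw [ha5, Function.update_self, h2]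
      · rw [hlevu, h2, hlev _ (hsub _ h4), h5]
  · intro j hj hx
    have h8 := hdone j hj hx
    rw [hlev _ (hsub _ h8)]
    rcases List.mem_append.1 hx with hx | hx
    · rw [hlev _ hx]; exact hI.up j hj hx
    · rw [List.mem_singleton.1 hx, hlevu]
      have := hI.le_cur _ h8
      omega
  · rw [List.pairwise_append]
    refine ⟨hI.sorted.imp_of_mem fun ha hb h => by rwa [hlev _ ha, hlev _ hb], by simp, ?_⟩
    intro x hx y hy
    rw [List.mem_singleton.1 hy, hlevu, hlev x hx]
    exact hI.le_succ x hx
  · rw [htake, hr13]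
    intro x hx
    rw [hlev _ (hsub _ hx)]; exact hI.le_cur x hx
  · rw [hdrop, hr13]
    intro x hx
    rcases List.mem_append.1 hx with hx | hx
    · rw [hlev _ (List.mem_of_mem_drop hx)]; exact hI.cur_le x hx
    · rw [List.mem_singleton.1 hx, hlevu]; omega
  · rw [hr13]
    intro x hx
    rcases List.mem_append.1 hx with hx | hx
    · rw [hlev _ hx]; exact hI.le_succ x hx
    · rw [List.mem_singleton.1 hx, hlevu]
  · intro x hx
    rw [List.length_append, List.length_singleton]
    rcases List.mem_append.1 hx with hx | hx
    · rw [hlev _ hx]; exact (hI.le_length x hx).trans (by omega)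
    · rw [List.mem_singleton.1 hx, hlevu]
      have := hI.cur_le_length
      omega
  · rw [hr13, List.length_append]; exact hI.cur_le_length.trans (by omega)
  · intro k hk
    rw [harr k (by omega) (by omega) (by omega) (by omega)]; exact hI.zero k hk

/-- This is where acyclicity enters. A vertex that never reached the queue has an unprocessed
incoming edge; the tail has smaller rank, so by induction it was queued and popped, and all its
edges are done. -/
theorem TopoInv.mem_queue {g : EdgeArray} {q : List ℕ} {U : Finset ℕ} {σ : AState}
    (hI : TopoInv g q U σ) (h7 : σ.reg 7 = 0) (h10 : σ.reg 10 = q.length) (x : ℕ) (hx : x < g.n) :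
    x ∈ q := by
  induction hr : g.rank x using Nat.strong_induction_on generalizing x with
  | _ r ih =>
    by_contra hc
    have h1 := mt (hI.mem x hx).2 hc
    rw [hI.indeg x hx] at h1
    obtain ⟨j, hj⟩ := Finset.card_pos.1 (Nat.pos_of_ne_zero h1)
    rw [Finset.mem_filter, hI.undone j, h10, List.take_length] at hj
    obtain ⟨⟨h2, h3⟩, rfl⟩ := hj
    have := (h3 (ih _ (hr ▸ g.rank_lt j h2) _ (g.tail_lt j h2) rfl)).2
    omega

theorem wp_topoSort {g : EdgeArray} {σ : AState} {Q : AState → ℕ → Prop} {q : List ℕ} {d : ℕ → ℕ}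
    (h : QueueInv g d g.n q σ) (hd : ∀ v < g.n, d v =
      ((Finset.range g.m).filter fun i => g.head i = v).card)
    (h7 : σ.reg 7 = 0) (h10 : σ.reg 10 = 0) (h13 : σ.reg 13 = 0)
    (hQ : ∀ σ' k, Stores g σ' → Leveled g (σ'.arr 6) (σ'.arr 5) (σ'.arr 4 (g.n - 1)) →
      (∀ k, 7 ≤ k → ∀ i, σ'.arr k i = 0) → k ≤ g.n + g.m → Q σ' k) :
    WP g.N ord topoSort σ Q := by
  have hN : g.N = 2 * (g.n + g.m + 1) := rfl
  have hnoedge : ∀ j < g.m, g.head j ∉ q := fun j hj hx => by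
    have := ((h.mem _).1 hx).2
    rw [hd _ (g.head_lt j hj), Finset.card_eq_zero] at this
    have h1 : j ∈ (Finset.range g.m).filter fun i => g.head i = g.head j := by simp [hj]
    simp [this] at h1
  -- Every iteration either processes an edge of `U` or pops a vertex, so `|U| + (n - reg 10)` is a
  -- potential.
  refine wp_loop (fun p σ => ∃ q U, TopoInv g q U σ ∧ U.card + (g.n - σ.reg 10) ≤ p)
    (g.m + g.n) ⟨q, Finset.range g.m, ⟨h.toStores, h.first, h.next, h.queue, h.len, h.nodup,
      fun x hx => ((h.mem x).1 hx).1, by omega, ?_, by simp [h7], ?_, ?_, ?_, ?_, ?_,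
      by simp [h10], by simp [h13], ?_, ?_, by omega, h.zero⟩, by simp [h10]⟩ ?_ ?_ ?_
  · simp [h10]
  · rw [h.indeg]; exact hd
  · intro x hx; rw [h.indeg, h.mem]; simp [hx]
  · exact fun x hx => .inl ⟨h.lev x hx, h.pred x⟩
  · exact fun j hj hx => absurd hx (hnoedge j hj)
  · exact List.pairwise_iff_getElem.2 fun i j hi hj _ => by
      rw [h.lev _ (List.getElem_mem hi), h.lev _ (List.getElem_mem hj)]
  -- The current level starts at `0`, one below the level `1` of the sources in the queue.
  · exact fun x hx => by rw [h.lev x hx]; omega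
  · exact fun x hx => by rw [h.lev x hx]; exact List.length_pos_of_mem hx
  · rintro p σ ⟨q, U, hI, hp⟩
    have h1 := testLt_le_one (σ.reg 10) (σ.reg 11)
    have h2 : σ.reg 7 ≤ g.m := by
      by_cases h : σ.reg 7 = 0
      · omega
      · exact (hI.cursor h).1
    simp
    omega
  · rintro p σ ⟨q, U, hI, hp⟩ hne
    have hlen := length_le_of_nodup_of_lt hI.nodup hI.lt
    by_cases h7 : σ.reg 7 = 0
    · have h10 : σ.reg 10 < q.length := by
        simpa [h7, hI.len] using hne
      have hq := hI.queue _ h10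
      have hqn := hI.lt _ (List.getElem_mem h10)
      simp [h7, hq]
      repeat refine And.intro (by omega) ?_
      refine ⟨p - 1, by omega, q, U, hI.pop h7 h10 ?_ ?_ ?_ ?_ ?_ ?_ ?_ ?_, by omega⟩ <;> simp
    · obtain ⟨e, he⟩ : ∃ e, σ.reg 7 = e + 1 := ⟨σ.reg 7 - 1, by omega⟩
      obtain ⟨h1, h2, h3, h4⟩ := hI.cursor h7
      have hem : e < g.m := by omega
      have hh := hI.head e hem
      have hu := g.head_lt e hem
      have hnx := hI.next e hem
      have h8 := hI.lt _ (List.mem_of_mem_take h3)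
      have h13 := hI.cur_le_length
      rw [he, Nat.add_sub_cancel] at h2
      have heU : e ∈ U := (hI.undone e).2 ⟨hem, fun _ => ⟨h2, by omega⟩⟩
      have hcard := Finset.card_erase_of_mem heU
      have hpos := Finset.card_pos.2 ⟨e, heU⟩
      -- A vertex of positive in-degree is not in the queue yet, so there is room for it.
      have hqu : σ.arr 3 (g.head e) ≠ 0 → q.length < g.n := by
        intro h
        have := mt (hI.mem _ hu).1 h
        have h9 : (q ++ [g.head e]).length ≤ g.n := by
          refine length_le_of_nodup_of_lt ?_ ?_
          · rw [List.nodup_append]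
            exact ⟨hI.nodup, by simp, fun x hx y hy h => this (by simp at hy; rwa [← hy, ← h])⟩
          · intro x hx
            rcases List.mem_append.1 hx with hx | hx
            · exact hI.lt x hx
            · rw [List.mem_singleton.1 hx]; exact hu
        simpa using h9
      have hne : σ.arr 3 (g.head e) ≠ 0 := by
        rw [hI.indeg _ hu]
        exact (Finset.card_pos.2 ⟨e, by simp [heU]⟩).ne'
      have hq := hqu hne
      simp [he, hh, hI.len, hnx]
      repeat refine And.intro (by omega) ?_
      refine ⟨fun hz => ⟨by omega, ?_⟩, fun hz => ?_⟩
      · refine ⟨p - 1, by omega, q, _, hI.skip he (by omega) ?_ ?_ ?_ ?_, ?_⟩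
        · simp
        · intro k hk; simp [hk]
        · simp
        · intro r hr hr'; simp [hr, hr']
        · omega
      · repeat refine And.intro (by omega) ?_
        refine ⟨p - 1, by omega, _, _, hI.push he (by omega) ?_ ?_ ?_ ?_ ?_ ?_ ?_ ?_, ?_⟩
        · simp
        · simp
        · simp
        · simp
        · intro k hk h4 h5 h6; simp [hk, h4, h5, h6]
        · simp
        · simp
        · intro r hr hr' hr''; simp [hr, hr', hr'']
        · omega
  · rintro p' σ' k ⟨q, U, hI, hp⟩ he hk
    simp [hI.len] at he
    obtain ⟨h7, h10⟩ := he
    have h10 : σ'.reg 10 = q.length := le_antisymm hI.pos_le h10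
    have hmem := hI.mem_queue h7 h10
    have hlen : q.length = g.n := by
      refine le_antisymm (length_le_of_nodup_of_lt hI.nodup hI.lt) ?_
      rw [← List.toFinset_card_of_nodup hI.nodup]
      calc g.n = (Finset.range g.n).card := by simp
        _ ≤ _ := Finset.card_le_card fun x hx => by simpa using hmem x (by simpa using hx)
    refine hQ _ _ hI.toStores ⟨?_, ?_, ?_, ?_, ?_⟩ hI.zero (by omega)
    · intro x hx
      rcases hI.pred x (hmem x hx) with h | ⟨j, _, _, _, _, h⟩ <;> omega
    · exact fun x hx => hlen ▸ hI.le_length x (hmem x hx)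
    · exact fun j hj => hI.up j hj (hmem _ (g.head_lt j hj))
    · intro x hx
      rcases hI.pred x (hmem x hx) with h | ⟨j, h1, h2, _, h3, h4⟩
      · exact .inl h
      · exact .inr ⟨j, h1, h2, h3, h4⟩
    -- The queue is sorted by level, so its final entry has the maximal level and ends a longest
    -- path.
    · intro hn
      have hl : g.n - 1 < q.length := by omega
      rw [hI.queue _ hl]
      refine ⟨hI.lt _ (List.getElem_mem hl), fun x hx => ?_⟩
      obtain ⟨i, hi, rfl⟩ := List.getElem_of_mem (hmem x hx)
      rcases Nat.lt_or_ge i (g.n - 1) with h | h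
      · exact List.pairwise_iff_getElem.1 hI.sorted i _ hi hl h
      · have : i = g.n - 1 := by omega
        subst this; exact le_rfl

end ArrayLang

/-! ### Preprocessing: a longest path -/

namespace ArrayLang

variable {ord : ℕ → ℕ → Bool}

/-- Follows the predecessors from the last vertex of the queue. The path is written to array `7`,
the positions on it to array `8`, and the links to the next vertex of the path to array `9`. -/
def tracePath : ACmd := .block [
  .assign 8 (.reg 4),
  .cond (.reg 4)
    (.block [
      .assign 7 (.arr 4 (.sub (.reg 4) (.const 1))),
      .assign 14 (.arr 6 (.reg 7)),
      .assign 7 (.add (.reg 7) (.const 1))])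
    (.block [.assign 14 (.const 0), .assign 7 (.const 0)]),
  .loop (.reg 7) (.block [
    .assign 7 (.sub (.reg 7) (.const 1)),
    .store 7 (.sub (.arr 6 (.reg 7)) (.const 1)) (.reg 7),
    .store 8 (.reg 7) (.arr 6 (.reg 7)),
    .store 9 (.reg 7) (.reg 8),
    .assign 8 (.reg 7),
    .assign 7 (.arr 5 (.reg 7))]),
  .store 9 (.reg 4) (.reg 8)]

/-- `P` is a path with `k` vertices, one on each level; `pos x` is one plus the index of `x` in `P`, or
`0` if `x` is not on the path. -/
structure PathData (g : EdgeArray) (lev : ℕ → ℕ) (k : ℕ) (P pos : ℕ → ℕ) : Prop where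
  k_le : k ≤ g.n
  lev_pos : ∀ x < g.n, 1 ≤ lev x
  lev_le : ∀ x < g.n, lev x ≤ k
  lev_up : ∀ j < g.m, lev (g.tail j) < lev (g.head j)
  P_lt : ∀ t < k, P t < g.n
  lev_P : ∀ t < k, lev (P t) = t + 1
  pos_P : ∀ t < k, pos (P t) = t + 1
  edge : ∀ t, t + 1 < k → ∃ j < g.m, g.tail j = P t ∧ g.head j = P (t + 1)
  pos_le : ∀ x < g.n, pos x ≤ k
  P_pos : ∀ x < g.n, pos x ≠ 0 → P (pos x - 1) = x

/-- The linked list of the path; it starts in cell `n` and ends with `n`. -/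
structure PathLinks (g : EdgeArray) (k : ℕ) (P link : ℕ → ℕ) : Prop where
  first : link g.n = if 0 < k then P 0 else g.n
  next : ∀ t < k, link (P t) = if t + 1 < k then P (t + 1) else g.n

/-- The path is stored in arrays `7`, `8`, `9`, its length in register `14`. -/
structure StoresPath (g : EdgeArray) (k : ℕ) (P pos link : ℕ → ℕ) (σ : AState) : Prop
    extends Stores g σ where
  r14 : σ.reg 14 = k
  arr7 : σ.arr 7 = P
  arr8 : σ.arr 8 = pos
  arr9 : σ.arr 9 = link

theorem StoresPath.congr {g : EdgeArray} {k : ℕ} {P pos link : ℕ → ℕ} {σ σ' : AState}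
    (h : StoresPath g k P pos link σ) (h4 : σ'.reg 4 = σ.reg 4) (h5 : σ'.reg 5 = σ.reg 5)
    (h14 : σ'.reg 14 = σ.reg 14) (h0 : σ'.arr 0 = σ.arr 0) (h7 : σ'.arr 7 = σ.arr 7)
    (h8 : σ'.arr 8 = σ.arr 8) (h9 : σ'.arr 9 = σ.arr 9) : StoresPath g k P pos link σ' :=
  ⟨h.toStores.congr h4 h5 h0, h14.trans h.r14, h7.trans h.arr7, h8.trans h.arr8, h9.trans h.arr9⟩

/-- The invariant of path tracing: the vertices with index at least `i` are known. -/
structure TraceInv (g : EdgeArray) (lev pred : ℕ → ℕ) (k i : ℕ) (σ : AState) : Prop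
    extends Stores g σ where
  arr6 : σ.arr 6 = lev
  arr5 : σ.arr 5 = pred
  r14 : σ.reg 14 = k
  i_le : i ≤ k
  cur : (σ.reg 7 = 0 ∧ i = 0) ∨ ∃ x < g.n, σ.reg 7 = x + 1 ∧ lev x = i ∧
    (i < k → ∃ j < g.m, g.tail j = x ∧ g.head j = σ.arr 7 i)
  nxt : σ.reg 8 = if i < k then σ.arr 7 i else g.n
  path : ∀ t, i ≤ t → t < k → σ.arr 7 t < g.n ∧ lev (σ.arr 7 t) = t + 1 ∧
    σ.arr 8 (σ.arr 7 t) = t + 1 ∧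
    σ.arr 9 (σ.arr 7 t) = if t + 1 < k then σ.arr 7 (t + 1) else g.n
  edge : ∀ t, i ≤ t → t + 1 < k → ∃ j < g.m, g.tail j = σ.arr 7 t ∧ g.head j = σ.arr 7 (t + 1)
  pos : ∀ y < g.n, σ.arr 8 y = 0 ∨
    (i < σ.arr 8 y ∧ σ.arr 8 y ≤ k ∧ σ.arr 7 (σ.arr 8 y - 1) = y)
  zero : ∀ k, 10 ≤ k → ∀ i, σ.arr k i = 0

/-- The path is found backwards, a vertex on level `i + 1` getting index `i`. Path vertices have
distinct levels, so nothing recorded earlier is overwritten. A vertex without recorded predecessor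
has level `1`, so tracing stops exactly at index `0`. -/
theorem TraceInv.step {g : EdgeArray} {lev pred : ℕ → ℕ} {k i last : ℕ} {σ σ' : AState}
    (hI : TraceInv g lev pred k (i + 1) σ) (hL : Leveled g lev pred last) {x : ℕ} (hx : x < g.n)
    (hlev : lev x = i + 1)
    (hedge : i + 1 < k → ∃ j < g.m, g.tail j = x ∧ g.head j = σ.arr 7 (i + 1))
    (h7 : σ'.arr 7 = Function.update (σ.arr 7) i x)
    (h8 : σ'.arr 8 = Function.update (σ.arr 8) x (i + 1))
    (h9 : σ'.arr 9 = Function.update (σ.arr 9) x (σ.reg 8))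
    (harr : ∀ k, k ≠ 7 → k ≠ 8 → k ≠ 9 → σ'.arr k = σ.arr k)
    (hr8 : σ'.reg 8 = x) (hr7 : σ'.reg 7 = pred x)
    (hreg : ∀ r, r ≠ 7 → r ≠ 8 → σ'.reg r = σ.reg r) : TraceInv g lev pred k i σ' := by
  have hik := hI.i_le
  have hold : ∀ t, i + 1 ≤ t → σ'.arr 7 t = σ.arr 7 t := fun t ht => by
    rw [h7, Function.update_apply, if_neg (by omega)]
  have hnew : σ'.arr 7 i = x := by rw [h7, Function.update_self]
  have hne : ∀ t, i + 1 ≤ t → t < k → σ.arr 7 t ≠ x := fun t ht htk h => by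
    have := (hI.path t ht htk).2.1
    rw [h, hlev] at this; omega
  refine ⟨hI.toStores.congr (hreg _ (by simp) (by simp)) (hreg _ (by simp) (by simp))
    (harr _ (by simp) (by simp) (by simp)), ?_, ?_, ?_, by omega, ?_, ?_, ?_, ?_, ?_, ?_⟩
  · rw [harr 6 (by simp) (by simp) (by simp), hI.arr6]
  · rw [harr 5 (by simp) (by simp) (by simp), hI.arr5]
  · rw [hreg 14 (by simp) (by simp), hI.r14]
  · rw [hr7, hnew]
    rcases hL.pred x hx with ⟨h1, h2⟩ | ⟨j, h1, h2, h3, h4⟩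
    · exact .inl ⟨h2, by omega⟩
    · exact .inr ⟨g.tail j, g.tail_lt j h1, h3, by omega, fun _ => ⟨j, h1, rfl, h2⟩⟩
  · rw [hr8, if_pos (by omega), hnew]
  · intro t ht htk
    rcases Nat.eq_or_lt_of_le ht with rfl | h
    · rw [hnew]
      refine ⟨hx, hlev, by rw [h8, Function.update_self], ?_⟩
      rw [h9, Function.update_self, hI.nxt, hold _ le_rfl]
    · rw [hold t h, hold _ (by omega), h8, h9, Function.update_of_ne (hne t h htk),
        Function.update_of_ne (hne t h htk)]
      exact hI.path t h htk
  · intro t ht htk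
    rcases Nat.eq_or_lt_of_le ht with rfl | h
    · rw [hnew, hold _ le_rfl]; exact hedge htk
    · rw [hold t h, hold _ (by omega)]; exact hI.edge t h htk
  · intro y hy
    rw [h8]
    by_cases hyx : y = x
    · subst hyx
      rw [Function.update_self]
      exact .inr ⟨by omega, hik, by rw [Nat.add_sub_cancel, hnew]⟩
    · rw [Function.update_of_ne hyx]
      refine (hI.pos y hy).imp id ?_
      rintro ⟨h1, h2, h3⟩
      exact ⟨by omega, h2, by rw [hold _ (by omega), h3]⟩
  · intro k hk
    rw [harr k (by omega) (by omega) (by omega)]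
    exact hI.zero k hk

theorem wp_tracePath {g : EdgeArray} {σ : AState} {Q : AState → ℕ → Prop}
    (h : Stores g σ) (hL : Leveled g (σ.arr 6) (σ.arr 5) (σ.arr 4 (g.n - 1)))
    (h0 : ∀ k, 7 ≤ k → ∀ i, σ.arr k i = 0)
    (hQ : ∀ σ' n' lev k P pos link, PathData g lev k P pos → PathLinks g k P link →
      StoresPath g k P pos link σ' → (∀ k, 10 ≤ k → ∀ i, σ'.arr k i = 0) → n' ≤ g.n → Q σ' n') :
    WP g.N ord tracePath σ Q := by
  have hN : g.N = 2 * (g.n + g.m + 1) := rfl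
  -- Common to the empty and the nonempty graph, which differ only in the initialization. The
  -- potential is the level of the current vertex.
  have main : ∀ (σ1 : AState) (k : ℕ), k ≤ g.n → (∀ x < g.n, σ.arr 6 x ≤ k) →
      TraceInv g (σ.arr 6) (σ.arr 5) k k σ1 → WP g.N ord (.block [
        .loop (.reg 7) (.block [
          .assign 7 (.sub (.reg 7) (.const 1)),
          .store 7 (.sub (.arr 6 (.reg 7)) (.const 1)) (.reg 7),
          .store 8 (.reg 7) (.arr 6 (.reg 7)),
          .store 9 (.reg 7) (.reg 8),
          .assign 8 (.reg 7),
          .assign 7 (.arr 5 (.reg 7))]),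
        .store 9 (.reg 4) (.reg 8)]) σ1 Q := by
    intro σ1 k hkn hk hI1
    rw [wp_block_cons]
    refine wp_loop (fun i σ' => TraceInv g (σ.arr 6) (σ.arr 5) k i σ') k hI1 (by simp) ?_ ?_
    · rintro i σ' hI hne
      simp at hne
      obtain ⟨h1, -⟩ | ⟨x, hx, hrx, hlx, hedge⟩ := hI.cur
      · exact absurd h1 hne
      have hp := hL.pos x hx
      obtain ⟨i, rfl⟩ : ∃ i', i = i' + 1 := ⟨i - 1, by omega⟩
      have hik := hI.i_le
      simp [hrx, hI.arr6, hI.arr5, hlx]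
      repeat refine And.intro (by omega) ?_
      refine ⟨i, le_rfl, hI.step hL hx hlx hedge ?_ ?_ ?_ ?_ ?_ ?_ ?_⟩
      · simp
      · simp
      · simp
      · intro k h7 h8 h9; simp [h7, h8, h9]
      · simp
      · simp
      · intro r h7 h8; simp [h7, h8]
    · rintro i σ' n' hI he hn'
      simp at he
      have hi : i = 0 := by
        obtain ⟨-, h1⟩ | ⟨x, hx, hrx, hlx, hedge⟩ := hI.cur
        · exact h1
        · omega
      subst hi
      simp [hI.r4]
      refine ⟨by omega, hQ _ _ (σ.arr 6) k (σ'.arr 7) (σ'.arr 8)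
        (Function.update (σ'.arr 9) g.n (σ'.reg 8)) ⟨hkn, hL.pos, hk, hL.up,
          fun t ht => (hI.path t (by omega) ht).1, fun t ht => (hI.path t (by omega) ht).2.1,
          fun t ht => (hI.path t (by omega) ht).2.2.1, fun t ht => hI.edge t (by omega) ht, ?_, ?_⟩
        ⟨?_, ?_⟩ ⟨hI.toStores.congr (by simp) (by simp) (by simp), ?_, ?_, ?_, ?_⟩ ?_ (by omega)⟩
      · intro x hx
        rcases hI.pos x hx with h | h
        · omega
        · exact h.2.1
      · intro x hx hne
        rcases hI.pos x hx with h | h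
        · exact absurd h hne
        · exact h.2.2
      · rw [Function.update_self]; exact hI.nxt
      · intro t ht
        rw [Function.update_of_ne, (hI.path t (by omega) ht).2.2.2]
        have := (hI.path t (by omega) ht).1
        omega
      · simpa using hI.r14
      · simp
      · simp
      · simp
      · intro k hk i
        have h9 : k ≠ 9 := by omega
        simpa [h9] using hI.zero k hk i
  rw [tracePath]
  simp only [wp_block_cons (c := .assign _ _), wp_block_cons (c := .cond _ _ _), wp_assign, wp_cond]
  simp only [AExpr.Ok, AExpr.eval, AState.setReg_reg, h.r4]
  refine ⟨by simp, trivial, trivial, fun hn => ?_, fun hn => ?_⟩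
  · simp at hn
    obtain ⟨h1, h2⟩ := hL.last hn
    have h3 := hL.le _ h1
    simp [-wp_block_cons]
    repeat refine And.intro (by omega) ?_
    refine main _ _ h3 h2 ⟨h.congr (by simp) (by simp) (by simp), by simp, by simp, by simp, le_rfl,
      .inr ⟨_, h1, by simp, rfl, fun h => absurd h (lt_irrefl _)⟩, by simp, ?_, ?_, ?_, ?_⟩
    · intro t ht ht'; omega
    · intro t ht ht'; omega
    · intro y hy; simp [h0]
    · intro k hk i; simpa using h0 k (by omega) i
  · simp at hn
    simp [-wp_block_cons]
    refine main _ 0 (by omega) (by omega) ⟨h.congr (by simp) (by simp) (by simp), by simp, by simp,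
      by simp, le_rfl, .inl (by simp), by simp, ?_, ?_, ?_, ?_⟩
    · intro t ht ht'; omega
    · intro t ht ht'; omega
    · intro y hy; simp [h0]
    · intro k hk i; simpa using h0 k (by omega) i

end ArrayLang

/-! ### Preprocessing: the vertices that are kept -/

namespace ArrayLang

variable {ord : ℕ → ℕ → Bool}

/-- Computes, for each vertex outside the path, the position of its last predecessor on the path
(array `10`), and the position from the end of its first successor on the path (array `11`). -/
def scanNeighbors : ACmd := .loop (.lt (.reg 6) (.reg 5)) (.block [
  .assign 10 (.arr 0 (.add (.reg 6) (.reg 6))),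
  .assign 11 (.arr 0 (.add (.add (.reg 6) (.reg 6)) (.const 1))),
  .assign 7 (.arr 8 (.reg 10)),
  .assign 8 (.arr 8 (.reg 11)),
  .cond (.reg 7)
    (.cond (.reg 8) .skip
      (.cond (.lt (.arr 10 (.reg 11)) (.reg 7)) (.store 10 (.reg 11) (.reg 7)) .skip))
    (.cond (.reg 8)
      (.cond (.lt (.arr 11 (.reg 10)) (.sub (.add (.reg 14) (.const 1)) (.reg 8)))
        (.store 11 (.reg 10) (.sub (.add (.reg 14) (.const 1)) (.reg 8))) .skip) .skip),
  .assign 6 (.add (.reg 6) (.const 1))])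

/-- `a` and `b` describe the last predecessors and first successors on the path with respect to the
first `j` edges. -/
structure ScanData (g : EdgeArray) (k : ℕ) (P pos : ℕ → ℕ) (j : ℕ) (a b : ℕ → ℕ) : Prop where
  a_edge : ∀ v < g.n, a v ≠ 0 → a v ≤ k ∧ pos v = 0 ∧
    ∃ e < g.m, g.tail e = P (a v - 1) ∧ g.head e = v
  le_a : ∀ i < j, pos (g.tail i) ≠ 0 → pos (g.head i) = 0 → pos (g.tail i) ≤ a (g.head i)
  b_edge : ∀ v < g.n, b v ≠ 0 → b v ≤ k ∧ pos v = 0 ∧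
    ∃ e < g.m, g.tail e = v ∧ g.head e = P (k - b v)
  le_b : ∀ i < j, pos (g.tail i) = 0 → pos (g.head i) ≠ 0 →
    k + 1 - pos (g.head i) ≤ b (g.tail i)

theorem ScanData.succ {g : EdgeArray} {k : ℕ} {P pos : ℕ → ℕ} {j : ℕ} {a b : ℕ → ℕ}
    (h : ScanData g k P pos j a b)
    (ha : pos (g.tail j) ≠ 0 → pos (g.head j) = 0 → pos (g.tail j) ≤ a (g.head j))
    (hb : pos (g.tail j) = 0 → pos (g.head j) ≠ 0 → k + 1 - pos (g.head j) ≤ b (g.tail j)) :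
    ScanData g k P pos (j + 1) a b := by
  refine ⟨h.a_edge, fun i hi => ?_, h.b_edge, fun i hi => ?_⟩
  · rcases Nat.lt_succ_iff_lt_or_eq.1 hi with hi | rfl
    · exact h.le_a i hi
    · exact ha
  · rcases Nat.lt_succ_iff_lt_or_eq.1 hi with hi | rfl
    · exact h.le_b i hi
    · exact hb

theorem ScanData.update_a {g : EdgeArray} {lev : ℕ → ℕ} {k : ℕ} {P pos : ℕ → ℕ} {j : ℕ}
    {a b : ℕ → ℕ} (hP : PathData g lev k P pos) (h : ScanData g k P pos j a b) (hj : j < g.m)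
    (h1 : pos (g.tail j) ≠ 0) (h2 : pos (g.head j) = 0) (h3 : a (g.head j) < pos (g.tail j)) :
    ScanData g k P pos (j + 1) (Function.update a (g.head j) (pos (g.tail j))) b := by
  refine ScanData.succ ⟨fun v hv => ?_, fun i hi hi1 hi2 => ?_, h.b_edge, h.le_b⟩ ?_ ?_
  · rw [Function.update_apply]
    split_ifs with hvj
    · subst hvj
      exact fun _ => ⟨hP.pos_le _ (g.tail_lt j hj), h2, j, hj,
        (hP.P_pos _ (g.tail_lt j hj) h1).symm, rfl⟩
    · exact h.a_edge v hv
  · have := h.le_a i hi hi1 hi2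
    rw [Function.update_apply]
    split_ifs with hvj
    · rw [hvj] at this; omega
    · exact this
  · simp
  · exact fun h3 => absurd h3 h1

/-- Counting positions from the end turns the first successor into a maximum, so that `0` can stand
for "none yet", as it does for predecessors. -/
theorem ScanData.update_b {g : EdgeArray} {lev : ℕ → ℕ} {k : ℕ} {P pos : ℕ → ℕ} {j : ℕ}
    {a b : ℕ → ℕ} (hP : PathData g lev k P pos) (h : ScanData g k P pos j a b) (hj : j < g.m)
    (h1 : pos (g.tail j) = 0) (h2 : pos (g.head j) ≠ 0)
    (h3 : b (g.tail j) < k + 1 - pos (g.head j)) :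
    ScanData g k P pos (j + 1) a (Function.update b (g.tail j) (k + 1 - pos (g.head j))) := by
  refine ScanData.succ ⟨h.a_edge, h.le_a, fun v hv => ?_, fun i hi hi1 hi2 => ?_⟩ ?_ ?_
  · rw [Function.update_apply]
    split_ifs with hvj
    · subst hvj
      have h4 := hP.pos_le _ (g.head_lt j hj)
      have h5 : k - (k + 1 - pos (g.head j)) = pos (g.head j) - 1 := by omega
      rw [h5]
      exact fun _ => ⟨by omega, h1, j, hj, rfl, (hP.P_pos _ (g.head_lt j hj) h2).symm⟩
    · exact h.b_edge v hv
  · have := h.le_b i hi hi1 hi2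
    rw [Function.update_apply]
    split_ifs with hvj
    · rw [hvj] at this; omega
    · exact this
  · exact fun h3 => absurd h1 h3
  · simp

theorem wp_scanNeighbors {g : EdgeArray} {σ : AState} {Q : AState → ℕ → Prop} {lev : ℕ → ℕ}
    {k : ℕ} {P pos link : ℕ → ℕ} (hP : PathData g lev k P pos) (h : StoresPath g k P pos link σ)
    (h6 : σ.reg 6 = 0) (h0 : ∀ k, 10 ≤ k → ∀ i, σ.arr k i = 0)
    (hQ : ∀ σ' n', StoresPath g k P pos link σ' →
      ScanData g k P pos g.m (σ'.arr 10) (σ'.arr 11) → (∀ k, 12 ≤ k → ∀ i, σ'.arr k i = 0) →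
      n' ≤ g.m → Q σ' n') :
    WP g.N ord scanNeighbors σ Q := by
  have hN : g.N = 2 * (g.n + g.m + 1) := rfl
  have hk := hP.k_le
  refine wp_for g.m (fun j σ => StoresPath g k P pos link σ ∧
    ScanData g k P pos j (σ.arr 10) (σ.arr 11) ∧ (∀ k, 12 ≤ k → ∀ i, σ.arr k i = 0) ∧
    σ.reg 6 = j) ⟨h, ⟨?_, by simp, ?_, by simp⟩, fun k hk => h0 k (by omega), h6⟩
    (fun i σ h => ⟨h.2.2.2, h.1.r5⟩) ?_
    (fun σ' k h => hQ σ' k h.1 h.2.1 h.2.2.1)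
  · simp [h0]
  · simp [h0]
  rintro j σ hj ⟨hS, hI, hz, h6⟩
  have ht := hS.tail j hj
  have hh := hS.head j hj
  have ht1 := g.tail_lt j hj
  have hh1 := g.head_lt j hj
  simp [ht, hh, h6, hS.arr8, hS.r14]
  repeat refine And.intro (by omega) ?_
  refine ⟨fun h1 => ⟨fun h2 => ?_, fun h2 => ⟨by omega, fun h3 => ⟨by omega, by omega, ?_⟩,
    fun h3 => ?_⟩⟩, fun h1 => ⟨fun h2 => ⟨⟨by omega, by omega⟩, fun h3 => ⟨by omega, by omega, ?_⟩,
    fun h3 => ?_⟩, fun h2 => ?_⟩⟩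
  · exact ⟨by omega, hS.congr (by simp) (by simp) (by simp) (by simp) (by simp) (by simp) (by simp),
      hI.succ (fun _ h => absurd h h2) (fun h => absurd h h1), hz⟩
  · refine ⟨hS.congr (by simp) (by simp) (by simp) (by simp) (by simp) (by simp)
      (by simp), hI.update_a hP hj h1 h2 h3, fun k hk i => ?_⟩
    rw [if_neg (by omega)]; exact hz k hk i
  · exact ⟨by omega, hS.congr (by simp) (by simp) (by simp) (by simp) (by simp) (by simp) (by simp),
      hI.succ (fun _ _ => h3) (fun h => absurd h h1), hz⟩
  · refine ⟨by omega, hS.congr (by simp) (by simp) (by simp) (by simp) (by simp) (by simp)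
      (by simp), hI.update_b hP hj h1 h2 (by omega), fun k hk i => ?_⟩
    rw [if_neg (by omega)]; exact hz k hk i
  · exact ⟨by omega, hS.congr (by simp) (by simp) (by simp) (by simp) (by simp) (by simp) (by simp),
      hI.succ (fun h => absurd h1 h) (fun _ _ => by omega), hz⟩
  · exact ⟨by omega, hS.congr (by simp) (by simp) (by simp) (by simp) (by simp) (by simp) (by simp),
      hI.succ (fun h => absurd h1 h) (fun _ h => absurd h2 h), hz⟩

/-- Marks (array `12`) the vertices that are kept: those outside the path and their last predecessors
and first successors on the path. -/
def markKept : ACmd := .loop (.lt (.reg 6) (.reg 4)) (.block [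
  .cond (.arr 8 (.reg 6)) .skip (.block [
    .store 12 (.reg 6) (.const 1),
    .cond (.arr 10 (.reg 6))
      (.store 12 (.arr 7 (.sub (.arr 10 (.reg 6)) (.const 1))) (.const 1)) .skip,
    .cond (.arr 11 (.reg 6))
      (.store 12 (.arr 7 (.sub (.reg 14) (.arr 11 (.reg 6)))) (.const 1)) .skip]),
  .assign 6 (.add (.reg 6) (.const 1))])

/-- The vertices `x` with `mark x ≠ 0` are kept. -/
structure MarkData (g : EdgeArray) (P pos mark : ℕ → ℕ) : Prop where
  nonpath : ∀ v < g.n, pos v = 0 → mark v ≠ 0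
  before : ∀ e < g.m, pos (g.tail e) ≠ 0 → pos (g.head e) = 0 → ∃ e' < g.m,
    g.head e' = g.head e ∧ pos (g.tail e) ≤ pos (g.tail e') ∧ mark (g.tail e') ≠ 0
  after : ∀ e < g.m, pos (g.tail e) = 0 → pos (g.head e) ≠ 0 → ∃ e' < g.m,
    g.tail e' = g.tail e ∧ pos (g.head e') ≠ 0 ∧ pos (g.head e') ≤ pos (g.head e) ∧
      mark (g.head e') ≠ 0
  card : ((Finset.range g.n).filter fun x => mark x ≠ 0).card ≤
    3 * ((Finset.range g.n).filter fun x => pos x = 0).card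

theorem card_le_three_mul {s t : Finset ℕ} (a b : ℕ → ℕ)
    (h : ∀ x ∈ s, ∃ y ∈ t, x = y ∨ x = a y ∨ x = b y) : s.card ≤ 3 * t.card := by
  have h1 : s ⊆ t ∪ (t.image a ∪ t.image b) := by
    intro x hx
    obtain ⟨y, hy, rfl | rfl | rfl⟩ := h x hx
    · simp [hy]
    · simp only [Finset.mem_union, Finset.mem_image]
      exact .inr (.inl ⟨y, hy, rfl⟩)
    · simp only [Finset.mem_union, Finset.mem_image]
      exact .inr (.inr ⟨y, hy, rfl⟩)
  have h2 := Finset.card_le_card h1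
  have h3 := Finset.card_union_le t (t.image a ∪ t.image b)
  have h4 := Finset.card_union_le (t.image a) (t.image b)
  have h5 := Finset.card_image_le (s := t) (f := a)
  have h6 := Finset.card_image_le (s := t) (f := b)
  omega

/-- The invariant of marking after the first `v` vertices. -/
structure MarkInv (g : EdgeArray) (k : ℕ) (P pos a b : ℕ → ℕ) (v : ℕ) (mark : ℕ → ℕ) : Prop where
  marked : ∀ y < v, pos y = 0 → mark y ≠ 0 ∧ (a y ≠ 0 → mark (P (a y - 1)) ≠ 0) ∧
    (b y ≠ 0 → mark (P (k - b y)) ≠ 0)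
  source : ∀ x < g.n, mark x ≠ 0 → ∃ y < v, pos y = 0 ∧
    (x = y ∨ x = P (a y - 1) ∨ x = P (k - b y))

/-- Once all edges are scanned, `le_a` and `le_b` say that the recorded neighbors are the last
predecessor and the first successor on the path. Positions lie between `1` and `k`, so the records
are nonzero as soon as such an edge exists. -/
theorem MarkInv.markData {g : EdgeArray} {lev : ℕ → ℕ} {k : ℕ} {P pos a b mark : ℕ → ℕ}
    (hP : PathData g lev k P pos) (hS : ScanData g k P pos g.m a b)
    (hM : MarkInv g k P pos a b g.n mark) : MarkData g P pos mark := by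
  refine ⟨fun v hv h => (hM.marked v hv h).1, fun e he h1 h2 => ?_, fun e he h1 h2 => ?_, ?_⟩
  · have hh := g.head_lt e he
    have h3 := hS.le_a e he h1 h2
    obtain ⟨h4, -, e', he', h5, h6⟩ := hS.a_edge _ hh (by omega)
    refine ⟨e', he', h6, ?_, h5 ▸ (hM.marked _ hh h2).2.1 (by omega)⟩
    rw [h5, hP.pos_P _ (by omega)]
    omega
  · have hh := g.tail_lt e he
    have hh1 := hP.pos_le _ (g.head_lt e he)
    have h3 := hS.le_b e he h1 h2
    obtain ⟨h4, -, e', he', h5, h6⟩ := hS.b_edge _ hh (by omega)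
    have h7 := hP.pos_P (k - b (g.tail e)) (by omega)
    refine ⟨e', he', h5, ?_, ?_, h6 ▸ (hM.marked _ hh h1).2.2 (by omega)⟩
    · rw [h6, h7]; omega
    · rw [h6, h7]; omega
  -- Each kept vertex is charged to a vertex `y` outside the path, as `y` itself or as one of its
  -- two recorded neighbors. Where no neighbor is recorded the formula names an arbitrary vertex,
  -- which does no harm in an upper bound.
  · refine card_le_three_mul (fun y => P (a y - 1)) (fun y => P (k - b y)) fun x hx => ?_
    simp only [Finset.mem_filter, Finset.mem_range] at hx ⊢
    obtain ⟨y, hy, h1, h2⟩ := hM.source x hx.1 hx.2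
    exact ⟨y, ⟨hy, h1⟩, h2⟩

theorem MarkInv.step {g : EdgeArray} {k : ℕ} {P pos a b mark mark' : ℕ → ℕ} {v : ℕ}
    (hM : MarkInv g k P pos a b v mark) (hv : pos v = 0) (hmono : ∀ x, mark x ≠ 0 → mark' x ≠ 0)
    (h1 : mark' v ≠ 0) (h2 : a v ≠ 0 → mark' (P (a v - 1)) ≠ 0)
    (h3 : b v ≠ 0 → mark' (P (k - b v)) ≠ 0)
    (h4 : ∀ x, mark' x ≠ 0 → mark x ≠ 0 ∨ x = v ∨ x = P (a v - 1) ∨ x = P (k - b v)) :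
    MarkInv g k P pos a b (v + 1) mark' := by
  refine ⟨fun y hy hp => ?_, fun x hx hm => ?_⟩
  · rcases Nat.lt_succ_iff_lt_or_eq.1 hy with hy | rfl
    · obtain ⟨h5, h6, h7⟩ := hM.marked y hy hp
      exact ⟨hmono _ h5, fun h => hmono _ (h6 h), fun h => hmono _ (h7 h)⟩
    · exact ⟨h1, h2, h3⟩
  · rcases h4 x hm with h | h
    · obtain ⟨y, hy, h5⟩ := hM.source x hx h
      exact ⟨y, by omega, h5⟩
    · exact ⟨v, by omega, hv, h⟩

theorem wp_markKept {g : EdgeArray} {σ : AState} {Q : AState → ℕ → Prop} {lev : ℕ → ℕ}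
    {k : ℕ} {P pos link : ℕ → ℕ} (hP : PathData g lev k P pos) (h : StoresPath g k P pos link σ)
    (hsc : ScanData g k P pos g.m (σ.arr 10) (σ.arr 11))
    (h6 : σ.reg 6 = 0) (h0 : ∀ k, 12 ≤ k → ∀ i, σ.arr k i = 0)
    (hQ : ∀ σ' n', StoresPath g k P pos link σ' → MarkData g P pos (σ'.arr 12) →
      n' ≤ g.n → Q σ' n') :
    WP g.N ord markKept σ Q := by
  have hN : g.N = 2 * (g.n + g.m + 1) := rfl
  have hk := hP.k_le
  refine wp_for g.n (fun j σ' => StoresPath g k P pos link σ' ∧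
    MarkInv g k P pos (σ.arr 10) (σ.arr 11) j (σ'.arr 12) ∧
    σ'.arr 10 = σ.arr 10 ∧ σ'.arr 11 = σ.arr 11 ∧ σ'.reg 6 = j)
    ⟨h, ⟨by simp, by simp [h0]⟩, rfl, rfl, h6⟩
    (fun i σ h => ⟨h.2.2.2.2, h.1.r4⟩) ?_
    (fun σ' k h => hQ σ' k h.1 (h.2.1.markData hP hsc))
  rintro j σ' hj ⟨hS, hI, h10, h11, h6⟩
  have ha := hsc.a_edge j hj
  have hb := hsc.b_edge j hj
  simp [h6, hS.arr8, hS.r14, hS.arr7, h10, h11]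
  refine ⟨by omega, fun h1 => ⟨by omega, hS.congr (by simp) (by simp) (by simp) (by simp) (by simp)
    (by simp) (by simp), ⟨fun y hy hp => ?_, fun x hx hm => ?_⟩⟩, fun h1 => ⟨by omega,
    fun h2 => ?_, fun h2 => ?_⟩⟩
  · refine hI.marked y ?_ hp
    have : y ≠ j := by rintro rfl; exact h1 hp
    omega
  · obtain ⟨y, hy, h5⟩ := hI.source x hx hm
    exact ⟨y, by omega, h5⟩
  · have h3 := (ha h2).1
    have h4 := hP.P_lt (σ.arr 10 j - 1) (by omega)
    refine ⟨by omega, by omega, by omega, fun h5 => ?_, fun h5 => ?_⟩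
    · have h6 := (hb h5).1
      have h7 := hP.P_lt (k - σ.arr 11 j) (by omega)
      refine ⟨by omega, by omega, by omega, hS.congr (by simp) (by simp) (by simp) (by simp)
        (by simp) (by simp) (by simp), hI.step h1 ?_ ?_ ?_ ?_ ?_⟩
      all_goals simp [Function.update_apply]
      all_goals grind
    · refine ⟨by omega, hS.congr (by simp) (by simp) (by simp) (by simp)
        (by simp) (by simp) (by simp), hI.step h1 ?_ ?_ ?_ ?_ ?_⟩
      all_goals simp [Function.update_apply]
      all_goals grind
  · refine ⟨by omega, fun h5 => ?_, fun h5 => ?_⟩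
    · have h6 := (hb h5).1
      have h7 := hP.P_lt (k - σ.arr 11 j) (by omega)
      refine ⟨by omega, by omega, by omega, hS.congr (by simp) (by simp) (by simp) (by simp)
        (by simp) (by simp) (by simp), hI.step h1 ?_ ?_ ?_ ?_ ?_⟩
      all_goals simp [Function.update_apply]
      all_goals grind
    · refine ⟨by omega, hS.congr (by simp) (by simp) (by simp) (by simp)
        (by simp) (by simp) (by simp), hI.step h1 ?_ ?_ ?_ ?_ ?_⟩
      all_goals simp [Function.update_apply]
      all_goals grind

end ArrayLang

/-! ### Preprocessing: the output graph -/

namespace ArrayLang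

open WordRAM (encodeEdges)

variable {ord : ℕ → ℕ → Bool}

theorem length_encodeEdges (hl : List (ℕ × ℕ)) : (encodeEdges hl).length = 2 * hl.length := by
  induction hl with
  | nil => rfl
  | cons e hl ih =>
    simp only [encodeEdges, List.flatMap_cons, List.length_append, List.length_cons,
      List.length_nil] at ih ⊢
    omega

theorem Holds.append_edge {f : ℕ → ℕ} {hl : List (ℕ × ℕ)} (h : Holds f (encodeEdges hl)) {i : ℕ}
    (hi : i = 2 * hl.length) (a b : ℕ) :
    Holds (Function.update (Function.update f i a) (i + 1) b) (encodeEdges (hl ++ [(a, b)])) := by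
  have h1 : encodeEdges (hl ++ [(a, b)]) = encodeEdges hl ++ [a] ++ [b] := by simp [encodeEdges]
  rw [h1]
  exact (h.append (hi.trans (length_encodeEdges hl).symm) a).append
    (by simp [length_encodeEdges, hi]) b

/-- Outputs the edges between consecutive kept vertices of the path. Register `8` is one plus the
last kept vertex. -/
def pathEdges : ACmd := .loop (.lt (.reg 6) (.reg 14)) (.block [
  .assign 7 (.arr 7 (.reg 6)),
  .cond (.arr 12 (.reg 7))
    (.block [
      .cond (.reg 8)
        (.block [
          .store 14 (.reg 12) (.sub (.reg 8) (.const 1)),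
          .store 14 (.add (.reg 12) (.const 1)) (.reg 7),
          .assign 12 (.add (.reg 12) (.const 2))])
        .skip,
      .assign 8 (.add (.reg 7) (.const 1))])
    .skip,
  .assign 6 (.add (.reg 6) (.const 1))])

/-- The edges `hl` between kept vertices on the first `i` positions of the path; `prev` is one plus the
last kept vertex. -/
structure PathEdges (g : EdgeArray) (pos mark : ℕ → ℕ) (i : ℕ) (hl : List (ℕ × ℕ)) (prev : ℕ) :
    Prop where
  nodup : hl.Nodup
  sound : ∀ a b, (a, b) ∈ hl → a < g.n ∧ b < g.n ∧ mark a ≠ 0 ∧ mark b ≠ 0 ∧ pos a ≠ 0 ∧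
    pos a < pos b ∧ pos b ≤ i
  complete : ∀ R : ℕ → ℕ → Prop, (∀ a b c, R a b → R b c → R a c) → (∀ a b, (a, b) ∈ hl → R a b) →
    ∀ a < g.n, ∀ b < g.n, mark a ≠ 0 → mark b ≠ 0 → pos a ≠ 0 → pos a < pos b → pos b ≤ i → R a b
  prev : (prev = 0 ∧ hl = [] ∧ ∀ x < g.n, mark x ≠ 0 → pos x ≠ 0 → i < pos x) ∨
    ∃ x < g.n, prev = x + 1 ∧ mark x ≠ 0 ∧ pos x ≠ 0 ∧ pos x ≤ i ∧
      (∀ y < g.n, mark y ≠ 0 → pos y ≠ 0 → pos y ≤ i → pos y ≤ pos x) ∧ hl.length + 1 ≤ i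

theorem PathData.pos_inj {g : EdgeArray} {lev : ℕ → ℕ} {k : ℕ} {P pos : ℕ → ℕ}
    (hP : PathData g lev k P pos) {x y : ℕ} (hx : x < g.n) (hy : y < g.n) (hx0 : pos x ≠ 0)
    (h : pos x = pos y) : x = y := by
  rw [← hP.P_pos x hx hx0, ← hP.P_pos y hy (h ▸ hx0), h]

theorem PathEdges.length_le {g : EdgeArray} {pos mark : ℕ → ℕ} {i : ℕ} {hl : List (ℕ × ℕ)}
    {prev : ℕ} (h : PathEdges g pos mark i hl prev) : hl.length ≤ i - 1 := by
  rcases h.prev with ⟨-, rfl, -⟩ | ⟨x, -, -, -, -, -, -, h⟩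
  · simp
  · omega

theorem PathEdges.skip {g : EdgeArray} {lev : ℕ → ℕ} {k : ℕ} {P pos mark : ℕ → ℕ} {i : ℕ}
    {hl : List (ℕ × ℕ)} {prev : ℕ} (hP : PathData g lev k P pos)
    (h : PathEdges g pos mark i hl prev) (hm : mark (P i) = 0) :
    PathEdges g pos mark (i + 1) hl prev := by
  have key : ∀ x < g.n, mark x ≠ 0 → pos x ≠ i + 1 := by
    intro x hx hmx hpx
    have := hP.P_pos x hx (by omega)
    rw [hpx, Nat.add_sub_cancel] at this
    exact hmx (this ▸ hm)
  refine ⟨h.nodup, fun a b hab => ?_, fun R hR hl a ha b hb hma hmb h0 h1 h2 => ?_, ?_⟩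
  · obtain ⟨h1, h2, h3, h4, h5, h6, h7⟩ := h.sound a b hab
    exact ⟨h1, h2, h3, h4, h5, h6, by omega⟩
  · have := key b hb hmb
    exact h.complete R hR hl a ha b hb hma hmb h0 h1 (by omega)
  · rcases h.prev with ⟨h1, h2, h3⟩ | ⟨x, h1, h2, h3, h4, h5, h6, h7⟩
    · refine .inl ⟨h1, h2, fun x hx hmx h0 => ?_⟩
      have := key x hx hmx
      have := h3 x hx hmx h0
      omega
    · refine .inr ⟨x, h1, h2, h3, h4, by omega, fun y hy hmy h0 h8 => ?_, by omega⟩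
      have := key y hy hmy
      exact h6 y hy hmy h0 (by omega)

theorem PathEdges.start {g : EdgeArray} {lev : ℕ → ℕ} {k : ℕ} {P pos mark : ℕ → ℕ} {i : ℕ}
    {hl : List (ℕ × ℕ)} (hP : PathData g lev k P pos) (hi : i < k)
    (h : PathEdges g pos mark i hl 0) (hm : mark (P i) ≠ 0) :
    PathEdges g pos mark (i + 1) hl (P i + 1) := by
  rcases h.prev with ⟨h1, rfl, h3⟩ | ⟨x, h1, h2, h3⟩
  · refine ⟨List.nodup_nil, by simp, fun R hR hl a ha b hb hma hmb h0 h4 h5 => ?_, .inr ⟨P i,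
      hP.P_lt i hi, rfl, hm, by rw [hP.pos_P i hi]; omega, by rw [hP.pos_P i hi],
      fun y _ _ _ h => by rw [hP.pos_P i hi]; exact h, by simp⟩⟩
    have := h3 a ha hma h0
    omega
  · omega

/-- A chain suffices for `complete`: every kept path vertex before `P i` is the previous kept vertex
`x` or already related to `x`, and transitivity adds the step from `x` to `P i`. -/
theorem PathEdges.push {g : EdgeArray} {lev : ℕ → ℕ} {k : ℕ} {P pos mark : ℕ → ℕ} {i : ℕ}
    {hl : List (ℕ × ℕ)} {prev : ℕ} (hP : PathData g lev k P pos) (hi : i < k) (hprev : prev ≠ 0)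
    (h : PathEdges g pos mark i hl prev) (hm : mark (P i) ≠ 0) :
    PathEdges g pos mark (i + 1) (hl ++ [(prev - 1, P i)]) (P i + 1) := by
  rcases h.prev with ⟨h1, rfl, h3⟩ | ⟨x, h1, rfl, h3, h4, h5, h6, h7⟩
  · omega
  have hpi := hP.pos_P i hi
  have hil := hP.P_lt i hi
  rw [Nat.add_sub_cancel]
  refine ⟨?_, fun a b hab => ?_, fun R hR hl a ha b hb hma hmb h0 h8 h9 => ?_, .inr ⟨P i,
      hil, rfl, hm, by omega, by omega, fun y _ _ _ h => by omega, by simp; omega⟩⟩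
  · rw [List.nodup_append]
    refine ⟨h.nodup, by simp, fun e he e' he' hee => ?_⟩
    rw [List.mem_singleton.1 he'] at hee
    subst hee
    have := (h.sound _ _ he).2.2.2.2.2.2
    omega
  · rcases List.mem_append.1 hab with hab | hab
    · obtain ⟨h1, h2, h3, h4, h5, h6, h7⟩ := h.sound a b hab
      exact ⟨h1, h2, h3, h4, h5, h6, by omega⟩
    · rw [List.mem_singleton, Prod.mk.injEq] at hab
      obtain ⟨rfl, rfl⟩ := hab
      exact ⟨h1, hil, h3, hm, h4, by omega, by omega⟩
  · have hl' := fun a b hab => hl a b (List.mem_append_left _ hab)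
    have hx := hl x (P i) (by simp)
    by_cases hb1 : pos b ≤ i
    · exact h.complete R hR hl' a ha b hb hma hmb h0 h8 hb1
    · have hbi : b = P i := hP.pos_inj hb hil (by omega) (by omega)
      subst hbi
      have h10 := h6 a ha hma h0 (by omega)
      rcases Nat.eq_or_lt_of_le h10 with h10 | h10
      · rw [hP.pos_inj ha h1 h0 h10]; exact hx
      · exact hR _ _ _ (h.complete R hR hl' a ha x h1 hma h3 h0 h10 h5) hx

theorem wp_pathEdges {g : EdgeArray} {σ : AState} {Q : AState → ℕ → Prop} {lev : ℕ → ℕ}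
    {k : ℕ} {P pos link : ℕ → ℕ} (hP : PathData g lev k P pos) (h : StoresPath g k P pos link σ)
    (h6 : σ.reg 6 = 0) (h8 : σ.reg 8 = 0) (h12 : σ.reg 12 = 0)
    (hQ : ∀ σ' n' hl prev, StoresPath g k P pos link σ' → PathEdges g pos (σ.arr 12) k hl prev →
      σ'.arr 12 = σ.arr 12 → σ'.reg 12 = 2 * hl.length → Holds (σ'.arr 14) (encodeEdges hl) →
      n' ≤ k → Q σ' n') :
    WP g.N ord pathEdges σ Q := by
  have hN : g.N = 2 * (g.n + g.m + 1) := rfl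
  have hk := hP.k_le
  refine wp_for k (fun j σ' => StoresPath g k P pos link σ' ∧ (∃ hl,
    PathEdges g pos (σ.arr 12) j hl (σ'.reg 8) ∧ σ'.reg 12 = 2 * hl.length ∧
    Holds (σ'.arr 14) (encodeEdges hl)) ∧ σ'.arr 12 = σ.arr 12 ∧ σ'.reg 6 = j)
    ⟨h, ⟨[], ⟨List.nodup_nil, by simp, ?_, .inl ⟨h8, rfl, ?_⟩⟩, h12, .nil _⟩, rfl, h6⟩
    (fun i σ h => ⟨h.2.2.2, h.1.r14⟩) ?_
    (fun σ' n' ⟨h1, ⟨hl, h2, h3, h4⟩, h5, h6⟩ => hQ σ' n' hl _ h1 h2 h5 h3 h4)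
  · intro R hR hl a ha b hb hma hmb h0 h8 h9; omega
  · intro x hx hm h0; omega
  rintro j σ' hj ⟨hS, ⟨hl, hI, hlen, hH⟩, h12, h6⟩
  have hPj := hP.P_lt j hj
  have hle := hI.length_le
  simp [h6, hS.arr7, h12, hlen]
  repeat refine And.intro (by omega) ?_
  refine ⟨fun hm => ⟨fun h0 => ?_, fun h0 => ?_⟩, fun hm => ?_⟩
  · refine ⟨by omega, by omega, by omega, by omega, by omega, by omega, hS.congr (by simp) (by simp)
      (by simp) (by simp) (by simp) (by simp) (by simp), _, hI.push hP hj h0 hm, by simp; omega, ?_⟩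
    exact hH.append_edge rfl _ _
  · refine ⟨by omega, by omega, hS.congr (by simp) (by simp)
      (by simp) (by simp) (by simp) (by simp) (by simp), _, (h0 ▸ hI).start hP hj hm, rfl, hH⟩
  · exact ⟨by omega, hS.congr (by simp) (by simp) (by simp) (by simp) (by simp) (by simp) (by simp),
      _, hI.skip hP hm, rfl, hH⟩

/-- Outputs the current edge. -/
def outputEdge : ACmd := .block [
  .store 14 (.reg 12) (.reg 7),
  .store 14 (.add (.reg 12) (.const 1)) (.reg 8),
  .assign 12 (.add (.reg 12) (.const 2))]

/-- Outputs the edges between kept vertices that are not both on the path. -/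
def keptEdges : ACmd := .loop (.lt (.reg 6) (.reg 5)) (.block [
  .assign 7 (.arr 0 (.add (.reg 6) (.reg 6))),
  .assign 8 (.arr 0 (.add (.add (.reg 6) (.reg 6)) (.const 1))),
  .cond (.arr 12 (.reg 7))
    (.cond (.arr 12 (.reg 8))
      (.cond (.arr 8 (.reg 7)) (.cond (.arr 8 (.reg 8)) .skip outputEdge) outputEdge) .skip) .skip,
  .assign 6 (.add (.reg 6) (.const 1))])

/-- The edges `hl` of the output graph, with respect to the first `j` edges of the input graph. -/
structure OutputEdges (g : EdgeArray) (k : ℕ) (pos mark : ℕ → ℕ) (j : ℕ) (hl : List (ℕ × ℕ)) :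
    Prop where
  nodup : hl.Nodup
  sound : ∀ a b, (a, b) ∈ hl → a < g.n ∧ b < g.n ∧ mark a ≠ 0 ∧ mark b ≠ 0 ∧
    ((pos a ≠ 0 ∧ pos b ≠ 0 ∧ pos a < pos b) ∨
      ((pos a = 0 ∨ pos b = 0) ∧ ∃ e < j, g.tail e = a ∧ g.head e = b))
  path : ∀ R : ℕ → ℕ → Prop, (∀ a b c, R a b → R b c → R a c) → (∀ a b, (a, b) ∈ hl → R a b) →
    ∀ a < g.n, ∀ b < g.n, mark a ≠ 0 → mark b ≠ 0 → pos a ≠ 0 → pos a < pos b → R a b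
  edge : ∀ e < j, mark (g.tail e) ≠ 0 → mark (g.head e) ≠ 0 →
    (pos (g.tail e) = 0 ∨ pos (g.head e) = 0) → (g.tail e, g.head e) ∈ hl
  length_le : hl.length ≤ (k - 1) + j

theorem OutputEdges.skip {g : EdgeArray} {k : ℕ} {pos mark : ℕ → ℕ} {j : ℕ} {hl : List (ℕ × ℕ)}
    (h : OutputEdges g k pos mark j hl)
    (hj : ¬ (mark (g.tail j) ≠ 0 ∧ mark (g.head j) ≠ 0 ∧
      (pos (g.tail j) = 0 ∨ pos (g.head j) = 0))) :
    OutputEdges g k pos mark (j + 1) hl := by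
  refine ⟨h.nodup, fun a b hab => ?_, h.path, fun e he h1 h2 h3 => ?_, by have := h.length_le; omega⟩
  · obtain ⟨h1, h2, h3, h4, h5⟩ := h.sound a b hab
    refine ⟨h1, h2, h3, h4, h5.imp id ?_⟩
    rintro ⟨h6, e, he, h7⟩
    exact ⟨h6, e, by omega, h7⟩
  · rcases Nat.lt_succ_iff_lt_or_eq.1 he with he | rfl
    · exact h.edge e he h1 h2 h3
    · exact absurd ⟨h1, h2, h3⟩ hj

theorem OutputEdges.push {g : EdgeArray} {k : ℕ} {pos mark : ℕ → ℕ} {j : ℕ} {hl : List (ℕ × ℕ)}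
    (h : OutputEdges g k pos mark j hl) (hj : j < g.m) (h1 : mark (g.tail j) ≠ 0)
    (h2 : mark (g.head j) ≠ 0) (h3 : pos (g.tail j) = 0 ∨ pos (g.head j) = 0) :
    OutputEdges g k pos mark (j + 1) (hl ++ [(g.tail j, g.head j)]) := by
  refine ⟨?_, fun a b hab => ?_, fun R hR hl => ?_, fun e he h1 h2 h3 => ?_, ?_⟩
  · rw [List.nodup_append]
    refine ⟨h.nodup, by simp, fun e he e' he' hee => ?_⟩
    rw [List.mem_singleton.1 he'] at hee
    subst hee
    -- The new edge is not one of the pairs on the path, since one of its ends is outside, and it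
    -- differs from all earlier input edges.
    obtain ⟨-, -, -, -, h4 | ⟨-, i, hi, h4, h5⟩⟩ := h.sound _ _ he
    · omega
    · have := g.inj i (by omega) j hj h4 h5
      omega
  · rcases List.mem_append.1 hab with hab | hab
    · obtain ⟨h1, h2, h3, h4, h5⟩ := h.sound a b hab
      refine ⟨h1, h2, h3, h4, h5.imp id ?_⟩
      rintro ⟨h6, e, he, h7⟩
      exact ⟨h6, e, by omega, h7⟩
    · rw [List.mem_singleton, Prod.mk.injEq] at hab
      obtain ⟨rfl, rfl⟩ := hab
      exact ⟨g.tail_lt j hj, g.head_lt j hj, h1, h2, .inr ⟨h3, j, by omega, rfl, rfl⟩⟩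
  · exact h.path R hR fun a b hab => hl a b (List.mem_append_left _ hab)
  · rcases Nat.lt_succ_iff_lt_or_eq.1 he with he | rfl
    · exact List.mem_append_left _ (h.edge e he h1 h2 h3)
    · simp
  · have := h.length_le
    simp only [List.length_append, List.length_singleton]
    omega

theorem wp_keptEdges {g : EdgeArray} {σ : AState} {Q : AState → ℕ → Prop} {lev : ℕ → ℕ}
    {k : ℕ} {P pos link : ℕ → ℕ} {hl : List (ℕ × ℕ)} {prev : ℕ} (hP : PathData g lev k P pos)
    (h : StoresPath g k P pos link σ) (hpe : PathEdges g pos (σ.arr 12) k hl prev)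
    (h6 : σ.reg 6 = 0) (h12 : σ.reg 12 = 2 * hl.length) (hh : Holds (σ.arr 14) (encodeEdges hl))
    (hQ : ∀ σ' n' hl, StoresPath g k P pos link σ' → OutputEdges g k pos (σ.arr 12) g.m hl →
      σ'.arr 12 = σ.arr 12 → σ'.reg 12 = 2 * hl.length → Holds (σ'.arr 14) (encodeEdges hl) →
      n' ≤ g.m → Q σ' n') :
    WP g.N ord keptEdges σ Q := by
  have hN : g.N = 2 * (g.n + g.m + 1) := rfl
  have hk := hP.k_le
  refine wp_for g.m (fun j σ' => StoresPath g k P pos link σ' ∧ (∃ hl,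
    OutputEdges g k pos (σ.arr 12) j hl ∧ σ'.reg 12 = 2 * hl.length ∧
    Holds (σ'.arr 14) (encodeEdges hl)) ∧ σ'.arr 12 = σ.arr 12 ∧ σ'.reg 6 = j)
    ⟨h, ⟨hl, ⟨hpe.nodup, fun a b hab => ?_, ?_, by simp, hpe.length_le⟩, h12, hh⟩, rfl, h6⟩
    (fun i σ h => ⟨h.2.2.2, h.1.r5⟩) ?_
    (fun σ' n' ⟨h1, ⟨hl, h2, h3, h4⟩, h5, h6⟩ => hQ σ' n' hl h1 h2 h5 h3 h4)
  · obtain ⟨h1, h2, h3, h4, h5, h6, h7⟩ := hpe.sound a b hab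
    exact ⟨h1, h2, h3, h4, .inl ⟨h5, by omega, h6⟩⟩
  · exact fun R hR hl a ha b hb hma hmb h0 h1 =>
      hpe.complete R hR hl a ha b hb hma hmb h0 h1 (hP.pos_le b hb)
  rintro j σ' hj ⟨hS, ⟨hl, hI, hlen, hH⟩, h12, h6⟩
  have ht := hS.tail j hj
  have hh := hS.head j hj
  have ht1 := g.tail_lt j hj
  have hh1 := g.head_lt j hj
  -- At most `(k - 1) + j` edges with `k ≤ n` have been written, so the next two cells lie below `N
  -- = 2 * (n + m + 1)`.
  have hle := hI.length_le
  simp [outputEdge, h6, ht, hh, hS.arr8, h12, hlen]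
  repeat refine And.intro (by omega) ?_
  refine ⟨fun h1 => ⟨by omega, fun h2 => ⟨by omega, fun h3 => ⟨by omega, fun h4 => ?_, fun h4 => ?_⟩,
    fun h3 => ?_⟩, fun h2 => ?_⟩, fun h1 => ?_⟩
  · exact ⟨by omega, hS.congr (by simp) (by simp) (by simp) (by simp) (by simp) (by simp) (by simp),
      _, hI.skip (by tauto), rfl, hH⟩
  · refine ⟨by omega, by omega, by omega, by omega, by omega, hS.congr (by simp) (by simp)
      (by simp) (by simp) (by simp) (by simp) (by simp), _, hI.push hj h1 h2 (.inr h4),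
      by simp; omega, hH.append_edge rfl _ _⟩
  · refine ⟨by omega, by omega, by omega, by omega, by omega, hS.congr (by simp) (by simp)
      (by simp) (by simp) (by simp) (by simp) (by simp), _, hI.push hj h1 h2 (.inl h3),
      by simp; omega, hH.append_edge rfl _ _⟩
  · exact ⟨by omega, hS.congr (by simp) (by simp) (by simp) (by simp) (by simp) (by simp) (by simp),
      _, hI.skip (by tauto), rfl, hH⟩
  · exact ⟨by omega, hS.congr (by simp) (by simp) (by simp) (by simp) (by simp) (by simp) (by simp),
      _, hI.skip (by tauto), rfl, hH⟩

/-- Outputs the kept vertices. -/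
def keptVertices : ACmd := .loop (.lt (.reg 6) (.reg 4)) (.block [
  .cond (.arr 12 (.reg 6))
    (.block [.store 13 (.reg 0) (.reg 6), .assign 0 (.add (.reg 0) (.const 1))]) .skip,
  .assign 6 (.add (.reg 6) (.const 1))])

theorem wp_keptVertices {g : EdgeArray} {σ : AState} {Q : AState → ℕ → Prop}
    {k : ℕ} {P pos link : ℕ → ℕ} (h : StoresPath g k P pos link σ)
    (h6 : σ.reg 6 = 0) (h0 : σ.reg 0 = 0)
    (hQ : ∀ σ' n' ys, StoresPath g k P pos link σ' → ys.Nodup →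
      (∀ x, x ∈ ys ↔ x < g.n ∧ σ.arr 12 x ≠ 0) → σ'.reg 0 = ys.length → Holds (σ'.arr 13) ys →
      σ'.arr 14 = σ.arr 14 → σ'.reg 12 = σ.reg 12 → n' ≤ g.n → Q σ' n') :
    WP g.N ord keptVertices σ Q := by
  have hN : g.N = 2 * (g.n + g.m + 1) := rfl
  refine wp_for g.n (fun j σ' => StoresPath g k P pos link σ' ∧ (∃ ys : List ℕ, ys.Nodup ∧
    (∀ x, x ∈ ys ↔ x < j ∧ σ.arr 12 x ≠ 0) ∧ σ'.reg 0 = ys.length ∧ Holds (σ'.arr 13) ys) ∧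
    σ'.arr 14 = σ.arr 14 ∧ σ'.reg 12 = σ.reg 12 ∧ σ'.arr 12 = σ.arr 12 ∧ σ'.reg 6 = j)
    ⟨h, ⟨[], List.nodup_nil, by simp, h0, .nil _⟩, rfl, rfl, rfl, h6⟩
    (fun i σ h => ⟨h.2.2.2.2.2, h.1.r4⟩) ?_
    (fun σ' n' ⟨h1, ⟨ys, h2, h3, h4, h5⟩, h6, h7, _⟩ => hQ σ' n' ys h1 h2 h3 h4 h5 h6 h7)
  rintro j σ' hj ⟨hS, ⟨ys, hnd, hmem, hlen, hH⟩, h14, hr12, h12, h6⟩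
  have hle := length_le_of_nodup_of_lt (n := g.n) hnd fun x hx => by have := (hmem x).1 hx; omega
  simp [h6, h12, hlen, h14, hr12]
  refine ⟨by omega, fun hm => ?_, fun hm => ?_⟩
  · refine ⟨by omega, by omega, by omega, hS.congr (by simp) (by simp)
      (by simp) (by simp) (by simp) (by simp) (by simp), ys ++ [j], ?_, fun x => ?_, by simp,
      hH.append rfl j⟩
    · rw [List.nodup_append]
      refine ⟨hnd, by simp, fun x hx y hy hxy => ?_⟩
      rw [List.mem_singleton.1 hy] at hxy
      have := (hmem x).1 hx
      omega
    · rw [List.mem_append, hmem, List.mem_singleton]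
      constructor
      · rintro (⟨h1, h2⟩ | rfl)
        · exact ⟨by omega, h2⟩
        · exact ⟨le_rfl, hm⟩
      · rintro ⟨h1, h2⟩
        rcases Nat.lt_or_eq_of_le h1 with h1 | h1
        · exact .inl ⟨h1, h2⟩
        · exact .inr h1
  · refine ⟨by omega, hS.congr (by simp) (by simp)
      (by simp) (by simp) (by simp) (by simp) (by simp), ys, hnd, fun x => ?_, rfl, hH⟩
    rw [hmem]
    constructor
    · rintro ⟨h1, h2⟩
      exact ⟨by omega, h2⟩
    · rintro ⟨h1, h2⟩
      rcases Nat.lt_or_eq_of_le h1 with h1 | rfl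
      · exact ⟨h1, h2⟩
      · exact absurd hm h2

/-- The preprocessing program; initially, the graph is stored. -/
def preprocessing : ACmd := .block [
  .assign 6 (.const 0), buildAdjacency,
  .assign 6 (.const 0), .assign 11 (.const 0), initQueue,
  .assign 7 (.const 0), .assign 10 (.const 0), .assign 13 (.const 0), topoSort,
  tracePath,
  .assign 6 (.const 0), scanNeighbors,
  .assign 6 (.const 0), markKept,
  .assign 6 (.const 0), .assign 8 (.const 0), .assign 12 (.const 0), pathEdges,
  .assign 6 (.const 0), keptEdges,
  .assign 6 (.const 0), .assign 0 (.const 0), keptVertices,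
  .assign 2 (.div (.reg 12) (.const 2))]

/-- The final state of the preprocessing program. -/
structure Preprocessed (g : EdgeArray) (lev : ℕ → ℕ) (k : ℕ) (P pos link mark : ℕ → ℕ)
    (ys : List ℕ) (hl : List (ℕ × ℕ)) (σ : AState) : Prop extends
    PathData g lev k P pos, PathLinks g k P link, StoresPath g k P pos link σ,
    MarkData g P pos mark where
  output : OutputEdges g k pos mark g.m hl
  nodup : ys.Nodup
  mem : ∀ x, x ∈ ys ↔ x < g.n ∧ mark x ≠ 0
  r0 : σ.reg 0 = ys.length
  r2 : σ.reg 2 = hl.length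
  vertices : Holds (σ.arr 13) ys
  edges : Holds (σ.arr 14) (encodeEdges hl)

theorem wp_preprocessing {g : EdgeArray} {σ : AState} {Q : AState → ℕ → Prop} (h : Stores g σ)
    (h0 : ∀ k, 1 ≤ k → ∀ i, σ.arr k i = 0)
    (hQ : ∀ σ' n' lev k P pos link mark ys hl, Preprocessed g lev k P pos link mark ys hl σ' →
      n' ≤ 7 * (g.n + g.m) → Q σ' n') :
    WP g.N ord preprocessing σ Q := by
  have ass : ∀ {σ : AState} {Q : AState → ℕ → Prop} {r c : ℕ} {cs : List ACmd}, r ≠ 9 → c < 20 →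
      WP g.N ord (.block cs) (σ.setReg r c) Q →
      WP g.N ord (.block (.assign r (.const c) :: cs)) σ Q := by
    intro σ Q r c cs hr hc h
    rw [wp_block_cons, wp_assign]
    refine ⟨hr, hc, ?_⟩
    simpa using h
  unfold preprocessing
  refine ass (by simp) (by simp) ?_
  rw [wp_block_cons]
  refine wp_buildAdjacency (h.congr (by simp) (by simp) (by simp)) (by simp) (by simpa using h0) ?_
  intro σ n1 hA hn1
  refine ass (by simp) (by simp) (ass (by simp) (by simp) ?_)
  rw [wp_block_cons]
  refine wp_initQueue ⟨hA.toStores.congr (by simp) (by simp) (by simp), by simpa using hA.first,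
    by simpa using hA.next, by simpa using hA.indeg, by simpa using hA.zero⟩ (by simp) (by simp) ?_
  intro σ2 n2 q hB hn2
  refine ass (by simp) (by simp) (ass (by simp) (by simp) (ass (by simp) (by simp) ?_))
  rw [wp_block_cons]
  refine wp_topoSort (q := q) (d := σ.arr 3) ⟨hB.toStores.congr (by simp) (by simp) (by simp),
    by simpa using hB.first, by simpa using hB.next, by simpa using hB.indeg,
    by simpa using hB.queue, by simpa using hB.len, hB.nodup, by simpa using hB.mem,
    by simpa using hB.lev, by simpa using hB.pred, by simpa using hB.zero⟩ hA.indeg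
    (by simp) (by simp) (by simp) ?_
  intro σ3 n3 hS3 hL hz3 hn3
  rw [wp_block_cons]
  refine wp_tracePath hS3 hL hz3 ?_
  intro σ4 n4 lev k P pos link hP hlinks hS4 hz4 hn4
  refine ass (by simp) (by simp) ?_
  rw [wp_block_cons]
  refine wp_scanNeighbors hP (hS4.congr (by simp) (by simp) (by simp) (by simp) (by simp) (by simp)
    (by simp)) (by simp) (by simpa using hz4) ?_
  intro σ5 n5 hS5 hsc hz5 hn5
  refine ass (by simp) (by simp) ?_
  rw [wp_block_cons]
  refine wp_markKept hP (hS5.congr (by simp) (by simp) (by simp) (by simp) (by simp) (by simp)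
    (by simp)) (by simpa using hsc) (by simp) (by simpa using hz5) ?_
  intro σ6 n6 hS6 hM hn6
  refine ass (by simp) (by simp) (ass (by simp) (by simp) (ass (by simp) (by simp) ?_))
  rw [wp_block_cons]
  refine wp_pathEdges hP (hS6.congr (by simp) (by simp) (by simp) (by simp) (by simp) (by simp)
    (by simp)) (by simp) (by simp) (by simp) ?_
  intro σ7 n7 hl prev hS7 hpe h12 hr12 hH hn7
  simp only [AState.setReg_arr] at hpe h12
  refine ass (by simp) (by simp) ?_
  rw [wp_block_cons]
  refine wp_keptEdges (hl := hl) (prev := prev) hP (hS7.congr (by simp) (by simp) (by simp)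
    (by simp) (by simp) (by simp) (by simp)) (by simpa [h12] using hpe) (by simp)
    (by simpa using hr12) (by simpa using hH) ?_
  intro σ8 n8 hl hS8 hout h12' hr12 hH hn8
  simp only [AState.setReg_arr, h12] at hout h12'
  refine ass (by simp) (by simp) (ass (by simp) (by simp) ?_)
  rw [wp_block_cons]
  refine wp_keptVertices (hS8.congr (by simp) (by simp) (by simp)
    (by simp) (by simp) (by simp) (by simp)) (by simp) (by simp) ?_
  intro σ9 n9 ys hS9 hnd hmem hr0 hY h14 hr12' hn9
  simp only [AState.setReg_arr, h12', AState.setReg_reg] at hmem h14 hr12'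
  simp at hr12'
  have hk := hP.k_le
  simp
  -- The nine phases together need at most `6 * n + 4 * m` iterations.
  refine hQ _ _ lev k P pos link (σ6.arr 12) ys hl ⟨hP, hlinks, hS9.congr (by simp) (by simp)
    (by simp) (by simp) (by simp) (by simp) (by simp), hM, hout, hnd, hmem, by simpa using hr0, ?_,
    by simpa using hY, by simpa [h14] using hH⟩ (by omega)
  simp [hr12', hr12]

end ArrayLang

/-! ### The sorting program -/

namespace ArrayLang

variable {ord : ℕ → ℕ → Bool}

/-- The linked list `lk` that starts in cell `n` and ends with `n` runs through the items in `S` by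
increasing rank `r`. -/
def Linked (r : ℕ → ℕ) (n : ℕ) (S : ℕ → Prop) (lk : ℕ → ℕ) : Prop :=
  ∀ a, (a = n ∨ S a) → (lk a ≠ n → S (lk a) ∧ (a = n ∨ r a < r (lk a))) ∧
    ∀ z, S z → (a = n ∨ r a < r z) → lk a ≠ n ∧ r (lk a) ≤ r z

/-- Here `p` is the largest listed item below `y`, or the head cell `n` if there is none. For any
item before `p` the next larger item is at most `p`, hence below `y`, so only the links of `p` and
`y` have to change. -/
theorem Linked.insert {r : ℕ → ℕ} {n : ℕ} {S : ℕ → Prop} {lk : ℕ → ℕ} (h : Linked r n S lk)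
    (hS : ∀ x, S x → x < n) (hr : ∀ x < n, ∀ y < n, r x = r y → x = y) {y p : ℕ} (hy : y < n)
    (hyS : ¬ S y) (hp : p = n ∨ S p) (hpy : p = n ∨ r p < r y)
    (hmax : ∀ z, S z → r z < r y → p ≠ n ∧ r z ≤ r p) :
    Linked r n (fun x => S x ∨ x = y) (Function.update (Function.update lk y (lk p)) p y) := by
  have hne : p ≠ y := by
    rintro rfl
    rcases hp with rfl | hp
    · omega
    · exact hyS hp
  have hlt : ∀ z, S z → ¬ r z < r y → r y < r z := fun z hz h => by
    have : r z ≠ r y := fun h => hyS (hr z (hS z hz) y hy h ▸ hz)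
    omega
  intro a ha
  by_cases hap : a = p
  · subst hap
    rw [Function.update_self]
    refine ⟨fun _ => ⟨.inr rfl, hpy⟩, fun z hz haz => ⟨by omega, ?_⟩⟩
    rcases hz with hz | rfl
    · by_contra hc
      obtain ⟨h1, h2⟩ := hmax z hz (by omega)
      omega
    · exact le_rfl
  rw [Function.update_of_ne hap]
  by_cases hay : a = y
  · subst hay
    rw [Function.update_self]
    obtain ⟨h1, h2⟩ := h p hp
    refine ⟨fun h3 => ?_, fun z hz haz => ?_⟩
    · obtain ⟨h4, h5⟩ := h1 h3
      refine ⟨.inl h4, .inr (hlt _ h4 fun h6 => ?_)⟩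
      obtain ⟨h7, h8⟩ := hmax _ h4 h6
      omega
    · rcases hz with hz | rfl
      · exact h2 z hz (by omega)
      · omega
  rw [Function.update_of_ne hay]
  have haS : a = n ∨ S a := by tauto
  obtain ⟨h1, h2⟩ := h a haS
  refine ⟨fun h3 => ⟨.inl (h1 h3).1, (h1 h3).2⟩, fun z hz haz => ?_⟩
  rcases hz with hz | rfl
  · exact h2 z hz haz
  · have hpS : S p ∧ (a = n ∨ r a < r p) := by
      rcases haS with rfl | haS
      · exact ⟨by tauto, .inl rfl⟩
      · have h3 : a < n := hS a haS
        obtain ⟨h4, h5⟩ := hmax a haS (by omega)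
        have h6 : S p := by tauto
        refine ⟨h6, .inr (lt_of_le_of_ne h5 fun h7 => hap (hr a h3 p (hS p h6) h7))⟩
    obtain ⟨h3, h4⟩ := h2 p hpS.1 hpS.2
    have h5 := hS p hpS.1
    exact ⟨h3, by omega⟩

/-- `Linked` forces `lk a` to be the least item above `a`, which is the head of what remains of the
sorted list. -/
theorem Linked.holdsLinkedList {r : ℕ → ℕ} {n : ℕ} {S : ℕ → Prop} {lk : ℕ → ℕ}
    (h : Linked r n S lk) (hS : ∀ x, S x → x < n)
    {mem : ℕ → ℕ} {A : ℕ} (hmem : ∀ x < n, mem (A + x) = lk x) (l : List ℕ) (a : ℕ)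
    (ha : a = n ∨ S a) (hl : l.Pairwise fun x y => r x < r y)
    (hal : ∀ z, z ∈ l ↔ S z ∧ (a = n ∨ r a < r z)) :
    WordRAM.HoldsLinkedList mem A n (lk a) l := by
  induction l generalizing a with
  | nil =>
    by_contra hc
    simpa using (hal (lk a)).2 ((h a ha).1 hc)
  | cons x l ih =>
    rw [List.pairwise_cons] at hl
    obtain ⟨h1, h2⟩ := (hal x).1 List.mem_cons_self
    obtain ⟨h3, h4⟩ := (h a ha).2 x h1 h2
    obtain ⟨h5, h6⟩ := (h a ha).1 h3
    have hx : lk a = x := by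
      have h7 : lk a ∈ x :: l := (hal _).2 ⟨h5, h6⟩
      rcases List.mem_cons.1 h7 with h7 | h7
      · exact h7
      · have := hl.1 _ h7
        omega
    refine ⟨hx, ?_⟩
    rw [hmem x (hS x h1)]
    refine ih x (.inr h1) hl.2 fun z => ⟨fun hz => ?_, fun ⟨hz1, hz2⟩ => ?_⟩
    · exact ⟨((hal z).1 (List.mem_cons_of_mem _ hz)).1, .inr (hl.1 z hz)⟩
    · have h8 := hS x h1
      have hz3 : r x < r z := by omega
      rcases List.mem_cons.1 ((hal z).2 ⟨hz1, by omega⟩) with rfl | h9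
      · omega
      · exact h9

/-! ### Exponential and binary search on the path -/

/-- The test whether the path vertex with index `reg 11 + reg 12 - 1` exists and is smaller than item
`reg 7`. -/
def probe : AExpr := .lt (.const 1) (.add
  (.lt (.add (.reg 11) (.reg 12)) (.add (.reg 14) (.const 1)))
  (.less (.arr 7 (.sub (.add (.reg 11) (.reg 12)) (.const 1))) (.reg 7)))

/-- Exponential and binary search for the number of path vertices smaller than item `reg 7`, starting
from `reg 10`. -/
def search : ACmd := .block [
  .assign 11 (.reg 10),
  .assign 12 (.const 1),
  .loop probe (.block [
    .assign 11 (.add (.reg 11) (.reg 12)),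
    .assign 12 (.add (.reg 12) (.reg 12))]),
  .loop (.lt (.const 1) (.reg 12)) (.block [
    .assign 12 (.div (.reg 12) (.const 2)),
    .cond probe (.assign 11 (.add (.reg 11) (.reg 12))) .skip])]

/-- The states that differ from `σ` at most in registers `11` and `12`. -/
structure SearchFrame (σ σ' : AState) : Prop where
  arr : σ'.arr = σ.arr
  reg : ∀ r, r ≠ 11 → r ≠ 12 → σ'.reg r = σ.reg r

theorem SearchFrame.set {σ σ' σ'' : AState} (h : SearchFrame σ σ') (harr : σ''.arr = σ'.arr)
    (hreg : ∀ r, r ≠ 11 → r ≠ 12 → σ''.reg r = σ'.reg r) : SearchFrame σ σ'' :=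
  ⟨harr.trans h.arr, fun r h1 h2 => (hreg r h1 h2).trans (h.reg r h1 h2)⟩

/-- There is no short-circuit evaluation: the array is read even beyond the end of the path. The
index is at most `2 * k`, which `hkN` keeps in range, and the value read there is irrelevant because
the first summand is then `0`. -/
theorem probe_spec {N k c : ℕ} {σ σ' : AState} (h : SearchFrame σ σ') (hk : σ.reg 14 = k)
    (hc : c ≤ k) (hord : ∀ t < k, ord (σ.arr 7 t) (σ.reg 7) = true ↔ t < c) (hkN : 2 * k + 2 ≤ N)
    (h11 : σ'.reg 11 ≤ c) (h12 : 1 ≤ σ'.reg 12) (h12' : σ'.reg 12 ≤ k + 1) :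
    probe.Ok N ord σ' ∧ (probe.eval ord σ' = 0 ↔ c < σ'.reg 11 + σ'.reg 12) := by
  have h14 := h.reg 14 (by simp) (by simp)
  have h7 := h.reg 7 (by simp) (by simp)
  have hle := testLt_le_one (σ'.reg 11 + σ'.reg 12) (k + 1)
  have hb := Bool.toNat_le (ord (σ.arr 7 (σ'.reg 11 + σ'.reg 12 - 1)) (σ.reg 7))
  constructor
  · simp only [probe, AExpr.Ok, AExpr.eval, h14, hk, h7, h.arr]
    refine ⟨by omega, ⟨⟨trivial, trivial, by omega⟩, ⟨trivial, by omega, by omega⟩⟩,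
      ⟨⟨by omega, ⟨⟨trivial, trivial, by omega⟩, by omega⟩, by omega⟩, trivial⟩, by omega⟩
  · simp only [probe, AExpr.eval, h14, hk, h7, h.arr, testLt_eq_zero]
    by_cases hlt : σ'.reg 11 + σ'.reg 12 < k + 1
    · have h1 : testLt (σ'.reg 11 + σ'.reg 12) (k + 1) = 1 := by simp [testLt, hlt]
      have h2 := hord (σ'.reg 11 + σ'.reg 12 - 1) (by omega)
      rw [h1]
      cases hcase : ord (σ.arr 7 (σ'.reg 11 + σ'.reg 12 - 1)) (σ.reg 7)
      · have h3 := mt h2.2 (by simp [hcase])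
        simp
        omega
      · have h3 := h2.1 hcase
        simp
        omega
    · have h1 : testLt (σ'.reg 11 + σ'.reg 12) (k + 1) = 0 := by simp [testLt, hlt]
      rw [h1]
      constructor <;> intro <;> omega

/-- After `i` doublings the step is `2 ^ i` and register `11` has advanced by `2 ^ i - 1` without
passing `c`, so `i ≤ log (c - reg 10 + 1)`. The first failing probe leaves `2 ^ i` candidates for
`c`, and `i` halvings isolate it. -/
theorem wp_search {N k c : ℕ} {σ : AState} {Q : AState → ℕ → Prop} (hk : σ.reg 14 = k)
    (hc : c ≤ k) (hj : σ.reg 10 ≤ c)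
    (hord : ∀ t < k, ord (σ.arr 7 t) (σ.reg 7) = true ↔ t < c) (hkN : 2 * k + 2 ≤ N)
    (hQ : ∀ σ' n', SearchFrame σ σ' → σ'.reg 11 = c →
      n' ≤ 2 * Nat.log 2 (c - σ.reg 10 + 1) → Q σ' n') :
    WP N ord search σ Q := by
  rw [search]
  simp only [wp_block_cons (c := .assign _ _), wp_assign, AExpr.Ok, AExpr.eval]
  refine ⟨by simp, trivial, by simp, by simp, ?_⟩
  simp only [Nat.zero_add]
  rw [wp_block_cons]
  set L := Nat.log 2 (c - σ.reg 10 + 1) with hL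
  refine wp_loop (fun p σ' => SearchFrame σ σ' ∧ ∃ i, p + i = L ∧ σ'.reg 12 = 2 ^ i ∧
    σ'.reg 11 + 1 = σ.reg 10 + 2 ^ i ∧ σ'.reg 11 ≤ c) L ?_ ?_ ?_ ?_
  · exact ⟨⟨by simp, fun r h1 h2 => by simp [h1, h2]⟩, 0, by simp, by simp, by simp, by simpa⟩
  · rintro p σ' ⟨hF, i, hp, h12, h11, hle⟩
    have h2 := Nat.one_le_two_pow (n := i)
    exact (probe_spec hF hk hc hord hkN hle (by omega) (by omega)).1
  · rintro p σ' ⟨hF, i, hp, h12, h11, hle⟩ hne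
    have h2 := Nat.one_le_two_pow (n := i)
    have h3 := mt (probe_spec hF hk hc hord hkN hle (by omega) (by omega)).2.2 hne
    -- The successful probe gives `reg 10 + 2 ^ (i + 1) - 1 ≤ c`, with the initial value of register
    -- `10`.
    have h4 : i + 1 ≤ L := Nat.le_log_of_pow_le (by simp) (by rw [pow_succ]; omega)
    simp [h12]
    repeat refine And.intro (by omega) ?_
    refine ⟨p - 1, by omega, hF.set (by simp) (fun r h1 h2 => by simp [h1, h2]), i + 1, by omega,
      by rw [pow_succ]; omega, by rw [pow_succ]; omega, by omega⟩
  · rintro p σ1 n1 ⟨hF, i, hp, h12, h11, hle⟩ he hn1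
    have h2 := Nat.one_le_two_pow (n := i)
    have h3 := (probe_spec hF hk hc hord hkN hle (by omega) (by omega)).2.1 he
    rw [wp_block_cons]
    -- Now the exponent `i` is the potential: `c` is one of the `2 ^ i` numbers from register `11`
    -- on.
    refine wp_loop (fun i σ' => SearchFrame σ σ' ∧ σ'.reg 12 = 2 ^ i ∧ σ'.reg 11 ≤ c ∧
      c < σ'.reg 11 + 2 ^ i ∧ 2 ^ i ≤ k + 1) i ⟨hF, h12, hle, by omega, by omega⟩ ?_ ?_ ?_
    · simp
    · rintro i σ' ⟨hF, h12, hle, hlt, hik⟩ hne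
      simp [h12] at hne
      obtain ⟨i, rfl⟩ : ∃ i', i = i' + 1 := ⟨i - 1, by omega⟩
      have h2 := Nat.one_le_two_pow (n := i)
      have hdiv : 2 ^ (i + 1) / 2 = 2 ^ i := by rw [pow_succ]; omega
      have hps : 2 ^ (i + 1) = 2 ^ i + 2 ^ i := by rw [pow_succ]; omega
      rw [wp_block_cons, wp_assign]
      refine ⟨by simp, by simp, ?_⟩
      simp only [AExpr.eval, h12, hdiv]
      rw [wp_block_cons, wp_cond]
      obtain ⟨h4, h5⟩ := probe_spec (N := N) (σ' := σ'.setReg 12 (2 ^ i)) (hF.set (by simp)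
        (fun r _ h2 => by simp [h2])) hk hc hord hkN (by simpa using hle) (by simpa)
        (by simp; omega)
      simp only [AState.setReg_reg] at h5
      simp at h5
      refine ⟨h4, fun h6 => ?_, fun h6 => ?_⟩
      · have h7 := mt h5.2 h6
        simp
        refine ⟨by omega, hF.set (by simp) (fun r h1 h2 => by simp [h1, h2]),
          by omega, by omega, by omega⟩
      · have h7 := h5.1 h6
        simp
        refine ⟨hF.set (by simp) (fun r h1 h2 => by simp [h2]),
          by omega, by omega, by omega⟩
    · rintro i' σ2 n2 ⟨hF, h12, hle, hlt, hik⟩ he hn2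
      simp [h12] at he
      subst he
      simp
      exact hQ _ _ hF (by simp at hlt; omega) (by omega)

/-! ### Insertion of the vertices outside the path -/

/-- The sorting program. Register `8` is the last item of the processed part of the linked list,
register `10` the number of path vertices up to this item. -/
def sorting : ACmd := .block [
  .assign 6 (.const 0),
  .assign 8 (.reg 4),
  .assign 10 (.const 0),
  .loop (.lt (.reg 6) (.reg 0)) (.block [
    .assign 7 (.arr 13 (.reg 6)),
    .cond (.arr 8 (.reg 7))
      (.assign 10 (.arr 8 (.reg 7)))
      (.block [
        search,
        .cond (.lt (.reg 10) (.reg 11)) (.assign 8 (.arr 7 (.sub (.reg 11) (.const 1)))) .skip,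
        .assign 10 (.reg 11),
        .store 9 (.reg 7) (.arr 9 (.reg 8)),
        .store 9 (.reg 8) (.reg 7)]),
    .assign 8 (.reg 7),
    .assign 6 (.add (.reg 6) (.const 1))]),
  .assign 0 (.arr 9 (.reg 4))]

/-- The kept vertices `ys`, sorted by the ranks `r`, and bounds `D` for the numbers of vertices
directly before the vertices outside the path. -/
structure SortData (g : EdgeArray) (k : ℕ) (P pos r D : ℕ → ℕ) (ys : List ℕ) : Prop where
  inj : ∀ x < g.n, ∀ y < g.n, r x = r y → x = y
  up : ∀ j < g.m, r (g.tail j) < r (g.head j)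
  sorted : ys.Pairwise fun x y => r x < r y
  lt : ∀ x ∈ ys, x < g.n
  nonpath : ∀ x < g.n, pos x = 0 → x ∈ ys
  gap : ∀ y ∈ ys, pos y = 0 → ∀ j c, (∀ t, j ≤ t → t < c → t < k ∧ r (P t) < r y ∧
    ∀ w ∈ ys, r w < r y → r w < r (P t)) → c - j ≤ D y

/-- The number of loop iterations for the insertion of `y`. -/
def insertCost (pos D : ℕ → ℕ) (y : ℕ) : ℕ :=
  1 + if pos y = 0 then 2 * Nat.log 2 (D y + 1) else 0

theorem PathData.rank_lt {g : EdgeArray} {lev : ℕ → ℕ} {k : ℕ} {P pos r : ℕ → ℕ}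
    (hP : PathData g lev k P pos) (hr : ∀ j < g.m, r (g.tail j) < r (g.head j)) {s t : ℕ}
    (hst : s < t) (ht : t < k) : r (P s) < r (P t) := by
  induction t with
  | zero => omega
  | succ t ih =>
    obtain ⟨j, hj, h1, h2⟩ := hP.edge t ht
    have h3 := hr j hj
    rw [h1, h2] at h3
    rcases Nat.lt_succ_iff_lt_or_eq.1 hst with h | rfl
    · exact (ih h (by omega)).trans h3
    · exact h3

theorem PathData.rank_lt_iff {g : EdgeArray} {lev : ℕ → ℕ} {k : ℕ} {P pos r : ℕ → ℕ}
    (hP : PathData g lev k P pos) (hr : ∀ j < g.m, r (g.tail j) < r (g.head j)) {s t : ℕ}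
    (hs : s < k) (ht : t < k) : r (P s) < r (P t) ↔ s < t := by
  refine ⟨fun h => ?_, fun h => hP.rank_lt hr h ht⟩
  by_contra hc
  rcases Nat.eq_or_lt_of_le (Nat.le_of_not_lt hc) with rfl | h1
  · omega
  · have := hP.rank_lt hr h1 hs
    omega

/-- Ranks increase along the path, so the path vertices below `b` form an initial segment. -/
theorem PathData.exists_count {g : EdgeArray} {lev : ℕ → ℕ} {k : ℕ} {P pos r : ℕ → ℕ}
    (hP : PathData g lev k P pos) (hr : ∀ j < g.m, r (g.tail j) < r (g.head j)) (b : ℕ) :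
    ∃ c ≤ k, ∀ t < k, r (P t) < b ↔ t < c := by
  classical
  have hex : ∃ c, ¬ (c < k ∧ r (P c) < b) := ⟨k, by simp⟩
  have h1 := Nat.find_spec hex
  have h2 : Nat.find hex ≤ k := Nat.find_min' hex (by simp)
  refine ⟨Nat.find hex, h2, fun t ht => ⟨fun h => ?_, fun h => ?_⟩⟩
  · by_contra hc
    have h3 : r (P (Nat.find hex)) ≤ r (P t) := by
      rcases Nat.eq_or_lt_of_le (Nat.le_of_not_lt hc) with h4 | h4
      · rw [h4]
      · exact (hP.rank_lt hr h4 ht).le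
    exact h1 ⟨by omega, by omega⟩
  · by_contra hc
    exact Nat.find_min hex h fun h4 => hc h4.2

theorem PathLinks.linked {g : EdgeArray} {lev : ℕ → ℕ} {k : ℕ} {P pos link r : ℕ → ℕ}
    (hP : PathData g lev k P pos) (hl : PathLinks g k P link)
    (hr : ∀ j < g.m, r (g.tail j) < r (g.head j)) :
    Linked r g.n (fun x => x < g.n ∧ pos x ≠ 0) link := by
  have key : ∀ z, z < g.n ∧ pos z ≠ 0 → ∃ t < k, z = P t := fun z hz =>
    ⟨pos z - 1, by have := hP.pos_le z hz.1; omega, (hP.P_pos z hz.1 hz.2).symm⟩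
  have hmem : ∀ t < k, P t < g.n ∧ pos (P t) ≠ 0 := fun t ht =>
    ⟨hP.P_lt t ht, by rw [hP.pos_P t ht]; omega⟩
  have hle : ∀ s t, s ≤ t → t < k → r (P s) ≤ r (P t) := fun s t hst ht => by
    rcases Nat.eq_or_lt_of_le hst with rfl | h
    · exact le_rfl
    · exact (hP.rank_lt hr h ht).le
  intro a ha
  by_cases han : a = g.n
  · subst han
    rw [hl.first]
    split_ifs with h0
    · refine ⟨fun _ => ⟨hmem 0 h0, .inl rfl⟩, fun z hz _ => ?_⟩
      obtain ⟨t, ht, rfl⟩ := key z hz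
      exact ⟨(hP.P_lt 0 h0).ne, hle 0 t (Nat.zero_le t) ht⟩
    · refine ⟨fun h => absurd rfl h, fun z hz _ => ?_⟩
      obtain ⟨t, ht, rfl⟩ := key z hz
      omega
  · obtain ⟨s, hs, rfl⟩ := key a (by tauto)
    rw [hl.next s hs]
    split_ifs with h0
    · refine ⟨fun _ => ⟨hmem _ h0, .inr (hP.rank_lt hr (by omega) h0)⟩, fun z hz h => ?_⟩
      obtain ⟨t, ht, rfl⟩ := key z hz
      have h1 := (hP.rank_lt_iff hr hs ht).1 (by tauto)
      exact ⟨(hP.P_lt _ h0).ne, hle _ t h1 ht⟩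
    · refine ⟨fun h => absurd rfl h, fun z hz h => ?_⟩
      obtain ⟨t, ht, rfl⟩ := key z hz
      have h1 := (hP.rank_lt_iff hr hs ht).1 (by tauto)
      omega

/-- The invariant of the sorting program after `i` of the items `ys`. -/
structure SortInv (g : EdgeArray) (k : ℕ) (P pos r : ℕ → ℕ) (ys : List ℕ) (i : ℕ) (σ : AState) :
    Prop where
  r0 : σ.reg 0 = ys.length
  r4 : σ.reg 4 = g.n
  r6 : σ.reg 6 = i
  r14 : σ.reg 14 = k
  arr7 : σ.arr 7 = P
  arr8 : σ.arr 8 = pos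
  items : Holds (σ.arr 13) ys
  linked : Linked r g.n (fun x => x < g.n ∧ (pos x ≠ 0 ∨ x ∈ ys.take i)) (σ.arr 9)
  last : (i = 0 ∧ σ.reg 8 = g.n) ∨
    (σ.reg 8 ∈ ys.take i ∧ ∀ w ∈ ys.take i, r w ≤ r (σ.reg 8))
  count : ∀ t < k, t < σ.reg 10 ↔ i ≠ 0 ∧ r (P t) ≤ r (σ.reg 8)
  count_le : σ.reg 10 ≤ k

/-- In a sorted list, being processed already is the same as having smaller rank than the next item.
-/
theorem take_spec {r : ℕ → ℕ} {ys : List ℕ} (hs : ys.Pairwise fun x y => r x < r y) {i : ℕ}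
    (hi : i < ys.length) :
    ys.take (i + 1) = ys.take i ++ [ys[i]] ∧ ∀ w ∈ ys, w ∈ ys.take i ↔ r w < r ys[i] := by
  have h1 : ys.take (i + 1) = ys.take i ++ [ys[i]] := List.take_succ_eq_append_getElem hi
  have h2 : ys = ys.take i ++ (ys[i] :: ys.drop (i + 1)) := by
    rw [← List.drop_eq_getElem_cons hi, List.take_append_drop]
  refine ⟨h1, fun w hw => ?_⟩
  rw [h2, List.pairwise_append, List.pairwise_cons] at hs
  obtain ⟨h3, ⟨h4, h5⟩, h6⟩ := hs
  refine ⟨fun h => h6 w h _ List.mem_cons_self, fun h => ?_⟩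
  rw [h2] at hw
  rcases List.mem_append.1 hw with hw | hw
  · exact hw
  · rcases List.mem_cons.1 hw with rfl | hw
    · omega
    · have := h4 w hw
      omega

/-- A kept path vertex is in the linked list from the start, so only the cursor moves. Positions
start at `1`; thus `pos` is also the number of path vertices up to this one. -/
theorem SortInv.path_step {g : EdgeArray} {lev : ℕ → ℕ} {k : ℕ} {P pos r D : ℕ → ℕ}
    {ys : List ℕ} {i : ℕ} {σ σ' : AState} (hI : SortInv g k P pos r ys i σ)
    (hP : PathData g lev k P pos) (hD : SortData g k P pos r D ys) (hi : i < ys.length)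
    (hpos : pos ys[i] ≠ 0) (harr : σ'.arr = σ.arr) (h6 : σ'.reg 6 = i + 1)
    (h8 : σ'.reg 8 = ys[i]) (h10 : σ'.reg 10 = pos ys[i])
    (hreg : ∀ r, r ≠ 6 → r ≠ 7 → r ≠ 8 → r ≠ 10 → σ'.reg r = σ.reg r) :
    SortInv g k P pos r ys (i + 1) σ' := by
  obtain ⟨h1, h2⟩ := take_spec hD.sorted hi
  have hy := List.getElem_mem hi
  have hyn := hD.lt _ hy
  have hle := hP.pos_le _ hyn
  refine ⟨(hreg 0 (by simp) (by simp) (by simp) (by simp)).trans hI.r0,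
    (hreg 4 (by simp) (by simp) (by simp) (by simp)).trans hI.r4, h6,
    (hreg 14 (by simp) (by simp) (by simp) (by simp)).trans hI.r14, harr ▸ hI.arr7, harr ▸ hI.arr8,
    harr ▸ hI.items, ?_, .inr ⟨?_, ?_⟩, ?_, by omega⟩
  · rw [harr, h1]
    convert hI.linked using 2 with x
    refine and_congr_right fun hx => ?_
    simp only [List.mem_append, List.mem_singleton]
    constructor
    · rintro (h | h | rfl)
      · exact .inl h
      · exact .inr h
      · exact .inl hpos
    · tauto
  · rw [h8, h1]; exact List.mem_append_right _ (by simp)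
  · rw [h8, h1]
    intro w hw
    rcases List.mem_append.1 hw with hw | hw
    · exact ((h2 w (List.mem_of_mem_take hw)).1 hw).le
    · rw [List.mem_singleton.1 hw]
  · intro t ht
    have h3 := hP.P_pos _ hyn hpos
    have h4 := hP.rank_lt_iff (r := r) hD.up (s := pos ys[i] - 1) (t := t) (by omega) ht
    rw [h3] at h4
    rw [h8, h10]
    simp only [ne_eq, Nat.add_eq_zero_iff, one_ne_zero, and_false, not_false_eq_true, true_and]
    omega

/-- The predecessor of the new item in the list is the larger one of the last processed item and the
last path vertex below the new item. If `reg 10 < c`, there are path vertices between the last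
processed item and the new one, and it is `P (c - 1)`. Otherwise it is register `8`, which is the
head cell `n` as long as nothing has been processed. -/
theorem SortInv.insert_step {g : EdgeArray} {lev : ℕ → ℕ} {k : ℕ} {P pos r D : ℕ → ℕ}
    {ys : List ℕ} {i : ℕ} {σ σ' : AState} (hI : SortInv g k P pos r ys i σ)
    (hP : PathData g lev k P pos) (hD : SortData g k P pos r D ys) (hi : i < ys.length)
    (hpos : pos ys[i] = 0) {c p : ℕ} (hc : c ≤ k) (hcnt : ∀ t < k, r (P t) < r ys[i] ↔ t < c)
    (hp : p = if σ.reg 10 < c then P (c - 1) else σ.reg 8)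
    (h9 : σ'.arr 9 = Function.update (Function.update (σ.arr 9) ys[i] (σ.arr 9 p)) p ys[i])
    (harr : ∀ k, k ≠ 9 → σ'.arr k = σ.arr k) (h6 : σ'.reg 6 = i + 1)
    (h8 : σ'.reg 8 = ys[i]) (h10 : σ'.reg 10 = c)
    (hreg : ∀ r, r ≠ 6 → r ≠ 7 → r ≠ 8 → r ≠ 10 → r ≠ 11 → r ≠ 12 → σ'.reg r = σ.reg r) :
    SortInv g k P pos r ys (i + 1) σ' := by
  obtain ⟨h1, h2⟩ := take_spec hD.sorted hi
  have hy := List.getElem_mem hi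
  have hyn := hD.lt _ hy
  have hnot : ys[i] ∉ ys.take i := fun h => by have := (h2 _ hy).1 h; omega
  have hlt : ∀ t < k, P t ≠ ys[i] := fun t ht h => by
    have := hP.pos_P t ht; rw [h, hpos] at this; omega
  have hlast := hI.last
  have htake : ∀ w ∈ ys.take i, w ∈ ys := fun w hw => List.mem_of_mem_take hw
  have hcount := hI.count
  refine ⟨(hreg 0 (by simp) (by simp) (by simp) (by simp) (by simp) (by simp)).trans hI.r0,
    (hreg 4 (by simp) (by simp) (by simp) (by simp) (by simp) (by simp)).trans hI.r4, h6,
    (hreg 14 (by simp) (by simp) (by simp) (by simp) (by simp) (by simp)).trans hI.r14,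
    (harr 7 (by simp)).trans hI.arr7, (harr 8 (by simp)).trans hI.arr8,
    (by rw [harr 13 (by simp)]; exact hI.items), ?_, .inr ⟨?_, ?_⟩, ?_, by omega⟩
  · rw [h9, h1]
    convert hI.linked.insert (fun x hx => hx.1) hD.inj hyn (p := p) ?_ ?_ ?_ ?_ using 2 with x
    · simp only [List.mem_append, List.mem_singleton]
      constructor
      · tauto
      · rintro (h | rfl)
        · tauto
        · exact ⟨hyn, by tauto⟩
    · tauto
    · rw [hp]
      split_ifs with h3
      · have := hP.P_lt (c - 1) (by omega)
        have := hP.pos_P (c - 1) (by omega)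
        exact .inr ⟨by omega, .inl (by omega)⟩
      · rcases hlast with h | h
        · exact .inl h.2
        · exact .inr ⟨hD.lt _ (htake _ h.1), .inr h.1⟩
    · rw [hp]
      split_ifs with h3
      · exact .inr ((hcnt (c - 1) (by omega)).2 (by omega))
      · rcases hlast with h | h
        · exact .inl h.2
        · exact .inr ((h2 _ (htake _ h.1)).1 h.1)
    · rintro z ⟨hzn, hz⟩ hzy
      have hzk : pos z ≠ 0 → ∃ t < k, z = P t := fun h =>
        ⟨pos z - 1, by have := hP.pos_le z hzn; omega, (hP.P_pos z hzn h).symm⟩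
      by_cases h3 : σ.reg 10 < c
      · rw [if_pos h3] at hp
        subst hp
        refine ⟨(hP.P_lt _ (by omega)).ne, ?_⟩
        rcases hz with hz | hz
        · obtain ⟨t, ht, rfl⟩ := hzk hz
          have h4 := (hcnt t ht).1 hzy
          rcases Nat.eq_or_lt_of_le (show t ≤ c - 1 by omega) with rfl | h5
          · exact le_rfl
          · exact (hP.rank_lt hD.up h5 (by omega)).le
        · rcases hlast with h | ⟨h4, h5⟩
          · rw [h.1] at hz; simp at hz
          · have h6 := h5 z hz
            have h7 := mt (hcount (c - 1) (by omega)).2 (by omega)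
            have : i ≠ 0 := by rintro rfl; simp at hz
            have : ¬ r (P (c - 1)) ≤ r (σ.reg 8) := fun h => h7 ⟨this, h⟩
            omega
      · rw [if_neg h3] at hp
        subst hp
        have h0 : i ≠ 0 ∧ r z ≤ r (σ.reg 8) := by
          rcases hz with hz | hz
          · obtain ⟨t, ht, rfl⟩ := hzk hz
            have h4 := (hcnt t ht).1 hzy
            exact (hcount t ht).1 (by omega)
          · refine ⟨by rintro rfl; simp at hz, ?_⟩
            rcases hlast with h | ⟨h4, h5⟩
            · rw [h.1] at hz; simp at hz
            · exact h5 z hz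
        refine ⟨?_, h0.2⟩
        rcases hlast with h | ⟨h4, h5⟩
        · exact absurd h.1 h0.1
        · exact (hD.lt _ (htake _ h4)).ne
  · rw [h8, h1]; exact List.mem_append_right _ (by simp)
  · rw [h8, h1]
    intro w hw
    rcases List.mem_append.1 hw with hw | hw
    · exact ((h2 w (htake w hw)).1 hw).le
    · rw [List.mem_singleton.1 hw]
  · intro t ht
    have h4 := hcnt t ht
    have h5 : r (P t) ≠ r ys[i] := fun h => hlt t ht (hD.inj _ (hP.P_lt t ht) _ hyn h)
    rw [h8, h10]
    simp only [ne_eq, Nat.add_eq_zero_iff, one_ne_zero, and_false, not_false_eq_true, true_and]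
    omega

theorem SortInv.le_count {g : EdgeArray} {k : ℕ} {P pos r D : ℕ → ℕ}
    {ys : List ℕ} {i : ℕ} {σ : AState} (hI : SortInv g k P pos r ys i σ)
    (hD : SortData g k P pos r D ys) (hi : i < ys.length)
    {c : ℕ} (hcnt : ∀ t < k, r (P t) < r ys[i] ↔ t < c) : σ.reg 10 ≤ c := by
  by_contra hc
  have h1 := hI.count_le
  obtain ⟨h2, h3⟩ := (hI.count c (by omega)).1 (by omega)
  rcases hI.last with h | ⟨h4, -⟩
  · exact h2 h.1
  · have h5 := ((take_spec hD.sorted hi).2 _ (List.mem_of_mem_take h4)).1 h4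
    have := (hcnt c (by omega)).1 (by omega)
    omega

/-- The search passes path vertices above the last processed item. That item is the largest item of
`ys` below `ys[i]`, so these vertices lie in the gap that `D` bounds. -/
theorem SortInv.gap_le {g : EdgeArray} {k : ℕ} {P pos r D : ℕ → ℕ}
    {ys : List ℕ} {i : ℕ} {σ : AState} (hI : SortInv g k P pos r ys i σ)
    (hD : SortData g k P pos r D ys) (hi : i < ys.length) (hpos : pos ys[i] = 0)
    {c : ℕ} (hc : c ≤ k) (hcnt : ∀ t < k, r (P t) < r ys[i] ↔ t < c) :
    c - σ.reg 10 ≤ D ys[i] := by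
  refine hD.gap _ (List.getElem_mem hi) hpos _ _ fun t h1 h2 =>
    ⟨by omega, (hcnt t (by omega)).2 h2, fun w hw hwy => ?_⟩
  have h3 := ((take_spec hD.sorted hi).2 w hw).2 hwy
  have h4 := mt (hI.count t (by omega)).2 (by omega)
  have h5 : i ≠ 0 := by rintro rfl; simp at h3
  rcases hI.last with h | ⟨h6, h7⟩
  · exact absurd h.1 h5
  · have := h7 w h3
    have : ¬ r (P t) ≤ r (σ.reg 8) := fun h => h4 ⟨h5, h⟩
    omega

theorem wp_sorting {g : EdgeArray} {lev : ℕ → ℕ} {k : ℕ} {P pos link r D : ℕ → ℕ}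
    {ys : List ℕ} {σ : AState} {Q : AState → ℕ → Prop}
    (hP : PathData g lev k P pos) (hl : PathLinks g k P link) (hD : SortData g k P pos r D ys)
    (hS : StoresPath g k P pos link σ) (h0 : σ.reg 0 = ys.length) (hy : Holds (σ.arr 13) ys)
    (hord : ∀ a < g.n, ∀ b < g.n, ord a b = true ↔ r a < r b)
    (hQ : ∀ σ' n', σ'.reg 0 = σ'.arr 9 g.n → Linked r g.n (fun x => x < g.n) (σ'.arr 9) →
      n' ≤ (ys.map (insertCost pos D)).sum → Q σ' n') :
    WP g.N ord sorting σ Q := by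
  have hN : g.N = 2 * (g.n + g.m + 1) := rfl
  have hkn := hP.k_le
  have hlen : ys.length ≤ g.n := by
    refine length_le_of_nodup_of_lt ?_ hD.lt
    exact hD.sorted.imp fun h h' => by subst h'; omega
  rw [sorting]
  simp only [wp_block_cons (c := .assign _ _), wp_assign, AExpr.Ok, AExpr.eval, AState.setReg_reg]
  refine ⟨by simp, by simp, by simp, trivial, by simp, by simp, ?_⟩
  simp only [Nat.zero_add]
  rw [wp_block_cons]
  -- The potential is the total cost of the items not yet processed, so it also pays for the inner
  -- search loops.
  refine wp_loop (fun p σ' => ∃ i, SortInv g k P pos r ys i σ' ∧ i ≤ ys.length ∧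
    ((ys.drop i).map (insertCost pos D)).sum ≤ p) (ys.map (insertCost pos D)).sum
    ⟨0, ⟨by simpa, by simpa using hS.r4, by simp, by simpa using hS.r14, by simpa using hS.arr7,
      by simpa using hS.arr8, by simpa, ?_, .inl ⟨rfl, by simpa using hS.r4⟩, by simp, by simp⟩,
      by simp, by simp⟩ ?_ ?_ ?_
  · simpa [hS.arr9] using hl.linked hP hD.up
  · simp
  · rintro p σ' ⟨i, hI, hile, hp⟩ hne
    simp only [AExpr.eval, ne_eq, testLt_eq_zero, not_not, hI.r0, hI.r6] at hne
    have hyi := hI.items i hne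
    have hyn := hD.lt _ (List.getElem_mem hne)
    have hsum : ((ys.drop i).map (insertCost pos D)).sum =
        insertCost pos D ys[i] + ((ys.drop (i + 1)).map (insertCost pos D)).sum := by
      rw [List.drop_eq_getElem_cons hne, List.map_cons, List.sum_cons]
    rw [wp_block_cons, wp_assign]
    refine ⟨by simp, ⟨by simp, trivial, by simp only [AExpr.eval, hI.r6]; omega⟩, ?_⟩
    simp only [AExpr.eval, hI.r6, hyi]
    rw [wp_block_cons, wp_cond]
    refine ⟨⟨by simp, trivial, by simp; omega⟩, fun h1 => ?_, fun h1 => ?_⟩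
    · simp [hI.arr8] at h1
      simp [hI.arr8, hI.r6]
      repeat refine And.intro (by omega) ?_
      refine ⟨_, ?_, i + 1, hI.path_step hP hD hne h1 ?_ ?_ ?_ ?_ ?_, hne, le_rfl⟩
      · have hcost1 : insertCost pos D ys[i] = 1 := by simp [insertCost, h1]
        rw [hsum, hcost1] at hp
        simp only [List.map_drop] at hp
        omega
      · simp
      · simp
      · simp
      · simp
      · intro r h2 h3 h4 h5; simp [h2, h3, h4, h5]
    · simp [hI.arr8] at h1
      obtain ⟨c, hck, hc⟩ := hP.exists_count hD.up (r ys[i])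
      have hjc := hI.le_count hD hne hc
      have hgap := hI.gap_le hD hne h1 hck hc
      rw [wp_block_cons]
      refine wp_search (k := k) (c := c) (by simpa using hI.r14) hck (by simpa) ?_ (by omega) ?_
      · intro t ht
        simp only [AState.setReg_arr, hI.arr7, AState.setReg_reg, if_true]
        rw [hord _ (hP.P_lt t ht) _ hyn, hc t ht]
      intro σ2 n2 hF h11 hn2
      have hcost : n2 ≤ 2 * Nat.log 2 (D ys[i] + 1) := by
        refine hn2.trans (Nat.mul_le_mul_left 2 (Nat.log_mono_right ?_))
        simpa using hgap
      have hcost1 : insertCost pos D ys[i] = 1 + 2 * Nat.log 2 (D ys[i] + 1) := by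
        simp [insertCost, h1]
      have h7 : σ2.reg 7 = ys[i] := by rw [hF.reg 7 (by simp) (by simp)]; simp
      have h8 : σ2.reg 8 = σ'.reg 8 := by rw [hF.reg 8 (by simp) (by simp)]; simp
      have h10 : σ2.reg 10 = σ'.reg 10 := by rw [hF.reg 10 (by simp) (by simp)]; simp
      have h6 : σ2.reg 6 = i := by rw [hF.reg 6 (by simp) (by simp)]; simp [hI.r6]
      have harr : σ2.arr = σ'.arr := by rw [hF.arr]; simp
      have hreg : ∀ r, r ≠ 7 → r ≠ 11 → r ≠ 12 → σ2.reg r = σ'.reg r := fun r h2 h3 h4 => by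
        rw [hF.reg r h3 h4]; simp [h2]
      have hlast : σ'.reg 8 ≤ g.n := by
        rcases hI.last with h | h
        · omega
        · exact (hD.lt _ (List.mem_of_mem_take h.1)).le
      simp [h7, h8, h10, h6, h11, harr, hI.arr7]
      refine ⟨fun h2 => ⟨by omega, by omega, ?_⟩, fun h2 => ?_⟩
      · have h3 := hP.P_lt (c - 1) (by omega)
        repeat refine And.intro (by omega) ?_
        refine ⟨_, ?_, i + 1, hI.insert_step hP hD hne h1 (p := P (c - 1)) hck hc ?_ ?_ ?_ ?_ ?_ ?_ ?_,
          hne, le_rfl⟩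
        · rw [hsum, hcost1] at hp
          simp only [List.map_drop] at hp
          omega
        · rw [if_pos h2]
        · simp [harr]
        · intro k hk; simp [hk, harr]
        · simp
        · simp
        · simp
        · intro r h2 h3 h4 h5 h6 h7; simp [h2, h3, h4, h5, hreg, h6, h7]
      · repeat refine And.intro (by omega) ?_
        refine ⟨_, ?_, i + 1, hI.insert_step hP hD hne h1 (p := σ'.reg 8) hck hc ?_ ?_ ?_ ?_ ?_ ?_ ?_,
          hne, le_rfl⟩
        · rw [hsum, hcost1] at hp
          simp only [List.map_drop] at hp
          omega
        · rw [if_neg (by omega)]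
        · simp [harr]
        · intro k hk; simp [hk, harr]
        · simp
        · simp
        · simp
        · intro r h2 h3 h4 h5 h6 h7; simp [h2, h3, h4, h5, hreg, h6, h7]
  · rintro p σ' n' ⟨i, hI, hile, hp⟩ he hn'
    simp only [AExpr.eval, testLt_eq_zero, hI.r0, hI.r6] at he
    have hi : i = ys.length := by omega
    subst hi
    simp [hI.r4]
    refine ⟨by omega, hQ _ _ (by simp) ?_ (by omega)⟩
    have hlk := hI.linked
    rw [List.take_length] at hlk
    simp only [AState.setReg_arr]
    convert hlk using 2 with x
    refine ⟨fun h => ⟨h, ?_⟩, fun h => h.1⟩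
    by_cases hp : pos x = 0
    · exact .inr (hD.nonpath x h hp)
    · exact .inl hp

end ArrayLang

/-! ### Counting compatible orders -/

namespace DagSort

/-! ### Ranks in a finite linear order -/

section Rank

variable {V : Type*} [Fintype V]

open Classical in
/-- The number of smaller elements. -/
noncomputable def orderRank (L : LinearOrder V) (x : V) : ℕ :=
  (Finset.univ.filter fun y => L.lt y x).card

theorem orderRank_lt_iff (L : LinearOrder V) {x y : V} :
    orderRank L x < orderRank L y ↔ L.lt x y := by
  have key : ∀ {x y : V}, L.lt x y → orderRank L x < orderRank L y := fun {x y} h => by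
    classical
    refine Finset.card_lt_card ⟨fun z hz => ?_, fun hsub => ?_⟩
    · simp only [Finset.mem_filter, Finset.mem_univ, true_and] at hz ⊢
      exact lt_trans hz h
    · have := hsub (x := x) (by simpa using h)
      simp at this
  refine ⟨fun h => ?_, key⟩
  rcases lt_trichotomy x y with h1 | rfl | h1
  · exact h1
  · exact absurd h (lt_irrefl _)
  · exact absurd (key h1) (by omega)

theorem orderRank_injective (L : LinearOrder V) : Function.Injective (orderRank L) := by
  intro x y h
  rcases lt_trichotomy x y with h1 | h1 | h1
  · have := (orderRank_lt_iff L).2 h1; omega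
  · exact h1
  · have := (orderRank_lt_iff L).2 h1; omega

theorem orderRank_lt_card (L : LinearOrder V) (x : V) : orderRank L x < Fintype.card V := by
  classical
  refine Finset.card_lt_univ_of_notMem (x := x) ?_
  simp

theorem exists_orderRank_eq (L : LinearOrder V) {i : ℕ} (hi : i < Fintype.card V) :
    ∃ x, orderRank L x = i := by
  have h := (Fintype.bijective_iff_injective_and_card
    fun x : V => (⟨orderRank L x, orderRank_lt_card L x⟩ : Fin (Fintype.card V))).2
    ⟨fun x y h => orderRank_injective L (by simpa using h), by simp⟩
  obtain ⟨x, hx⟩ := h.2 ⟨i, hi⟩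
  exact ⟨x, by simpa using hx⟩

end Rank

/-! ### Lower bounds for the number of compatible orders -/

variable {n : ℕ} {G : Digraph (Fin n)}

theorem linearOrder_eq {V : Type*} {L L' : LinearOrder V} (h : ∀ x y, L.lt x y ↔ L'.lt x y) :
    L = L' := LinearOrder.ext_lt h

/-- An order is determined by its relation `<`. Without finiteness `Nat.card` could be the default
value `0`, and `numOrders` could not be bounded from below. -/
instance finite_linearOrder {V : Type*} [Finite V] : Finite (LinearOrder V) :=
  Finite.of_injective (fun L : LinearOrder V => fun x y => L.lt x y) fun L L' h =>
    linearOrder_eq fun x y => by rw [show L.lt x y = L'.lt x y from congrFun (congrFun h x) y]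

theorem card_le_numOrders {α : Type*} [Fintype α] {V : Type*} [Finite V] {G : Digraph V}
    (f : α → LinearOrder V) (hG : ∀ a, Compatible G (f a)) (hf : Function.Injective f) :
    Fintype.card α ≤ numOrders G := by
  rw [← Nat.card_eq_fintype_card]
  exact Nat.card_le_card_of_injective (fun a => (⟨f a, hG a⟩ : {L // Compatible G L}))
    fun a b h => hf (by simpa using h)

/-- A graph with levels such that the vertices with property `p` form a transversal of the
levels. -/
theorem two_pow_le_numOrders (lev : Fin n → ℕ) (p : Fin n → Prop) [DecidablePred p]
    (hlev : ∀ u v, G.Adj u v → lev u < lev v) (hp : ∀ x, ∃ t, p t ∧ lev t = lev x) :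
    2 ^ (Finset.univ.filter fun x => ¬ p x).card ≤ numOrders G := by
  -- Each level gets three slots: the vertex with property `p` is in the middle one, and every other
  -- vertex chooses the one before or the one after it. Ties within a slot are broken by the numbers
  -- of the vertices.
  let c : ({x // ¬ p x} → Bool) → Fin n → ℕ := fun a x =>
    if h : p x then 1 else if a ⟨x, h⟩ then 0 else 2
  have hc : ∀ a x, c a x ≤ 2 := fun a x => by simp only [c]; split_ifs <;> omega
  let key : ({x // ¬ p x} → Bool) → Fin n → ℕ ×ₗ Fin n := fun a x =>
    toLex (3 * lev x + c a x, x)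
  have hkey : ∀ a, Function.Injective (key a) := fun a x y h => by
    have := congrArg (fun z => (ofLex z).2) h
    simpa [key] using this
  have hcard : Fintype.card ({x // ¬ p x} → Bool) = 2 ^ (Finset.univ.filter fun x => ¬ p x).card := by
    rw [Fintype.card_fun, Fintype.card_bool, Fintype.card_subtype]
  rw [← hcard]
  refine card_le_numOrders (fun a => LinearOrder.lift' (key a) (hkey a)) (fun a u v huv => ?_) ?_
  · change key a u < key a v
    have h1 := hlev u v huv
    have h2 := hc a u
    rw [Prod.Lex.toLex_lt_toLex]
    left
    dsimp only
    omega
  · intro a b hab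
    have hlt : ∀ x y, key a x < key a y ↔ key b x < key b y := fun x y => by
      have : (LinearOrder.lift' (key a) (hkey a)).lt x y ↔
        (LinearOrder.lift' (key b) (hkey b)).lt x y := by
          dsimp only at hab
          rw [hab]
      exact this
    -- The choice made for `x` can be read off from the comparison of `x` with `t`, which sits in
    -- the middle slot of the same level.
    funext ⟨x, hx⟩
    obtain ⟨t, ht, htx⟩ := hp x
    have h1 := hlt x t
    simp only [key, Prod.Lex.toLex_lt_toLex, c, dif_pos ht, dif_neg hx, htx] at h1
    cases ha : a ⟨x, hx⟩ <;> cases hb : b ⟨x, hx⟩ <;> simp [ha, hb] at h1 ⊢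

/-- The number of orders that arise when each item `x` with property `Z` is moved down by at most
`D x` positions. -/
theorem prod_le_numOrders (L : LinearOrder (Fin n)) (hL : Compatible G L) (Z : Fin n → Prop)
    [DecidablePred Z] (D : Fin n → ℕ)
    (hD : ∀ x, ∀ t, 1 ≤ t → t ≤ D x →
      ∃ y, orderRank L y + t = orderRank L x ∧ ¬ Z y ∧ ¬ G.Adj y x)
    (hZ : ∀ x, ¬ Z x → D x = 0) : ∏ x, (D x + 1) ≤ numOrders G := by
  -- Items outside `Z` keep odd keys. An item of `Z` moved down by `a x` gets the even key just
  -- below the place of rank `orderRank L x - a x`, so it never collides with an item outside `Z`.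
  let key : (∀ x, Fin (D x + 1)) → Fin n → ℕ := fun a x =>
    if Z x then 2 * (orderRank L x - a x) else 2 * orderRank L x + 1
  have hinj := orderRank_injective L
  -- By `hD`, a moved item `v` passes only items outside `Z` without an edge to `v`. So the items of
  -- `Z` keep their mutual order, and all edges are respected.
  have hmove : ∀ (a : ∀ x, Fin (D x + 1)) u v, orderRank L u < orderRank L v →
      Z u ∨ G.Adj u v → orderRank L u < orderRank L v - a v := by
    intro a u v huv h
    by_contra hc
    have := (a v).2
    obtain ⟨y, h1, h2, h3⟩ := hD v (orderRank L v - orderRank L u) (by omega) (by omega)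
    have : y = u := hinj (by omega)
    subst this
    tauto
  have hkey : ∀ a, Function.Injective (key a) := by
    have hwlog : ∀ a x y, key a x = key a y → ¬ orderRank L x < orderRank L y := by
      intro a x y h hxy
      simp only [key] at h
      split_ifs at h with h1 h2
      · have := hmove a x y hxy (.inl h1)
        omega
      all_goals omega
    intro a x y h
    have h1 := hwlog a x y h
    have h2 := hwlog a y x h.symm
    exact hinj (by omega)
  have hcard : Fintype.card (∀ x, Fin (D x + 1)) = ∏ x, (D x + 1) := by
    rw [Fintype.card_pi]
    simp
  rw [← hcard]
  refine card_le_numOrders (fun a => LinearOrder.lift' (key a) (hkey a)) (fun a u v huv => ?_) ?_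
  · change key a u < key a v
    have h1 := (orderRank_lt_iff L).2 (hL u v huv)
    have h2 := hmove a u v h1 (.inr huv)
    simp only [key]
    split_ifs <;> omega
  -- If `a x < b x`, the item `y` originally `b x` places below `x` ends up above `x` under `b` but
  -- stays below `x` under `a`.
  · have hwlog : ∀ (a b : ∀ x, Fin (D x + 1)) x, (∀ y z, key a y < key a z ↔ key b y < key b z) →
        ¬ (a x : ℕ) < b x := by
      intro a b x hab h
      have h1 := (b x).2
      obtain ⟨y, h2, h3, h4⟩ := hD x (b x) (by omega) (by omega)
      have h5 : Z x := by
        by_contra hc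
        have := hZ x hc
        omega
      have h6 := hab x y
      simp only [key, if_pos h5, if_neg h3] at h6
      omega
    intro a b hab
    have hlt : ∀ x y, key a x < key a y ↔ key b x < key b y := fun x y => by
      have : (LinearOrder.lift' (key a) (hkey a)).lt x y ↔
        (LinearOrder.lift' (key b) (hkey b)).lt x y := by
          dsimp only at hab
          rw [hab]
      exact this
    funext x
    have h1 := hwlog a b x hlt
    have h2 := hwlog b a x fun y z => (hlt y z).symm
    exact Fin.ext (by omega)

open Classical in
/-- The number of items below `x` and above all smaller elements of `Y`. -/
noncomputable def runLength (L : LinearOrder (Fin n)) (Y : Finset (Fin n)) (x : Fin n) : ℕ :=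
  (Finset.univ.filter fun y => L.lt y x ∧ ∀ w ∈ Y, L.lt w x → L.lt w y).card

/-- The counted items form a block of consecutive ranks directly below `x`. Were an item of `Y`
below `x` at or above `y`, all counted items would lie strictly between `y` and `x`, where there is
room for only `t - 1` of them. -/
theorem exists_of_le_runLength (L : LinearOrder (Fin n)) (Y : Finset (Fin n)) (x : Fin n) (t : ℕ)
    (ht : 1 ≤ t) (htD : t ≤ runLength L Y x) :
    ∃ y, orderRank L y + t = orderRank L x ∧ L.lt y x ∧ ∀ w ∈ Y, L.lt w x → L.lt w y := by
  classical
  have h1 : runLength L Y x ≤ orderRank L x := by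
    unfold runLength orderRank
    refine Finset.card_le_card fun z hz => ?_
    simp only [Finset.mem_filter, Finset.mem_univ, true_and] at hz ⊢
    exact hz.1
  have h2 := orderRank_lt_card L x
  obtain ⟨y, hy⟩ := exists_orderRank_eq L (i := orderRank L x - t) (by omega)
  have hyx : L.lt y x := (orderRank_lt_iff L).1 (by omega)
  refine ⟨y, by omega, hyx, ?_⟩
  by_contra hc
  simp only [not_forall] at hc
  obtain ⟨w, hw, hwx, hwy⟩ := hc
  have h3 : runLength L Y x ≤ (Finset.Ioo (orderRank L y) (orderRank L x)).card := by
    unfold runLength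
    refine Finset.card_le_card_of_injOn (orderRank L) (fun z hz => ?_)
      (orderRank_injective L).injOn
    simp only [Finset.coe_filter, Finset.mem_univ, true_and, Set.mem_ofPred_eq] at hz
    have h4 := (orderRank_lt_iff L).2 hz.1
    have h5 := (orderRank_lt_iff L).2 (hz.2 w hw hwx)
    have h6 := mt (orderRank_lt_iff L).1 hwy
    simp only [Finset.coe_Ioo, Set.mem_Ioo]
    omega
  rw [Nat.card_Ioo] at h3
  omega

theorem sum_log_le_log_numOrders {M : ℕ} (h : 2 ^ M ≤ numOrders G) :
    (M : ℝ) ≤ Real.logb 2 (numOrders G) := by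
  have h1 : (0 : ℝ) < numOrders G := by
    exact_mod_cast lt_of_lt_of_le (Nat.two_pow_pos M) h
  rw [Real.le_logb_iff_rpow_le (by norm_num) h1, Real.rpow_natCast]
  exact_mod_cast h

/-! ### Extending orders from the kept vertices -/

/-- Which vertices `Y` are kept, and which of their pairs have to be comparable, so that all compatible
orders of `Y` extend. Positions on the path are positive; `pos x = 0` for `x` outside the path. -/
structure KeptVertices (G : Digraph (Fin n)) (pos : Fin n → ℕ) (Y : Finset (Fin n)) : Prop where
  nonpath : ∀ x, pos x = 0 → x ∈ Y
  before : ∀ u v, G.Adj u v → pos u ≠ 0 → pos v = 0 → ∃ q ∈ Y, G.Adj q v ∧ pos u ≤ pos q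
  after : ∀ u v, G.Adj u v → pos u = 0 → pos v ≠ 0 →
    ∃ q ∈ Y, G.Adj u q ∧ pos q ≠ 0 ∧ pos q ≤ pos v
  up : ∀ u v, G.Adj u v → pos u ≠ 0 → pos v ≠ 0 → pos u < pos v
  inj : ∀ u v, pos u ≠ 0 → pos u = pos v → u = v

/-- An omitted vertex is on the path. Its key makes it follow the highest kept path vertex before
it, or precede everything kept if there is none; omitted vertices in the same place are ordered by
position. -/
theorem KeptVertices.exists_extension {pos : Fin n → ℕ} {Y : Finset (Fin n)}
    (h : KeptVertices G pos Y) (L : LinearOrder Y)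
    (hedge : ∀ u v : Y, G.Adj u v → (pos u = 0 ∨ pos v = 0) → L.lt u v)
    (hpath : ∀ u v : Y, pos u ≠ 0 → pos u < pos v → L.lt u v) :
    ∃ L' : LinearOrder (Fin n), Compatible G L' ∧ restrictOrder L' Y = L := by
  classical
  let ρ : Fin n → ℕ := fun x => if hx : x ∈ Y then orderRank L ⟨x, hx⟩ else 0
  have hρ : ∀ u v : Y, ρ u < ρ v ↔ L.lt u v := fun u v => by
    simp only [ρ, dif_pos u.2, dif_pos v.2, orderRank_lt_iff]
  have hρinj : ∀ u ∈ Y, ∀ v ∈ Y, ρ u = ρ v → u = v := fun u hu v hv huv => by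
    simp only [ρ, dif_pos hu, dif_pos hv] at huv
    simpa using orderRank_injective L huv
  have hadj : ∀ u ∈ Y, ∀ v ∈ Y, G.Adj u v → ρ u < ρ v := fun u hu v hv huv => by
    refine (hρ ⟨u, hu⟩ ⟨v, hv⟩).2 ?_
    by_cases h0 : pos u = 0 ∨ pos v = 0
    · exact hedge _ _ huv h0
    · rw [not_or] at h0
      exact hpath _ _ h0.1 (h.up u v huv h0.1 h0.2)
  have hpos : ∀ u ∈ Y, ∀ v ∈ Y, pos u ≠ 0 → pos u < pos v → ρ u < ρ v :=
    fun u hu v hv h0 huv => (hρ ⟨u, hu⟩ ⟨v, hv⟩).2 (hpath ⟨u, hu⟩ ⟨v, hv⟩ h0 huv)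
  let below : Fin n → Finset (Fin n) := fun x => Y.filter fun y => pos y ≠ 0 ∧ pos y < pos x
  let first : Fin n → ℕ := fun x => if x ∈ Y then ρ x + 1 else (below x).sup fun y => ρ y + 1
  let second : Fin n → ℕ := fun x => if x ∈ Y then 0 else pos x
  let key : Fin n → ℕ ×ₗ ℕ := fun x => toLex (first x, second x)
  have hle : ∀ u ∈ Y, ∀ v, pos u ≠ 0 → pos u < pos v → v ∉ Y → ρ u + 1 ≤ first v := by
    intro u hu v h0 huv hv
    simp only [first, if_neg hv]
    exact Finset.le_sup (f := fun y => ρ y + 1) (by simp [below, hu, h0, huv])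
  have hlt : ∀ u, u ∉ Y → ∀ b, (∀ y ∈ Y, pos y ≠ 0 → pos y < pos u → ρ y < b) →
      first u < b + 1 := by
    intro u hu b hb
    simp only [first, if_neg hu]
    rw [Finset.sup_lt_iff (by simp)]
    intro y hy
    simp only [below, Finset.mem_filter] at hy
    have := hb y hy.1 hy.2.1 hy.2.2
    omega
  have hkey : Function.Injective key := by
    intro x y hxy
    have h1 : first x = first y := congrArg (fun z => (ofLex z).1) hxy
    have h2 : second x = second y := congrArg (fun z => (ofLex z).2) hxy
    by_cases hx : x ∈ Y <;> by_cases hy : y ∈ Y <;> simp only [first, second, hx, hy, if_true,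
      if_false] at h1 h2
    · exact hρinj x hx y hy (by omega)
    · exact absurd (h.nonpath y h2.symm) hy
    · exact absurd (h.nonpath x h2) hx
    · exact h.inj x y (fun h3 => hx (h.nonpath x h3)) h2
  refine ⟨LinearOrder.lift' key hkey, fun u v huv => ?_, linearOrder_eq fun u v => ?_⟩
  · change key u < key v
    simp only [key, Prod.Lex.toLex_lt_toLex]
    by_cases hu : u ∈ Y <;> by_cases hv : v ∈ Y
    · left
      have := hadj u hu v hv huv
      simp only [first, if_pos hu, if_pos hv]
      omega
    · have hv0 : pos v ≠ 0 := fun h3 => hv (h.nonpath v h3)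
      have h1 : ρ u + 1 ≤ first v := by
        by_cases h0 : pos u = 0
        · obtain ⟨q, hq, huq, hq0, hqv⟩ := h.after u v huv h0 hv0
          have h2 := hadj u hu q hq huq
          have h3 : pos q ≠ pos v := fun h3 => hv (h.inj q v hq0 h3 ▸ hq)
          have h4 := hle q hq v hq0 (by omega) hv
          omega
        · exact hle u hu v h0 (h.up u v huv h0 hv0) hv
      have h2 : first u = ρ u + 1 := if_pos hu
      have h3 : second u = 0 := if_pos hu
      have h4 : second v = pos v := if_neg hv
      omega
    · have hu0 : pos u ≠ 0 := fun h3 => hu (h.nonpath u h3)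
      have h2 : first v = ρ v + 1 := if_pos hv
      left
      rw [h2]
      refine hlt u hu _ fun y hy hy0 hyu => ?_
      -- If `v` is outside the path, it has a kept predecessor `q` at or after the position of `u`;
      -- every kept path vertex before `u` precedes `q` and therefore `v`.
      by_cases h0 : pos v = 0
      · obtain ⟨q, hq, hqv, huq⟩ := h.before u v huv hu0 h0
        exact (hpos y hy q hq hy0 (by omega)).trans (hadj q hq v hv hqv)
      · exact hpos y hy v hv hy0 (hyu.trans (h.up u v huv hu0 h0))
    · have hu0 : pos u ≠ 0 := fun h3 => hu (h.nonpath u h3)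
      have hv0 : pos v ≠ 0 := fun h3 => hv (h.nonpath v h3)
      have h1 := h.up u v huv hu0 hv0
      have h2 : first u ≤ first v := by
        simp only [first, if_neg hu, if_neg hv]
        refine Finset.sup_mono fun y hy => ?_
        simp only [below, Finset.mem_filter] at hy ⊢
        exact ⟨hy.1, hy.2.1, by omega⟩
      have h3 : second u = pos u := if_neg hu
      have h4 : second v = pos v := if_neg hv
      omega
  · change key u < key v ↔ _
    rw [← hρ u v]
    simp only [key, Prod.Lex.toLex_lt_toLex, first, second, if_pos u.2, if_pos v.2]
    omega

/-- Restriction undoes extension, which is therefore injective. -/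
theorem numOrders_le_of_extension {Y : Finset (Fin n)} {H : Digraph Y}
    (h : ∀ L : LinearOrder Y, Compatible H L →
      ∃ L' : LinearOrder (Fin n), Compatible G L' ∧ restrictOrder L' Y = L) :
    numOrders H ≤ numOrders G := by
  choose f hf1 hf2 using h
  refine Nat.card_le_card_of_injective (fun L : {L // Compatible H L} =>
    (⟨f L.1 L.2, hf1 L.1 L.2⟩ : {L // Compatible G L})) fun L L' h => ?_
  have : f L.1 L.2 = f L'.1 L'.2 := by simpa using h
  exact Subtype.ext (by rw [← hf2 L.1 L.2, this, hf2])

/-- The vertices of an acyclic graph can be numbered increasingly along the edges. -/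
theorem IsDag.exists_rank (hG : IsDag G) : ∃ rank : Fin n → ℕ, ∀ u v, G.Adj u v → rank u < rank v := by
  classical
  refine ⟨fun v => (Finset.univ.filter fun u => Relation.TransGen G.Adj u v).card, fun u v huv => ?_⟩
  refine Finset.card_lt_card ⟨fun z hz => ?_, fun hsub => ?_⟩
  · simp only [Finset.mem_filter, Finset.mem_univ, true_and] at hz ⊢
    exact hz.tail huv
  · have := hsub (x := u) (by simpa using Relation.TransGen.single huv)
    simp only [Finset.mem_filter, Finset.mem_univ, true_and] at this
    exact hG u this

end DagSort

/-! ### The theorem -/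

namespace ArrayLang

open WordRAM DagSort

/-- The complete preprocessing program. -/
def preprocessProgram : Cmd :=
  .seq (.assign 9 (.add (.add (.add (.reg 0) (.reg 1)) (.const 1))
    (.add (.add (.reg 0) (.reg 1)) (.const 1))))
  (.seq (.assign 4 (.reg 0))
  (.seq (.assign 5 (.reg 1))
  (.seq preprocessing.compile
  (.seq (.assign 1 (.mul (.const 13) (.reg 9))) (.assign 3 (.mul (.const 14) (.reg 9)))))))

/-- The complete sorting program. -/
def sortProgram : Cmd := .seq sorting.compile (.assign 1 (.mul (.const 9) (.reg 9)))

theorem preprocessProgram_comparisonFree : preprocessProgram.ComparisonFree := by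
  simp [preprocessProgram, preprocessing, buildAdjacency, initQueue, topoSort, tracePath,
    scanNeighbors, markKept, pathEdges, keptEdges, outputEdge, keptVertices, ACmd.block,
    ACmd.compile, AExpr.compile, AExpr.address, Cmd.ComparisonFree, Expr.ComparisonFree]

/-! ### From edge lists to numbered edges -/

section EdgeList

variable {n : ℕ} {G : Digraph (Fin n)} {es : List (Fin n × Fin n)}

theorem exists_edgeArray (hG : IsDag G) (hes : IsEdgeList G es) :
    ∃ g : EdgeArray, g.n = n ∧ g.m = es.length ∧
      ∀ j (hj : j < es.length), g.tail j = (es[j].1 : ℕ) ∧ g.head j = (es[j].2 : ℕ) := by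
  obtain ⟨rank, hrank⟩ := hG.exists_rank
  let tail : ℕ → ℕ := fun j => if hj : j < es.length then es[j].1 else 0
  let head : ℕ → ℕ := fun j => if hj : j < es.length then es[j].2 else 0
  have ht : ∀ j (hj : j < es.length), tail j = (es[j].1 : ℕ) := fun j hj => dif_pos hj
  have hh : ∀ j (hj : j < es.length), head j = (es[j].2 : ℕ) := fun j hj => dif_pos hj
  refine ⟨⟨n, es.length, tail, head, fun x => if h : x < n then rank ⟨x, h⟩ else 0,
    fun j hj => by rw [ht j hj]; exact es[j].1.2, fun j hj => by rw [hh j hj]; exact es[j].2.2,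
    fun i hi j hj h1 h2 => ?_, fun j hj => ?_⟩, rfl, rfl, fun j hj => ⟨ht j hj, hh j hj⟩⟩
  · rw [ht i hi, ht j hj] at h1
    rw [hh i hi, hh j hj] at h2
    exact (hes.1.getElem_inj_iff).1 (Prod.ext (Fin.ext h1) (Fin.ext h2))
  · rw [ht j hj, hh j hj, dif_pos es[j].1.2, dif_pos es[j].2.2]
    exact hrank _ _ ((hes.2 _ _).1 (List.getElem_mem hj))

theorem encodeEdges_getElem? (l : List (ℕ × ℕ)) (j : ℕ) :
    (encodeEdges l)[j + j]? = l[j]?.map Prod.fst ∧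
      (encodeEdges l)[j + j + 1]? = l[j]?.map Prod.snd := by
  induction l generalizing j with
  | nil => simp [encodeEdges]
  | cons e l ih =>
    have h : encodeEdges (e :: l) = e.1 :: e.2 :: encodeEdges l := rfl
    rw [h]
    cases j with
    | zero => simp
    | succ j =>
      have h1 : j + 1 + (j + 1) = j + j + 1 + 1 := by omega
      rw [h1]
      simpa using ih j

theorem holds_writeArray (f : ℕ → ℕ) (l : List ℕ) : Holds (writeArray f 0 l) l := by
  intro i hi
  simp [writeArray, hi]

theorem exists_map_eq {α β : Type*} (f : α → β) (l : List β) (h : ∀ b ∈ l, ∃ a, f a = b) :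
    ∃ l' : List α, l'.map f = l := by
  induction l with
  | nil => exact ⟨[], rfl⟩
  | cons b l ih =>
    obtain ⟨a, rfl⟩ := h b List.mem_cons_self
    obtain ⟨l', rfl⟩ := ih fun b hb => h b (List.mem_cons_of_mem _ hb)
    exact ⟨a :: l', rfl⟩

theorem card_filter_range (n : ℕ) (p : ℕ → Prop) [DecidablePred p] :
    ((Finset.range n).filter p).card = (Finset.univ.filter fun x : Fin n => p x).card := by
  refine Finset.card_bij' (fun x hx => ⟨x, by simpa using (Finset.mem_filter.1 hx).1⟩)
    (fun x _ => x) ?_ ?_ ?_ ?_ <;> simp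

/-- The `k - 1` edges of the path have distinct heads. This is what makes the number of edges of the
output graph `O(m)` instead of `O(n + m)`. -/
theorem PathData.pred_le {g : EdgeArray} {lev : ℕ → ℕ} {k : ℕ} {P pos : ℕ → ℕ}
    (hP : PathData g lev k P pos) : k - 1 ≤ g.m := by
  have h : ∀ t, ∃ j, t < k - 1 → j < g.m ∧ g.head j = P (t + 1) := fun t => by
    by_cases ht : t < k - 1
    · obtain ⟨j, hj, -, h⟩ := hP.edge t (by omega)
      exact ⟨j, fun _ => ⟨hj, h⟩⟩
    · exact ⟨0, fun h => absurd h ht⟩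
  choose f hf using h
  have := Finset.card_le_card_of_injOn (s := Finset.range (k - 1)) (t := Finset.range g.m) f
    (fun t ht => by simpa using (hf t (by simpa using ht)).1) (fun s hs t ht hst => by
      simp only [Finset.coe_range, Set.mem_Iio] at hs ht
      have h1 := hP.pos_P (s + 1) (by omega)
      have h2 := hP.pos_P (t + 1) (by omega)
      rw [← (hf s hs).2, hst, (hf t ht).2, h2] at h1
      omega)
  simpa using this

end EdgeList

/-- The edge array `g` describes the graph `G` with edge list `es`. -/
structure Describes (g : EdgeArray) (G : Digraph (Fin g.n)) : Prop where
  adj : ∀ u v : Fin g.n, G.Adj u v ↔ ∃ j < g.m, g.tail j = u ∧ g.head j = v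

theorem describes_of_isEdgeList {g : EdgeArray} {G : Digraph (Fin g.n)}
    {es : List (Fin g.n × Fin g.n)} (hes : IsEdgeList G es) (hm : g.m = es.length)
    (h : ∀ j (hj : j < es.length), g.tail j = (es[j].1 : ℕ) ∧ g.head j = (es[j].2 : ℕ)) :
    Describes g G := by
  refine ⟨fun u v => ?_⟩
  rw [← hes.2, List.mem_iff_getElem, hm]
  constructor
  · rintro ⟨j, hj, h1⟩
    exact ⟨j, hj, by rw [(h j hj).1, h1], by rw [(h j hj).2, h1]⟩
  · rintro ⟨j, hj, h1, h2⟩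
    rw [(h j hj).1] at h1
    rw [(h j hj).2] at h2
    exact ⟨j, hj, Prod.ext (Fin.ext h1) (Fin.ext h2)⟩

theorem inputState_mem {n : ℕ} {es : List (Fin n × Fin n)} {j : ℕ} (hj : j < es.length) :
    (inputState n es).mem (j + j) = es[j].1 ∧ (inputState n es).mem (j + j + 1) = es[j].2 := by
  have h1 := holds_writeArray (fun _ => 0) (encodeEdges (es.map fun e => (e.1.val, e.2.val)))
  have h2 := encodeEdges_getElem? (es.map fun e => (e.1.val, e.2.val)) j
  have h3 := length_encodeEdges (es.map fun e => (e.1.val, e.2.val))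
  rw [List.length_map] at h3
  have h4 := h1 (j + j) (by omega)
  have h5 := h1 (j + j + 1) (by omega)
  rw [List.getElem?_eq_getElem (i := j + j) (by omega),
    List.getElem?_eq_getElem (i := j + j + 1) (by omega),
    List.getElem?_eq_getElem (i := j) (by simpa using hj)] at h2
  simp only [Option.map_some, Option.some.injEq, List.getElem_map] at h2
  exact ⟨h4.trans h2.1, h5.trans h2.2⟩

theorem inputState_mem_of_le {n : ℕ} {es : List (Fin n × Fin n)} {a : ℕ}
    (ha : 2 * es.length ≤ a) : (inputState n es).mem a = 0 := by
  simp only [inputState, writeArray]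
  rw [dif_neg]
  rw [length_encodeEdges, List.length_map]
  omega

/-! ### The counting bounds for the computed path and kept vertices -/

section Math

variable {g : EdgeArray} {G : Digraph (Fin g.n)} {lev : ℕ → ℕ} {k : ℕ}
  {P pos mark : ℕ → ℕ} {hl : List (ℕ × ℕ)}

/-- The path meets every level: `P (lev x - 1)` is on the level of `x`. -/
theorem two_pow_card_le_numOrders (hG : Describes g G) (hP : PathData g lev k P pos) :
    2 ^ ((Finset.range g.n).filter fun x => pos x = 0).card ≤ numOrders G := by
  rw [card_filter_range]
  have h := two_pow_le_numOrders (G := G) (fun x => lev x) (fun x => pos x ≠ 0) (fun u v huv => ?_)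
    fun x => ?_
  · simpa using h
  · obtain ⟨j, hj, h1, h2⟩ := (hG.adj u v).1 huv
    rw [← h1, ← h2]
    exact hP.lev_up j hj
  · have h1 := hP.lev_pos x x.2
    have h2 := hP.lev_le x x.2
    refine ⟨⟨P (lev x - 1), hP.P_lt _ (by omega)⟩, ?_, ?_⟩
    · have := hP.pos_P (lev x - 1) (by omega)
      dsimp only
      omega
    · have := hP.lev_P (lev x - 1) (by omega)
      dsimp only
      omega

/-- The kept vertices. -/
def keptSet (n : ℕ) (mark : ℕ → ℕ) : Finset (Fin n) := Finset.univ.filter fun x => mark x ≠ 0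

theorem mem_keptSet {n : ℕ} {mark : ℕ → ℕ} {x : Fin n} : x ∈ keptSet n mark ↔ mark x ≠ 0 := by
  simp [keptSet]

theorem MarkData.keptVertices (hG : Describes g G) (hP : PathData g lev k P pos)
    (hM : MarkData g P pos mark) : KeptVertices G (fun x => pos x) (keptSet g.n mark) := by
  refine ⟨fun x hx => mem_keptSet.2 (hM.nonpath x x.2 hx), fun u v huv h1 h2 => ?_,
    fun u v huv h1 h2 => ?_, fun u v huv h1 h2 => ?_,
    fun u v h1 h2 => Fin.ext (hP.pos_inj u.2 v.2 h1 h2)⟩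
  · obtain ⟨e, he, h3, h4⟩ := (hG.adj u v).1 huv
    obtain ⟨e', he', h5, h6, h7⟩ := hM.before e he (h3 ▸ h1) (h4 ▸ h2)
    exact ⟨⟨g.tail e', g.tail_lt e' he'⟩, mem_keptSet.2 h7,
      (hG.adj _ _).2 ⟨e', he', rfl, h5.trans h4⟩, h3 ▸ h6⟩
  · obtain ⟨e, he, h3, h4⟩ := (hG.adj u v).1 huv
    obtain ⟨e', he', h5, h6, h7, h8⟩ := hM.after e he (h3 ▸ h1) (h4 ▸ h2)
    exact ⟨⟨g.head e', g.head_lt e' he'⟩, mem_keptSet.2 h8,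
      (hG.adj _ _).2 ⟨e', he', h5.trans h3, rfl⟩, h6, h4 ▸ h7⟩
  · obtain ⟨e, he, h3, h4⟩ := (hG.adj u v).1 huv
    have h5 := hP.lev_up e he
    -- On the path, positions agree with levels, and levels increase along edges.
    have key : ∀ x < g.n, pos x ≠ 0 → lev x = pos x := fun x hx h0 => by
      have h6 := hP.pos_le x hx
      have h7 := hP.lev_P (pos x - 1) (by omega)
      rw [hP.P_pos x hx h0] at h7
      omega
    rw [h3, h4, key _ u.2 h1, key _ v.2 h2] at h5
    exact h5

/-- The ranks of the items in a linear order, as a function of numbers. -/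
noncomputable def natRank {n : ℕ} (L : LinearOrder (Fin n)) (x : ℕ) : ℕ :=
  if h : x < n then orderRank L ⟨x, h⟩ else 0

@[simp] theorem natRank_val {n : ℕ} (L : LinearOrder (Fin n)) (x : Fin n) :
    natRank L x = orderRank L x := by
  simp [natRank]

theorem natRank_lt_iff {n : ℕ} (L : LinearOrder (Fin n)) (x y : Fin n) :
    natRank L x < natRank L y ↔ L.lt x y := by
  rw [natRank_val, natRank_val, orderRank_lt_iff]

theorem natRank_up (hG : Describes g G) {L : LinearOrder (Fin g.n)} (hL : Compatible G L) :
    ∀ j < g.m, natRank L (g.tail j) < natRank L (g.head j) := fun j hj =>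
  (natRank_lt_iff L ⟨_, g.tail_lt j hj⟩ ⟨_, g.head_lt j hj⟩).2
    (hL _ _ ((hG.adj _ _).2 ⟨j, hj, rfl, rfl⟩))

theorem lt_of_pos_lt (hG : Describes g G) (hP : PathData g lev k P pos)
    {L : LinearOrder (Fin g.n)} (hL : Compatible G L) (u v : Fin g.n) (h0 : pos u ≠ 0)
    (huv : pos u < pos v) : L.lt u v := by
  rw [← natRank_lt_iff]
  have h1 := hP.pos_le v v.2
  have h2 := hP.rank_lt (natRank_up hG hL) (s := pos u - 1) (t := pos v - 1) (by omega) (by omega)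
  rwa [hP.P_pos u u.2 h0, hP.P_pos v v.2 (by omega)] at h2

/-- The output graph with edge list `hs`. -/
def edgeGraph {V : Type*} (hs : List (V × V)) : Digraph V := ⟨fun u v => (u, v) ∈ hs⟩

/-- The edges of the output graph are either edges of `G` or lead forward along the path, which is
increasing in `L`. -/
theorem compatible_restrict (hG : Describes g G) (hP : PathData g lev k P pos)
    (hO : OutputEdges g k pos mark g.m hl) {Y : Finset (Fin g.n)} {hs : List (Y × Y)}
    (hhs : (hs.map fun e => (e.1.val.val, e.2.val.val)) = hl) {L : LinearOrder (Fin g.n)}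
    (hL : Compatible G L) : Compatible (edgeGraph hs) (restrictOrder L Y) := by
  intro u v huv
  have h1 : ((u : Fin g.n).val, (v : Fin g.n).val) ∈ hl := by
    rw [← hhs]
    exact List.mem_map_of_mem (f := fun e : Y × Y => (e.1.val.val, e.2.val.val)) huv
  obtain ⟨-, -, -, -, ⟨h2, -, h3⟩ | ⟨-, e, he, h2, h3⟩⟩ := hO.sound _ _ h1
  · exact lt_of_pos_lt hG hP hL u v h2 h3
  · exact hL _ _ ((hG.adj _ _).2 ⟨e, he, h2, h3⟩)

theorem exists_extension (hG : Describes g G) (hP : PathData g lev k P pos)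
    (hM : MarkData g P pos mark)
    (hO : OutputEdges g k pos mark g.m hl)
    {hs : List (keptSet g.n mark × keptSet g.n mark)}
    (hhs : (hs.map fun e => (e.1.val.val, e.2.val.val)) = hl)
    (L : LinearOrder (keptSet g.n mark)) (hL : Compatible (edgeGraph hs) L) :
    ∃ L' : LinearOrder (Fin g.n), Compatible G L' ∧ restrictOrder L' (keptSet g.n mark) = L := by
  have hmem : ∀ u v : keptSet g.n mark, (u.val.val, v.val.val) ∈ hl → L.lt u v := by
    intro u v huv
    rw [← hhs, List.mem_map] at huv
    obtain ⟨⟨a, b⟩, hab, h⟩ := huv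
    simp only [Prod.mk.injEq] at h
    have h1 : a = u := Subtype.ext (Fin.ext h.1)
    have h2 : b = v := Subtype.ext (Fin.ext h.2)
    subst h1 h2
    exact hL _ _ hab
  refine (hM.keptVertices hG hP).exists_extension L (fun u v huv h0 => ?_) fun u v h0 huv => ?_
  · obtain ⟨e, he, h1, h2⟩ := (hG.adj _ _).1 huv
    refine hmem u v ?_
    rw [← h1, ← h2]
    refine hO.edge e he ?_ ?_ ?_
    · rw [h1]; exact mem_keptSet.1 u.2
    · rw [h2]; exact mem_keptSet.1 v.2
    · rw [h1, h2]; exact h0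
  -- `OutputEdges.path` is applied to the relation `<` of `L`, transferred to numbers: it is
  -- transitive and contains all edges of the output graph.
  · let R : ℕ → ℕ → Prop := fun a b => ∃ x y : keptSet g.n mark,
      x.val.val = a ∧ y.val.val = b ∧ L.lt x y
    have hR : R u.val.val v.val.val := by
      refine hO.path R ?_ (fun a b hab => ?_) _ u.val.2 _ v.val.2 (mem_keptSet.1 u.2)
        (mem_keptSet.1 v.2) h0 huv
      · rintro a b c ⟨x, y, rfl, rfl, h1⟩ ⟨y', z, h2, rfl, h3⟩
        have : y' = y := Subtype.ext (Fin.ext h2)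
        subst this
        exact ⟨x, z, rfl, rfl, @lt_trans _ L.toPreorder _ _ _ h1 h3⟩
      · obtain ⟨h1, h2, h3, h4, -⟩ := hO.sound a b hab
        exact ⟨⟨⟨a, h1⟩, mem_keptSet.2 h3⟩, ⟨⟨b, h2⟩, mem_keptSet.2 h4⟩, rfl, rfl, hmem _ _ hab⟩
    obtain ⟨x, y, h1, h2, h3⟩ := hR
    have h4 : x = u := Subtype.ext (Fin.ext h1)
    have h5 : y = v := Subtype.ext (Fin.ext h2)
    subst h4 h5
    exact h3

open Classical in
/-- The run length of a vertex outside the path, as a function of numbers. -/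
noncomputable def natRun {n : ℕ} (L : LinearOrder (Fin n)) (pos mark : ℕ → ℕ) (x : ℕ) : ℕ :=
  if h : x < n then if pos x = 0 then runLength L (keptSet n mark) ⟨x, h⟩ else 0 else 0

/-- An item `y` of the run below `x` is not kept, as it would have to be above itself; so it is on
the path. An edge from `y` to `x` would give a kept predecessor `q` of `x` at or after `y` on the
path, whereas the run lies above every kept item below `x`. -/
theorem prod_natRun_le_numOrders (hG : Describes g G) (hP : PathData g lev k P pos)
    (hM : MarkData g P pos mark) {L : LinearOrder (Fin g.n)} (hL : Compatible G L) :
    ∏ x : Fin g.n, (natRun L pos mark x + 1) ≤ numOrders G := by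
  refine prod_le_numOrders L hL (fun x => pos x = 0) _ (fun x t ht htD => ?_) fun x hx => ?_
  · by_cases h0 : pos x = 0
    · simp only [natRun, Fin.is_lt, dif_pos, h0, if_true] at htD
      obtain ⟨y, h1, h2, h3⟩ := exists_of_le_runLength L _ x t ht htD
      have hy0 : ¬ pos y = 0 := fun h4 =>
        @lt_irrefl _ L.toPreorder _ (h3 y (mem_keptSet.2 (hM.nonpath y y.2 h4)) h2)
      refine ⟨y, h1, hy0, fun hyx => ?_⟩
      obtain ⟨q, hq, hqx, hyq⟩ := (hM.keptVertices hG hP).before y x hyx hy0 h0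
      have h4 : L.lt q y := h3 q hq (hL q x hqx)
      rcases Nat.eq_or_lt_of_le hyq with h5 | h5
      · have h6 : y = q := Fin.ext (hP.pos_inj y.2 q.2 hy0 h5)
        subst h6
        exact @lt_irrefl _ L.toPreorder _ h4
      · exact @lt_asymm _ L.toPreorder _ _ h4 (lt_of_pos_lt hG hP hL y q hy0 h5)
    · simp only [natRun, Fin.is_lt, dif_pos, h0, if_false] at htD
      omega
  · simp [natRun, hx]

theorem sortData (hG : Describes g G) (hP : PathData g lev k P pos)
    (hM : MarkData g P pos mark) {L : LinearOrder (Fin g.n)} (hL : Compatible G L)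
    {l : List (Fin g.n)} (hlist : IsSortedListOf L (keptSet g.n mark) l) :
    SortData g k P pos (natRank L) (natRun L pos mark) (l.map fun x => x.val) := by
  refine ⟨fun x hx y hy hxy => ?_, natRank_up hG hL, ?_, ?_, fun x hx h0 => ?_, ?_⟩
  · rw [natRank, natRank, dif_pos hx, dif_pos hy] at hxy
    simpa using orderRank_injective L hxy
  · rw [List.pairwise_map]
    exact hlist.1.imp fun h => (natRank_lt_iff L _ _).2 h
  · simp
  · exact List.mem_map.2 ⟨⟨x, hx⟩, (hlist.2 _).2 (mem_keptSet.2 (hM.nonpath x hx h0)), rfl⟩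
  · intro y hy h0 j c h
    obtain ⟨y, hy', rfl⟩ := List.mem_map.1 hy
    classical
    simp only [natRun, Fin.is_lt, dif_pos, h0, if_true]
    -- `P` maps the indices from `j` to `c - 1` injectively into the run; the default value `y` is
    -- never taken.
    rw [← Nat.card_Ico j c, runLength]
    refine Finset.card_le_card_of_injOn
      (fun t => if ht : P t < g.n then ⟨P t, ht⟩ else y) (fun t ht => ?_) fun s hs t ht hst => ?_
    · simp only [Finset.coe_Ico, Set.mem_Ico] at ht
      obtain ⟨h1, h2, h3⟩ := h t ht.1 ht.2
      have h4 := hP.P_lt t h1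
      simp only [dif_pos h4, Finset.coe_filter, Finset.mem_univ, true_and, Set.mem_ofPred_eq]
      refine ⟨(natRank_lt_iff L ⟨P t, h4⟩ y).1 h2, fun w hw hwy => ?_⟩
      exact (natRank_lt_iff L w ⟨P t, h4⟩).1 (h3 w (List.mem_map.2 ⟨w, (hlist.2 _).2 hw, rfl⟩)
        ((natRank_lt_iff L w y).2 hwy))
    · simp only [Finset.coe_Ico, Set.mem_Ico] at hs ht
      have h1 := (h t ht.1 ht.2).1
      have h2 := (h s hs.1 hs.2).1
      have h3 := hP.P_lt t h1
      have h4 := hP.P_lt s h2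
      simp only [dif_pos h3, dif_pos h4, Fin.mk.injEq] at hst
      have h5 := hP.pos_P t h1
      have h6 := hP.pos_P s h2
      rw [hst] at h6
      omega

/-- Rounding down gives `2 ^ ∑ ⌊log (D x + 1)⌋ ≤ ∏ (D x + 1) ≤ e(G)`, with `D` the run lengths. The
searches need twice this sum of logarithms, and each item adds one iteration. -/
theorem sum_insertCost_le (hG : Describes g G) (hP : PathData g lev k P pos)
    (hM : MarkData g P pos mark) {L : LinearOrder (Fin g.n)} (hL : Compatible G L)
    {l : List (Fin g.n)} (hl : l.Nodup) :
    (((l.map fun x => x.val).map (insertCost pos (natRun L pos mark))).sum : ℝ) ≤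
      l.length + 2 * Real.logb 2 (numOrders G) := by
  let S := ∑ x : Fin g.n, Nat.log 2 (natRun L pos mark x + 1)
  have h1 : 2 ^ S ≤ numOrders G := by
    refine le_trans ?_ (prod_natRun_le_numOrders hG hP hM hL)
    rw [← Finset.prod_pow_eq_pow_sum]
    exact Finset.prod_le_prod' fun x _ => Nat.pow_log_le_self 2 (by simp)
  have h2 := sum_log_le_log_numOrders h1
  have h3 : ((l.map fun x => x.val).map (insertCost pos (natRun L pos mark))).sum ≤
      l.length + 2 * S := by
    rw [List.map_map, ← List.sum_toFinset _ hl]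
    calc _ ≤ ∑ x ∈ l.toFinset, (1 + 2 * Nat.log 2 (natRun L pos mark x + 1)) :=
          Finset.sum_le_sum fun x _ => by
            simp only [Function.comp, insertCost]
            split_ifs <;> omega
      _ = l.length + 2 * ∑ x ∈ l.toFinset, Nat.log 2 (natRun L pos mark x + 1) := by
          rw [Finset.sum_add_distrib, ← Finset.mul_sum, Finset.sum_const,
            List.toFinset_card_of_nodup hl, smul_eq_mul, mul_one]
      _ ≤ _ := by
          have := Finset.sum_le_univ_sum_of_nonneg (s := l.toFinset)
            (f := fun x : Fin g.n => Nat.log 2 (natRun L pos mark x + 1)) fun _ => Nat.zero_le _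
          simp only [S]
          omega
  have h4 : (((l.map fun x => x.val).map (insertCost pos (natRun L pos mark))).sum : ℝ) ≤
      l.length + 2 * S := by exact_mod_cast h3
  linarith

end Math

theorem exists_isSortedListOf_univ {n : ℕ} (L : LinearOrder (Fin n)) :
    ∃ xs, IsSortedListOf L Finset.univ xs := by
  have h : ∀ i : Fin n, ∃ x, orderRank L x = i := fun i => exists_orderRank_eq L (by simp)
  choose f hf using h
  refine ⟨(List.finRange n).map f, ?_, fun x => ?_⟩
  · rw [List.pairwise_map]
    refine (List.pairwise_lt_finRange n).imp fun {a b} hab => (orderRank_lt_iff L).1 ?_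
    rw [hf, hf]
    exact hab
  · simp only [List.mem_map, List.mem_finRange, true_and, Finset.mem_univ, iff_true]
    exact ⟨⟨orderRank L x, by simpa using orderRank_lt_card L x⟩,
      orderRank_injective L (hf _)⟩

/-! ### Execution of the complete programs -/

section Programs

variable {g : EdgeArray} {G : Digraph (Fin g.n)} {lev : ℕ → ℕ} {k : ℕ}
  {P pos link mark : ℕ → ℕ} {ys : List ℕ} {hl : List (ℕ × ℕ)}

theorem Represents.assign {N W : ℕ} {ord : ℕ → ℕ → Bool} {s : State} {σ : AState}
    (h : Represents N s σ) {r : ℕ} (hr : r ≠ 9) (e : Expr) (he : e.Fits W ord s) :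
    ∃ s', Exec W ord (.assign r e) s s' (e.cost + 1) ∧
      Represents N s' (σ.setReg r (e.eval ord s)) := by
  refine ⟨_, .assign s r e he, ?_, ?_, h.mem⟩
  · simp [AState.setReg, h.reg]
  · simp [hr.symm, h.size]

theorem exec_preprocessProgram {W : ℕ} {ord : ℕ → ℕ → Bool} (hW : 20 * g.N ≤ W) {s : State}
    (h0 : s.reg 0 = g.n) (h1 : s.reg 1 = g.m)
    (ht : ∀ j < g.m, s.mem (j + j) = g.tail j) (hh : ∀ j < g.m, s.mem (j + j + 1) = g.head j)
    (hz : ∀ a, 2 * g.m ≤ a → s.mem a = 0) :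
    ∃ s' t lev k P pos link mark ys hl σ, Exec W ord preprocessProgram s s' t ∧
      t ≤ 30 + preprocessing.size * (7 * (g.n + g.m) + 1) ∧ Represents g.N s' σ ∧
      Preprocessed g lev k P pos link mark ys hl σ ∧
      s'.reg 1 = 13 * g.N ∧ s'.reg 3 = 14 * g.N := by
  have hN : g.N = 2 * (g.n + g.m + 1) := rfl
  -- Array programs need `N` in register `9` and cannot write it, so it is computed by a machine
  -- instruction.
  have e1 := Exec.assign (W := W) (ord := ord) s 9 (.add (.add (.add (.reg 0) (.reg 1)) (.const 1))
    (.add (.add (.reg 0) (.reg 1)) (.const 1))) (by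
      simp only [Expr.Fits, Expr.eval, h0, h1]
      refine ⟨⟨⟨trivial, trivial, ?_⟩, ?_, ?_⟩, ⟨⟨trivial, trivial, ?_⟩, ?_, ?_⟩, ?_⟩ <;> omega)
  have r1 : Represents g.N ⟨Function.update s.reg 9 g.N, s.mem⟩
      ⟨Function.update s.reg 9 g.N, fun k i => s.mem (k * g.N + i)⟩ :=
    ⟨rfl, by simp, fun k i _ => rfl⟩
  have hv : g.n + g.m + 1 + (g.n + g.m + 1) = g.N := by omega
  simp only [Expr.eval, h0, h1, hv] at e1
  obtain ⟨s2, e2, r2⟩ := r1.assign (W := W) (ord := ord) (r := 4) (by simp) (.reg 0) trivial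
  obtain ⟨s3, e3, r3⟩ := r2.assign (W := W) (ord := ord) (r := 5) (by simp) (.reg 1) trivial
  have w : WP g.N ord preprocessing _ _ := wp_preprocessing (g := g) (ord := ord)
    (σ := ((⟨Function.update s.reg 9 g.N, fun k i => s.mem (k * g.N + i)⟩ : AState).setReg 4
      (Expr.eval ord ⟨Function.update s.reg 9 g.N, s.mem⟩ (.reg 0))).setReg 5
        (Expr.eval ord s2 (.reg 1)))
    (Q := fun σ' n' => (∃ lev k P pos link mark ys hl,
      Preprocessed g lev k P pos link mark ys hl σ') ∧ n' ≤ 7 * (g.n + g.m))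
    ⟨by simp [Expr.eval, h0], by simp [Expr.eval, r2.reg, h1], fun j hj => by simp [ht j hj],
      fun j hj => by simpa using hh j hj⟩
    -- The edge list occupies `2 * m < N` cells, so it fits into array `0` and all other arrays
    -- start with zeros.
    (fun k hk i => by
      simp only [AState.setReg_arr]
      refine hz _ ?_
      have : 1 * g.N ≤ k * g.N := Nat.mul_le_mul_right _ hk
      omega)
    (fun σ' n' lev k P pos link mark ys hl h hn => ⟨⟨lev, k, P, pos, link, mark, ys, hl, h⟩, hn⟩)
  obtain ⟨σ4, n4, x4, ⟨lev, k, P, pos, link, mark, ys, hl, h4⟩, hn4⟩ := w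
  obtain ⟨s4, t4, e4, r4, ht4⟩ := x4.compile_spec (W := W) (by omega) hW r3
  have h9 : s4.reg 9 = g.N := by rw [r4.reg, r4.size]
  obtain ⟨s5, e5, r5⟩ := r4.assign (W := W) (ord := ord) (r := 1) (by simp)
    (.mul (.const 13) (.reg 9)) (by
      simp only [Expr.Fits, Expr.eval, h9]
      exact ⟨by omega, trivial, by omega⟩)
  have h9' : s5.reg 9 = g.N := by rw [r5.reg, r5.size]
  obtain ⟨s6, e6, r6⟩ := r5.assign (W := W) (ord := ord) (r := 3) (by simp)
    (.mul (.const 14) (.reg 9)) (by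
      simp only [Expr.Fits, Expr.eval, h9']
      exact ⟨by omega, trivial, by omega⟩)
  refine ⟨s6, _, lev, k, P, pos, link, mark, ys, hl, _, .seq e1 (.seq e2 (.seq e3 (.seq e4
    (.seq e5 e6)))), ?_, r6, ⟨h4.toPathData, h4.toPathLinks, h4.toStoresPath.congr (by simp)
      (by simp) (by simp) (by simp) (by simp) (by simp) (by simp), h4.toMarkData, h4.output,
      h4.nodup, h4.mem, by simpa using h4.r0, by simpa using h4.r2, by simpa using h4.vertices,
      by simpa using h4.edges⟩, ?_, ?_⟩
  · have h5 : preprocessing.size * (n4 + 1) ≤ preprocessing.size * (7 * (g.n + g.m) + 1) :=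
      Nat.mul_le_mul_left _ (by omega)
    simp only [Expr.cost]
    omega
  · simp [r6.reg, Expr.eval, h9]
  · simp [r6.reg, Expr.eval, h9']

theorem exec_sortProgram {W : ℕ} (hW : 20 * g.N ≤ W) {s : State} {σ : AState}
    (hs : Represents g.N s σ) (hG : Describes g G)
    (hp : Preprocessed g lev k P pos link mark ys hl σ) (h1 : s.reg 1 = 13 * g.N)
    {L : LinearOrder (Fin g.n)} (hL : Compatible G L) {l : List (Fin g.n)}
    (hlist : IsSortedListOf L (keptSet g.n mark) l) (hlen : l.length = ys.length) :
    ∃ (xs : List (Fin g.n)) (s' : State) (t : ℕ),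
      Exec W (oracle L) sortProgram ⟨s.reg, writeArray s.mem (s.reg 1) (l.map fun x => x.val)⟩ s' t ∧
      t ≤ 4 + sorting.size * (((l.map fun x => x.val).map
        (insertCost pos (natRun L pos mark))).sum + 1) ∧
      IsSortedListOf L Finset.univ xs ∧
      HoldsLinkedList s'.mem (s'.reg 1) g.n (s'.reg 0) (xs.map fun x => x.val) := by
  have hN : g.N = 2 * (g.n + g.m + 1) := rfl
  have hys : ys.length ≤ g.n :=
    length_le_of_nodup_of_lt hp.nodup fun x hx => ((hp.mem x).1 hx).1
  -- The sorted array of `Y` has at most `n < N` words, so writing it at address `13 * N` affects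
  -- array `13` only.
  let σ1 : AState := ⟨σ.reg, fun k => if k = 13 then
    writeArray (σ.arr 13) 0 (l.map fun x => x.val) else σ.arr k⟩
  have r1 : Represents g.N ⟨s.reg, writeArray s.mem (s.reg 1) (l.map fun x => x.val)⟩ σ1 := by
    refine ⟨hs.reg, hs.size, fun k i hi => ?_⟩
    have h2 := hs.mem k i hi
    by_cases hk : k = 13
    · subst hk
      simp only [σ1, writeArray, h1, if_true]
      simp [h2]
    · simp only [σ1, writeArray, h1, if_neg hk]
      rw [dif_neg, h2]
      rintro ⟨h3, h4⟩
      rw [List.length_map] at h4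
      refine hk (array_address_inj (i' := k * g.N + i - 13 * g.N) hi (by omega) (by omega)).1
  have hord : ∀ a < g.n, ∀ b < g.n, oracle L a b = true ↔ natRank L a < natRank L b := by
    intro a ha b hb
    rw [natRank_lt_iff L ⟨a, ha⟩ ⟨b, hb⟩]
    simp [oracle, ha, hb]
  have hD := sortData hG hp.toPathData hp.toMarkData hL hlist
  have w : WP g.N (oracle L) sorting σ1 _ := wp_sorting (Q := fun σ' n' =>
      (σ'.reg 0 = σ'.arr 9 g.n ∧ Linked (natRank L) g.n (fun x => x < g.n) (σ'.arr 9)) ∧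
      n' ≤ ((l.map fun x => x.val).map (insertCost pos (natRun L pos mark))).sum)
    hp.toPathData hp.toPathLinks hD
    (hp.toStoresPath.congr rfl rfl rfl (by simp [σ1]) (by simp [σ1]) (by simp [σ1]) (by simp [σ1]))
    (by simp [σ1, hp.r0, hlen]) (by simpa [σ1] using holds_writeArray _ _) hord
    (fun σ' n' h2 h3 h4 => ⟨⟨h2, h3⟩, h4⟩)
  obtain ⟨σ2, n2, x2, ⟨h2, h3⟩, hn2⟩ := w
  obtain ⟨s2, t2, e2, r2, ht2⟩ := x2.compile_spec (W := W) (by omega) hW r1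
  have h9 : s2.reg 9 = g.N := by rw [r2.reg, r2.size]
  obtain ⟨s3, e3, r3⟩ := r2.assign (W := W) (ord := oracle L) (r := 1) (by simp)
    (.mul (.const 9) (.reg 9)) (by
      simp only [Expr.Fits, Expr.eval, h9]
      exact ⟨by omega, trivial, by omega⟩)
  obtain ⟨xs, hxs⟩ := exists_isSortedListOf_univ L
  refine ⟨xs, s3, _, .seq e2 e3, ?_, hxs, ?_⟩
  · have h4 := Nat.mul_le_mul_left sorting.size (Nat.add_le_add_right hn2 1)
    simp only [Expr.cost]
    omega
  · have h4 : s3.reg 1 = 9 * g.N := by simp [r3.reg, Expr.eval, h9]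
    have h5 : s3.reg 0 = σ2.arr 9 g.n := by simp [r3.reg, h2]
    rw [h4, h5]
    refine h3.holdsLinkedList (fun x hx => hx) (fun x hx => ?_) _ g.n (.inl rfl) ?_ fun z => ?_
    · rw [r3.mem 9 x (by omega)]
      simp
    · rw [List.pairwise_map]
      exact hxs.1.imp fun h => (natRank_lt_iff L _ _).2 h
    · rw [List.mem_map]
      exact ⟨fun ⟨x, _, h⟩ => ⟨h ▸ x.2, .inl rfl⟩,
        fun h => ⟨⟨z, h.1⟩, (hxs.2 _).2 (Finset.mem_univ _), rfl⟩⟩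

end Programs

end ArrayLang

/-- Vertices are numbered `0, …, n - 1`. There are a comparison-free preprocessing program, a sorting
program and a constant `C` that work for every DAG, every edge list of it, and every word length `w`
with `2 ^ w ≥ C (n + m + 1)`. -/
theorem mainTheorem5 :
    ∃ (preprocess sort : WordRAM.Cmd) (C : ℕ), preprocess.ComparisonFree ∧
      ∀ (n : ℕ) (G : Digraph (Fin n)) (es : List (Fin n × Fin n)) (w : ℕ),
        DagSort.IsDag G → DagSort.IsEdgeList G es → C * (n + es.length + 1) ≤ 2 ^ w →
        ∃ (Y : Finset (Fin n)) (H : Digraph Y) (ys : List (Fin n)) (hs : List (Y × Y))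
          (s₁ : WordRAM.State) (t₁ : ℕ),
          -- the preprocessing phase: it takes time `O(n + m)` and outputs `Y` and `H`
          WordRAM.Exec (2 ^ w) (fun _ _ => false) preprocess (WordRAM.inputState n es) s₁ t₁ ∧
          t₁ ≤ C * (n + es.length + 1) ∧
          (ys.Nodup ∧ ∀ x, x ∈ ys ↔ x ∈ Y) ∧
          s₁.reg 0 = ys.length ∧
          WordRAM.HoldsArray s₁.mem (s₁.reg 1) (ys.map fun x => x.val) ∧
          DagSort.IsEdgeList H hs ∧
          s₁.reg 2 = hs.length ∧
          WordRAM.HoldsArray s₁.mem (s₁.reg 3)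
            (WordRAM.encodeEdges (hs.map fun e => (e.1.val.val, e.2.val.val))) ∧
          -- the sizes of `Y` and `H`
          (Y.card : ℝ) ≤ C * Real.logb 2 (DagSort.numOrders G) ∧
          hs.length ≤ C * es.length ∧
          -- the compatible orders of `H` are exactly the restrictions of those of `G`
          (∀ L : LinearOrder (Fin n), DagSort.Compatible G L →
            DagSort.Compatible H (DagSort.restrictOrder L Y)) ∧
          (∀ L' : LinearOrder Y, DagSort.Compatible H L' →
            ∃ L : LinearOrder (Fin n), DagSort.Compatible G L ∧ DagSort.restrictOrder L Y = L') ∧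
          DagSort.numOrders H ≤ DagSort.numOrders G ∧
          -- the sorting phase: started after preprocessing, with the array of `Y` replaced by the
          -- sorted array of `Y`, it outputs the sorted linked list of all items
          ∀ L : LinearOrder (Fin n), DagSort.Compatible G L →
            ∀ l : List (Fin n), DagSort.IsSortedListOf L Y l →
            ∃ (xs : List (Fin n)) (s₂ : WordRAM.State) (t₂ : ℕ),
              WordRAM.Exec (2 ^ w) (WordRAM.oracle L) sort
                ⟨s₁.reg, WordRAM.writeArray s₁.mem (s₁.reg 1) (l.map fun x => x.val)⟩ s₂ t₂ ∧
              (t₂ : ℝ) ≤ C * (1 + Real.logb 2 (DagSort.numOrders G)) ∧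
              DagSort.IsSortedListOf L Finset.univ xs ∧
              WordRAM.HoldsLinkedList s₂.mem (s₂.reg 1) n (s₂.reg 0) (xs.map fun x => x.val) := by
  refine ⟨ArrayLang.preprocessProgram, ArrayLang.sortProgram,
    -- The factor `7` comes from the `7 * (n + m)` iterations of preprocessing. The factor `5` comes
    -- from sorting: `|Y| ≤ 3 * log e(G)` plus `2 * log e(G)` for the searches. The `100` covers the
    -- additive constants and the memory of `20 * N = 40 * (n + m + 1)` cells.
    7 * ArrayLang.preprocessing.size + 5 * ArrayLang.sorting.size + 100,
    ArrayLang.preprocessProgram_comparisonFree, fun n G es w hdag hes hw => ?_⟩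
  obtain ⟨g, rfl, hm, hth⟩ := ArrayLang.exists_edgeArray hdag hes
  have hG : ArrayLang.Describes g G := ArrayLang.describes_of_isEdgeList hes hm hth
  rw [← hm] at hw ⊢
  -- The program sizes matter only as constants independent of the graph.
  generalize hc1 : ArrayLang.preprocessing.size = c1 at hw ⊢
  generalize hc2 : ArrayLang.sorting.size = c2 at hw ⊢
  have hN : g.N = 2 * (g.n + g.m + 1) := rfl
  have hW : 20 * g.N ≤ 2 ^ w := le_trans (by rw [hN]; nlinarith) hw
  obtain ⟨s₁, t₁, lev, k, P, pos, link, mark, ys, hl, σ, e1, ht1, r1, hp, hr1, hr3⟩ :=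
    ArrayLang.exec_preprocessProgram (W := 2 ^ w) (ord := fun _ _ => false) hW
      (s := WordRAM.inputState g.n es) rfl hm.symm
      (fun j hj => (ArrayLang.inputState_mem (hm ▸ hj)).1.trans (hth j (hm ▸ hj)).1.symm)
      (fun j hj => (ArrayLang.inputState_mem (hm ▸ hj)).2.trans (hth j (hm ▸ hj)).2.symm)
      fun a ha => ArrayLang.inputState_mem_of_le (hm ▸ ha)
  rw [hc1] at ht1
  have hkept := fun x : Fin g.n => ArrayLang.mem_keptSet (mark := mark) (x := x)
  obtain ⟨ys', rfl⟩ := ArrayLang.exists_map_eq (fun x : Fin g.n => x.val) ys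
    fun x hx => ⟨⟨x, ((hp.mem x).1 hx).1⟩, rfl⟩
  obtain ⟨hs, hhs⟩ := ArrayLang.exists_map_eq
    (fun e : ArrayLang.keptSet g.n mark × ArrayLang.keptSet g.n mark => (e.1.val.val, e.2.val.val))
    hl fun ⟨a, b⟩ hab => by
      obtain ⟨h1, h2, h3, h4, -⟩ := hp.output.sound a b hab
      exact ⟨(⟨⟨a, h1⟩, (hkept _).2 h3⟩, ⟨⟨b, h2⟩, (hkept _).2 h4⟩), rfl⟩
  have hlen : hs.length = hl.length := by rw [← hhs, List.length_map]
  have hlm : hl.length ≤ 2 * g.m := by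
    have := hp.output.length_le
    have := hp.toPathData.pred_le
    omega
  have hys : ys'.Nodup ∧ ∀ x, x ∈ ys' ↔ x ∈ ArrayLang.keptSet g.n mark := by
    refine ⟨hp.nodup.of_map, fun x => ?_⟩
    rw [hkept, ← List.mem_map_of_injective Fin.val_injective, hp.mem]
    simp
  have hcard : (ArrayLang.keptSet g.n mark).card = ys'.length := by
    rw [← List.toFinset_card_of_nodup hys.1]
    congr 1
    ext x
    simp [hys.2]
  have hlog : ((ArrayLang.keptSet g.n mark).card : ℝ) ≤
      3 * Real.logb 2 (DagSort.numOrders G) := by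
    have h1 := DagSort.sum_log_le_log_numOrders
      (ArrayLang.two_pow_card_le_numOrders hG hp.toPathData)
    have h2 := hp.toMarkData.card
    rw [ArrayLang.card_filter_range _ fun x => mark x ≠ 0] at h2
    have h3 : ((ArrayLang.keptSet g.n mark).card : ℝ) ≤
        3 * (((Finset.range g.n).filter fun x => pos x = 0).card : ℕ) := by exact_mod_cast h2
    linarith
  have hlog0 : 0 ≤ Real.logb 2 (DagSort.numOrders G) := by
    have : (0 : ℝ) ≤ ((ArrayLang.keptSet g.n mark).card : ℝ) := Nat.cast_nonneg _
    linarith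
  have hext := fun L hL => ArrayLang.exists_extension hG hp.toPathData hp.toMarkData hp.output hhs L hL
  refine ⟨ArrayLang.keptSet g.n mark, ArrayLang.edgeGraph hs, ys', hs, s₁, t₁, e1, ?_, hys, ?_,
    fun i hi => ?_, ⟨?_, fun u v => Iff.rfl⟩, ?_, ?_, ?_, ?_, fun L hL =>
      ArrayLang.compatible_restrict hG hp.toPathData hp.output hhs hL, hext,
    DagSort.numOrders_le_of_extension hext, fun L hL l hlist => ?_⟩
  · nlinarith
  · rw [r1.reg, hp.r0, List.length_map]
  · have h1 : ys'.length ≤ g.n := by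
      rw [← hcard]
      simpa using Finset.card_le_univ (ArrayLang.keptSet g.n mark)
    rw [hr1, r1.mem 13 i (by rw [List.length_map] at hi; omega)]
    exact hp.vertices i hi
  · exact List.Nodup.of_map _ (hhs ▸ hp.output.nodup)
  · rw [r1.reg, hp.r2, hlen]
  · rw [hhs, hr3]
    intro i hi
    have h1 := hp.output.length_le
    have h2 := hp.toPathData.k_le
    rw [r1.mem 14 i (by rw [ArrayLang.length_encodeEdges] at hi; omega)]
    exact hp.edges i hi
  · refine hlog.trans (mul_le_mul_of_nonneg_right ?_ hlog0)
    push_cast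
    linarith [Nat.cast_nonneg (α := ℝ) c1, Nat.cast_nonneg (α := ℝ) c2]
  · rw [hlen]
    nlinarith
  · have hnd : l.Nodup := hlist.1.imp fun h h' => by
      subst h'
      exact @lt_irrefl _ L.toPreorder _ h
    have hll : l.length = (ArrayLang.keptSet g.n mark).card := by
      rw [← List.toFinset_card_of_nodup hnd]
      congr 1
      ext x
      simp [hlist.2]
    obtain ⟨xs, s₂, t₂, e2, ht2, hxs, hx⟩ := ArrayLang.exec_sortProgram hW r1 hG hp hr1 hL hlist
      (by rw [hll, hcard, List.length_map])
    refine ⟨xs, s₂, t₂, e2, ?_, hxs, hx⟩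
    have h1 := ArrayLang.sum_insertCost_le hG hp.toPathData hp.toMarkData hL hnd
    rw [hll] at h1
    rw [hc2] at ht2
    have h2 : (t₂ : ℝ) ≤ 4 + c2 * ((((l.map fun x => x.val).map (ArrayLang.insertCost pos
        (ArrayLang.natRun L pos mark))).sum : ℕ) + 1) := by exact_mod_cast ht2
    have h3 := Nat.cast_nonneg (α := ℝ) c1
    have h4 := Nat.cast_nonneg (α := ℝ) c2
    push_cast
    nlinarith [mul_le_mul_of_nonneg_left (h1.trans (add_le_add_left hlog _)) h4,
      mul_nonneg h3 hlog0, mul_nonneg h4 hlog0]
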